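/- Let $(X,\mu)$ be a Lebesgue space with continuous probability measure (a standard Borel space with a non-atomic probability measure). A polymorphism $\Pi$ of $(X,\mu)$ is a measure $\nu$ on $X\times X$ (its bistochastic measure) both of whose marginals equal $\mu$; its value $\Pi(x)=\nu^x$ is the conditional measure of $\nu$ over $x$ with respect to the first projection. The product is $(\Pi_1\Pi_2)^x(A)=\int \Pi_1^y(A)\,d\Pi_2^x(y)$, a $\mu$-preserving map $T$ is identified with the image of $\mu$ under $x\mapsto(x,Tx)$, and weak convergence $\Pi_n\to\Pi$ means $\nu_n(A\times B)\to\nu(A\times B)$ for all measurable $A,B\subset X$. The polymorphism $\Pi$ is prime if every measurable partition invariant under $\Pi$ (almost every $\Pi(x)$ is concentrated on one element of the partition, which depends only on the element containing $x$) is trivial; it is mixing if its $n$-step transition probabilities converge to $\mu$, i.e. $W_\Pi^n f\to\int f\,d\mu$ in $L^2(\mu)$ for all $f\in L^2(\mu)$, where $W_\Pi f(x)=\int f\,d\Pi(x)$. Let $\Pi$ be prime and not mixing, let $M$ be the Markov measure on $X^{\mathbb Z}$ of the stationary Markov process $(\xi_n)_{n\in\mathbb Z}$ with two-dimensional distribution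 $\nu$, let $(X_-,M_-)$ be the quotient of $(X^{\mathbb Z},M)$ by the tail $\sigma$-field of the past $\bigcap_{n}\sigma(\xi_k:k\le -n)$, let $S_-$ be the automorphism of $(X_-,M_-)$ induced by the left shift, and let $\Lambda'$ be the polymorphism from $X_-$ to $X$ whose value at $x_-$ is the conditional distribution of $\xi_0$ given $x_-$. Then there is an isomorphism $Q:(X,\mu)\to(X_-,M_-)$ such that, for the automorphism $T=Q^{-1}S_-Q$ and the polymorphism $\Lambda=\Lambda' Q$ of $(X,\mu)$, one has $\Lambda\cdot T=\Pi\cdot\Lambda$ and, in the sense of weak convergence, $$\Lambda=\lim_{n\to\infty}\Pi^n T^{-n}.$$ Moreover $\Pi$ can be written as $\Pi=\Phi\cdot T$ with a polymorphism $\Phi$, and for every such $\Phi$ $$\Lambda=\lim_{n\to\infty}\Phi_0\Phi_1\cdots\Phi_n=\prod_{k=0}^{\infty}\Phi_k,\qquad \Phi_k=T^k\Phi T^{-k}.$$ -/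

import Mathlib

open MeasureTheory ProbabilityTheory Filter
open scoped Topology

noncomputable section

/-- A polymorphism of `(X, μ)` to itself with invariant measure `μ`, given by its bistochastic
measure on `X × X`, both of whose marginal projections are `μ`. -/
@[ext]
structure Polymorphism {X : Type*} [MeasurableSpace X] (μ : Measure X) where
  bistochastic : Measure (X × X)
  fst_eq : bistochastic.fst = μ
  snd_eq : bistochastic.snd = μ

namespace Polymorphism

section Basic

variable {X : Type*} [MeasurableSpace X] {μ : Measure X}

/-- The conjugate polymorphism: the two projections are exchanged. -/
def conj (P : Polymorphism μ) : Polymorphism μ where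
  bistochastic := P.bistochastic.map Prod.swap
  fst_eq := by rw [Measure.fst_map_swap, P.snd_eq]
  snd_eq := by rw [Measure.snd_map_swap, P.fst_eq]

/-- A measure-preserving map as a polymorphism: the image of `μ` under `x ↦ (x, f x)`. -/
def ofMap (f : X → X) (hf : MeasurePreserving f μ μ) : Polymorphism μ where
  bistochastic := μ.map (fun x => (x, f x))
  fst_eq := by
    have h : Measurable fun x => (x, f x) := measurable_id.prodMk hf.measurable
    rw [Measure.fst, Measure.map_map measurable_fst h]
    exact Measure.map_id
  snd_eq := by
    have h : Measurable fun x => (x, f x) := measurable_id.prodMk hf.measurable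
    rw [Measure.snd, Measure.map_map measurable_snd h]
    exact hf.map_eq

instance : One (Polymorphism μ) := ⟨ofMap id (MeasurePreserving.id μ)⟩

/-- Weak convergence of polymorphisms: convergence of the bistochastic measures on all
measurable rectangles. -/
def TendsWeakly (P : ℕ → Polymorphism μ) (Q : Polymorphism μ) : Prop :=
  ∀ A B : Set X, MeasurableSet A → MeasurableSet B →
    Tendsto (fun n => (P n).bistochastic.real (A ×ˢ B)) atTop
      (𝓝 (Q.bistochastic.real (A ×ˢ B)))

end Basic

section Glue

variable {X : Type*} [MeasurableSpace X]

/-- A two-sided sequence made of the forward sequence `w.1` and the backward sequence `w.2`. -/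
def glue {X : Type*} (w : (ℕ → X) × (ℕ → X)) : ℤ → X
  | Int.ofNat n => w.1 n
  | Int.negSucc n => w.2 (n + 1)

lemma measurable_glue : Measurable (glue (X := X)) := by
  refine measurable_pi_lambda _ fun n => ?_
  cases n with
  | ofNat n => exact (measurable_pi_apply n).comp measurable_fst
  | negSucc n => exact (measurable_pi_apply (n + 1)).comp measurable_snd

end Glue

section Product

variable {X : Type*} [MeasurableSpace X] [StandardBorelSpace X] [Nonempty X]
  {μ : Measure X} [IsProbabilityMeasure μ]

instance (P : Polymorphism μ) : IsProbabilityMeasure P.bistochastic := by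
  have : IsProbabilityMeasure P.bistochastic.fst := by rw [P.fst_eq]; infer_instance
  exact ⟨by rw [← Measure.fst_univ]; exact measure_univ⟩

/-- The values `x ↦ ν^x` of a polymorphism (its transition probabilities): the conditional
measures of the bistochastic measure with respect to the first projection. -/
def value (P : Polymorphism μ) : Kernel X X := P.bistochastic.condKernel

instance (P : Polymorphism μ) : IsMarkovKernel P.value := by
  unfold value; infer_instance

lemma compProd_value (P : Polymorphism μ) : μ ⊗ₘ P.value = P.bistochastic := by
  have h := P.bistochastic.disintegrate P.bistochastic.condKernel
  rwa [P.fst_eq] at h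

lemma value_comp (P : Polymorphism μ) : P.value ∘ₘ μ = μ := by
  rw [← Measure.snd_compProd, compProd_value, P.snd_eq]

/-- The product: `(P Q)^x (A) = ∫ P^y (A) dQ^x (y)`, i.e. first `Q` and then `P`. -/
instance : Mul (Polymorphism μ) where
  mul P Q :=
    { bistochastic := μ ⊗ₘ (P.value ∘ₖ Q.value)
      fst_eq := Measure.fst_compProd _ _
      snd_eq := by
        rw [Measure.snd_compProd, ← Measure.comp_assoc, value_comp, value_comp] }

lemma mul_bistochastic (P Q : Polymorphism μ) :
    (P * Q).bistochastic = μ ⊗ₘ (P.value ∘ₖ Q.value) := rfl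

lemma value_ae_eq (P : Polymorphism μ) (κ : Kernel X X) [IsFiniteKernel κ]
    (h : P.bistochastic = μ ⊗ₘ κ) : κ =ᵐ[μ] P.value := by
  have := eq_condKernel_of_measure_eq_compProd (ρ := P.bistochastic) κ (by rw [P.fst_eq, h])
  rwa [P.fst_eq] at this

lemma value_mul (P Q : Polymorphism μ) : (P * Q).value =ᵐ[μ] P.value ∘ₖ Q.value :=
  (value_ae_eq _ _ (mul_bistochastic P Q)).symm

lemma value_one : (1 : Polymorphism μ).value =ᵐ[μ] (Kernel.id : Kernel X X) := by
  refine (value_ae_eq _ _ ?_).symm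
  rw [Measure.compProd_id]
  rfl

lemma comp_congr_left {κ η : Kernel X X} (h : κ =ᵐ[μ] η) (P : Polymorphism μ) :
    κ ∘ₖ P.value =ᵐ[μ] η ∘ₖ P.value := by
  have h' : ∀ᵐ y ∂(P.value ∘ₘ μ), κ y = η y := by rw [value_comp]; exact h
  filter_upwards [Measure.ae_ae_of_ae_comp h'] with x hx
  rw [Kernel.comp_apply, Kernel.comp_apply]
  exact Measure.bind_congr_right hx

lemma comp_congr_right {κ η : Kernel X X} (h : κ =ᵐ[μ] η) (P : Polymorphism μ) :
    P.value ∘ₖ κ =ᵐ[μ] P.value ∘ₖ η := by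
  filter_upwards [h] with x hx
  rw [Kernel.comp_apply, Kernel.comp_apply, hx]

/-- Polymorphisms of `(X, μ)` form a semigroup with unit. -/
instance : Monoid (Polymorphism μ) where
  mul_assoc P Q R := by
    ext1
    rw [mul_bistochastic, mul_bistochastic]
    refine Measure.compProd_congr ?_
    refine (comp_congr_left (value_mul P Q) R).trans ?_
    rw [Kernel.comp_assoc]
    exact (comp_congr_right (value_mul Q R) P).symm
  one_mul P := by
    ext1
    rw [mul_bistochastic, ← compProd_value P]
    refine Measure.compProd_congr ((comp_congr_left value_one P).trans ?_)
    rw [Kernel.id_comp]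
  mul_one P := by
    ext1
    rw [mul_bistochastic, ← compProd_value P]
    refine Measure.compProd_congr ((comp_congr_right value_one P).trans ?_)
    rw [Kernel.comp_id]

/-- Primality: every invariant measurable partition is trivial. A measurable partition is the
partition into the level sets of a measurable function `p`; it is invariant if for almost every
`x` the value `P^x` is concentrated on a single element `{p = g (p x)}` of the partition, which
depends only on the element that contains `x` (so that the factor of `P` by the partition is the
endomorphism `g`). -/
def IsPrime (P : Polymorphism μ) : Prop :=
  ∀ (p : X → ℝ) (g : ℝ → ℝ), Measurable p → Measurable g →
    (∀ᵐ x ∂μ, ∀ᵐ z ∂(P.value x), p z = g (p x)) → ∃ c : ℝ, ∀ᵐ x ∂μ, p x = c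

/-- Mixing in the sense of Markov processes: the `n`-step transition probabilities converge to
`μ`, i.e. `W^n f → ∫ f dμ` in `L²(μ)` for the Markov operator `(W f)(x) = ∫ f dP^x`
(tested on the indicator functions `f` of measurable sets, whose span is dense). -/
def IsMixing (P : Polymorphism μ) : Prop :=
  ∀ B : Set X, MeasurableSet B →
    Tendsto (fun n : ℕ => ∫ x, (((P ^ n).value x).real B - μ.real B) ^ 2 ∂μ) atTop (𝓝 0)

/-- The law on `X^ℕ` of the Markov chain started at `x`, with transition probabilities `P^x`. -/
def trajectory (P : Polymorphism μ) : Kernel X (ℕ → X) :=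
  (Kernel.traj (X := fun _ => X)
    (fun n => P.value.comap (fun h : (i : Finset.Iic n) → X => h ⟨n, by simp⟩)
      (measurable_pi_apply _)) 0).comap (fun x _ => x) (measurable_pi_lambda _ fun _ => measurable_id)

/-- The Markov measure on `X^ℤ` of the stationary Markov process with two-dimensional
distribution `P.bistochastic`: the state at time `0` has law `μ`, and given this state, the future
and the past are independent Markov chains that move according to the transition probabilities of
`P` and of its conjugate respectively. -/
def markovMeasure (P : Polymorphism μ) : Measure (ℤ → X) :=
  ((P.trajectory ×ₖ P.conj.trajectory) ∘ₘ μ).map glue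

end Product

section Tail

variable {X : Type*} [MeasurableSpace X]

/-- The tail `σ`-field of the past in `X^ℤ`: the intersection over `n` of the `σ`-fields generated
by the coordinates at the times `k ≤ -n`. -/
@[reducible]
def pastTail (X : Type*) [MeasurableSpace X] : MeasurableSpace (ℤ → X) :=
  ⨅ n : ℕ, ⨆ k : {k : ℤ // k ≤ -(n : ℤ)},
    MeasurableSpace.comap (fun y : ℤ → X => y k) inferInstance

/-- The left shift of `X^ℤ`. -/
def leftShift (y : ℤ → X) : ℤ → X := fun n => y (n + 1)

end Tail

section Past

variable {X : Type*} [MeasurableSpace X] [StandardBorelSpace X] [Nonempty X]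
  {μ : Measure X} [IsProbabilityMeasure μ]

instance (P : Polymorphism μ) : IsMarkovKernel P.trajectory := by
  unfold trajectory; infer_instance

instance (P : Polymorphism μ) : IsProbabilityMeasure P.markovMeasure := by
  unfold markovMeasure
  exact Measure.isProbabilityMeasure_map measurable_glue.aemeasurable

/-- `q : X^ℤ → X` represents an isomorphism `Q` (mod 0) of the state space `(X, μ)` onto the
quotient `(X_-, M_-)` of the path space by the tail `σ`-field of the past: `q` is the composition
of the projection onto `X_-` with `Q⁻¹`. That is, `q` is tail-measurable, carries the Markov
measure to `μ`, and every tail set is mod 0 the preimage of a measurable set. -/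
structure IsTailIsomorphism (P : Polymorphism μ) (q : (ℤ → X) → X) : Prop where
  measurable : Measurable[pastTail X] q
  map_eq : P.markovMeasure.map q = μ
  generates : ∀ A : Set (ℤ → X), MeasurableSet[pastTail X] A →
    ∃ B : Set X, MeasurableSet B ∧ A =ᵐ[P.markovMeasure] q ⁻¹' B

/-- The value at (the class in `X_-` of) `y` of the polymorphism `Λ'` from `X_-` to the state
space: the conditional distribution of the state at time `0` given the tail of the past. -/
def tailValue (P : Polymorphism μ) (y : ℤ → X) : Measure X :=
  (condExpKernel P.markovMeasure (pastTail X) y).map (fun z => z 0)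

/-- The partial products `Φ_0 Φ_1 ⋯ Φ_n` with `Φ_k = T^k Φ T^{-k}`. -/
def conjProd (Φ : Polymorphism μ) (T : X ≃ᵐ X) (hT : MeasurePreserving T μ μ) (n : ℕ) :
    Polymorphism μ :=
  ((List.range (n + 1)).map fun k =>
    ofMap T hT ^ k * Φ * ofMap T.symm (hT.symm T) ^ k).prod

end Past

end Polymorphism

end

open MeasureTheory ProbabilityTheory Filter
open scoped Topology ENNReal

noncomputable section

set_option linter.unusedSectionVars false

/-! Write `S` for the shift and `M` for the Markov measure. Choose a shift-equivariant tail map `q₀`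
into a standard Borel space `Z`, generating the tail of the past mod 0, and let `m` be its law. For
an embedding `ι` of `Z` into the unit interval put `v n z = ι (S^n z)`, and let `u n x` be the
conditional expectation of `v n (q₀ y)` given `y 0 = x`. By the Markov property, the expectation of
`ι ∘ q₀` given the coordinates at times `≥ -n` depends on `y (-n)` alone. Lévy's upward theorem and
stationarity then make `u n (y 0) - v n (q₀ y)` tend to 0 in `L¹`
(`tendsto_lintegral_edist_pastMean`). So the law of `(y 0, q₀ y)` is a coupling of `μ` and `m` that
asymptotically matches `u` with `v`.

Primality says that this coupling identifies only trivial sets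
(`IsPrime.measure_eq_zero_or_of_tail`): if a tail event is a function of the present, so are its
shifts, and the code of the present by these events defines an invariant partition. Non-mixing makes
`m` non-atomic (`IsPrime.nullSingletonClass_map`): an atom would be periodic by recurrence, hence a
tail event seen from the present, hence of full measure; the tail would be trivial, and a trivial
tail forces mixing (`isMixing_of_tail_trivial`).

The core is `IsAsymptoticCoupling.exists_measurableEquiv`: an asymptotic coupling of non-atomic
spaces that identifies only trivial sets can be replaced by an isomorphism `R` with `u n - v n ∘ R →
0` in `L¹`. Going to the other space and back and averaging the powers gives a self-coupling that
charges every product of non-null sets and asymptotically preserves `u`. With it, measures having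
equal masses on cells can be coupled inside the cells (`exists_coupling`), so a set of one space can
be matched with a set of the other at a cost small at all times (`exists_split_coupling_uniform`). A
back-and-forth construction with summable costs matches separating sequences of sets on both sides,
and equality of the resulting codes defines `R`.

Put `T = R⁻¹ S R` and `q = R⁻¹ ∘ q₀`. Then `T^n (y 0)` and `q (S^n y)` asymptotically agree. The
bistochastic measure of `P^n T^{-n}` is the law of `(T^n (y 0), y n)`, while that of `Λ` is the law
of `(q y, y 0)`, by stationarity also that of `(q (S^n y), y n)`. This gives the weak limit, and the
infinite product telescopes to the same powers. -/

/-! ### Gluing of couplings. -/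

/-- Two finite measures with the same first marginal are the two marginals of a measure on the
triple product. -/
lemma exists_gluing {X Y Z : Type*} [MeasurableSpace X] [MeasurableSpace Y] [MeasurableSpace Z]
    [StandardBorelSpace Y] [Nonempty Y] [StandardBorelSpace Z] [Nonempty Z]
    (a : Measure (X × Y)) (b : Measure (X × Z)) [IsFiniteMeasure a] [IsFiniteMeasure b]
    (h : a.fst = b.fst) :
    ∃ g : Measure (X × Y × Z), g.map (fun p => (p.1, p.2.1)) = a ∧
      g.map (fun p => (p.1, p.2.2)) = b := by
  refine ⟨a.fst ⊗ₘ (a.condKernel ×ₖ b.condKernel), ?_, ?_⟩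
  · have := Measure.compProd_map (μ := a.fst) (κ := a.condKernel ×ₖ b.condKernel)
      (f := (Prod.fst : Y × Z → Y)) measurable_fst
    rw [show (fun p : X × Y × Z => (p.1, p.2.1)) = Prod.map id Prod.fst from rfl, ← this,
      ← Kernel.fst_eq, Kernel.fst_prod, a.disintegrate]
  · have := Measure.compProd_map (μ := a.fst) (κ := a.condKernel ×ₖ b.condKernel)
      (f := (Prod.snd : Y × Z → Z)) measurable_snd
    rw [show (fun p : X × Y × Z => (p.1, p.2.2)) = Prod.map id Prod.snd from rfl, ← this,
      ← Kernel.snd_eq, Kernel.snd_prod, h, b.disintegrate]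

lemma measurable_edist_pair {X Y : Type*} [MeasurableSpace X] [MeasurableSpace Y] {u : X → ℝ}
    {v : Y → ℝ} (hu : Measurable u) (hv : Measurable v) :
    Measurable fun p : X × Y => edist (u p.1) (v p.2) :=
  (hu.comp measurable_fst).edist (hv.comp measurable_snd)

/-! ### Mean displacement under products and powers. -/

namespace Polymorphism

variable {X : Type*} [MeasurableSpace X] [StandardBorelSpace X] [Nonempty X]
  {μ : Measure X} [IsProbabilityMeasure μ]

lemma lintegral_bistochastic (P : Polymorphism μ) {f : X × X → ℝ≥0∞} (hf : Measurable f) :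
    ∫⁻ p, f p ∂P.bistochastic = ∫⁻ x, ∫⁻ y, f (x, y) ∂P.value x ∂μ := by
  rw [← P.compProd_value, Measure.lintegral_compProd hf]

lemma lintegral_snd (P : Polymorphism μ) {f : X → ℝ≥0∞} (hf : Measurable f) :
    ∫⁻ x, ∫⁻ y, f y ∂P.value x ∂μ = ∫⁻ x, f x ∂μ := by
  conv_rhs => rw [← P.snd_eq, Measure.snd, lintegral_map hf measurable_snd]
  rw [lintegral_bistochastic P (f := fun p => f p.2) (hf.comp measurable_snd)]

lemma lintegral_mul_bistochastic (P Q : Polymorphism μ) {f : X × X → ℝ≥0∞} (hf : Measurable f) :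
    ∫⁻ p, f p ∂(P * Q).bistochastic
      = ∫⁻ x, ∫⁻ y, ∫⁻ z, f (x, z) ∂P.value y ∂Q.value x ∂μ := by
  rw [mul_bistochastic, Measure.lintegral_compProd hf]
  refine lintegral_congr fun x => ?_
  exact Kernel.lintegral_comp _ _ _ (hf.comp measurable_prodMk_left)

/-- Triangle inequality through the intermediate state, which has law `μ` because `Q` preserves `μ`.
-/
lemma lintegral_edist_mul_le (P Q : Polymorphism μ) {u : X → ℝ} (hu : Measurable u) :
    ∫⁻ p, edist (u p.1) (u p.2) ∂(P * Q).bistochastic ≤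
      ∫⁻ p, edist (u p.1) (u p.2) ∂P.bistochastic +
        ∫⁻ p, edist (u p.1) (u p.2) ∂Q.bistochastic := by
  have hm := measurable_edist_pair hu hu
  rw [lintegral_mul_bistochastic P Q hm]
  calc ∫⁻ x, ∫⁻ y, ∫⁻ z, edist (u x) (u z) ∂P.value y ∂Q.value x ∂μ
      ≤ ∫⁻ x, ∫⁻ y, ((∫⁻ z, edist (u y) (u z) ∂P.value y) + edist (u x) (u y))
          ∂Q.value x ∂μ := by
        gcongr with x y
        calc ∫⁻ z, edist (u x) (u z) ∂P.value y
            ≤ ∫⁻ z, (edist (u y) (u z) + edist (u x) (u y)) ∂P.value y := by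
              gcongr with z
              rw [add_comm]; exact edist_triangle _ _ _
          _ = _ := by
              rw [lintegral_add_right _ measurable_const]; simp
    _ = _ := by
        have h1 : Measurable fun y => ∫⁻ z, edist (u y) (u z) ∂P.value y :=
          Measurable.lintegral_kernel_prod_right' hm
        have h2 : Measurable fun x => ∫⁻ y, edist (u x) (u y) ∂Q.value x :=
          Measurable.lintegral_kernel_prod_right' hm
        simp_rw [lintegral_add_left h1]
        rw [lintegral_add_right _ h2, lintegral_snd Q h1, lintegral_bistochastic P hm,
          lintegral_bistochastic Q hm]

lemma lintegral_edist_one {u : X → ℝ} (hu : Measurable u) :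
    ∫⁻ p, edist (u p.1) (u p.2) ∂(1 : Polymorphism μ).bistochastic = 0 := by
  change ∫⁻ p, edist (u p.1) (u p.2) ∂(μ.map fun x => (x, id x)) = 0
  rw [lintegral_map (measurable_edist_pair hu hu) (by fun_prop)]
  simp

lemma lintegral_edist_pow_le (P : Polymorphism μ) {u : X → ℝ} (hu : Measurable u) (k : ℕ) :
    ∫⁻ p, edist (u p.1) (u p.2) ∂(P ^ k).bistochastic ≤
      k * ∫⁻ p, edist (u p.1) (u p.2) ∂P.bistochastic := by
  induction k with
  | zero => simp [lintegral_edist_one hu]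
  | succ k ih =>
    rw [pow_succ]
    refine (lintegral_edist_mul_le _ _ hu).trans ?_
    push_cast
    rw [add_mul, one_mul]
    gcongr

lemma tsum_geometric_half : ∑' k : ℕ, (2⁻¹ : ℝ≥0∞) ^ (k + 1) = 1 := by
  rw [ENNReal.tsum_geometric_add_one, ENNReal.one_sub_inv_two, inv_inv]
  exact ENNReal.inv_mul_cancel (by simp) (by simp)

/-- The average of the powers of a polymorphism with geometric weights. -/
def geomMean (P : Polymorphism μ) : Polymorphism μ where
  bistochastic := Measure.sum fun k : ℕ => (2⁻¹ : ℝ≥0∞) ^ (k + 1) • (P ^ k).bistochastic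
  fst_eq := by
    rw [Measure.fst_sum]
    ext s hs
    rw [Measure.sum_apply _ hs]
    have : ∀ k : ℕ, (((2⁻¹ : ℝ≥0∞) ^ (k + 1) • (P ^ k).bistochastic).fst) s
        = (2⁻¹ : ℝ≥0∞) ^ (k + 1) * μ s := fun k => by
      rw [show μ s = (P ^ k).bistochastic.fst s by rw [(P ^ k).fst_eq], Measure.fst_apply hs, Measure.fst_apply hs]; simp
    simp_rw [this]
    rw [ENNReal.tsum_mul_right, tsum_geometric_half, one_mul]
  snd_eq := by
    rw [Measure.snd_sum]
    ext s hs
    rw [Measure.sum_apply _ hs]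
    have : ∀ k : ℕ, (((2⁻¹ : ℝ≥0∞) ^ (k + 1) • (P ^ k).bistochastic).snd) s
        = (2⁻¹ : ℝ≥0∞) ^ (k + 1) * μ s := fun k => by
      rw [show μ s = (P ^ k).bistochastic.snd s by rw [(P ^ k).snd_eq], Measure.snd_apply hs, Measure.snd_apply hs]; simp
    simp_rw [this]
    rw [ENNReal.tsum_mul_right, tsum_geometric_half, one_mul]

lemma tsum_geometric_mul_ne_top : ∑' k : ℕ, (2⁻¹ : ℝ≥0∞) ^ (k + 1) * k ≠ ∞ := by
  have h := (hasSum_coe_mul_geometric_of_norm_lt_one (𝕜 := ℝ) (r := 2⁻¹) (by norm_num)).summable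
  have h2 : Summable fun k : ℕ => (2⁻¹ : ℝ) ^ (k + 1) * k := by
    refine (h.mul_left 2⁻¹).congr fun k => ?_
    ring
  convert h2.tsum_ofReal_ne_top using 4 with k
  rw [ENNReal.ofReal_mul (by positivity), ENNReal.ofReal_pow (by positivity),
    ENNReal.ofReal_natCast, ENNReal.ofReal_inv_of_pos (by norm_num)]
  simp

/-- The `k`-th power costs at most `k` times the first, and the geometric weights have finite mean.
-/
lemma tendsto_lintegral_edist_geomMean (P : Polymorphism μ) {u : ℕ → X → ℝ}
    (hu : ∀ j, Measurable (u j))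
    (h : Tendsto (fun j => ∫⁻ p, edist (u j p.1) (u j p.2) ∂P.bistochastic) atTop (𝓝 0)) :
    Tendsto (fun j => ∫⁻ p, edist (u j p.1) (u j p.2) ∂P.geomMean.bistochastic) atTop (𝓝 0) := by
  have hle : ∀ j, ∫⁻ p, edist (u j p.1) (u j p.2) ∂P.geomMean.bistochastic ≤
      (∑' k : ℕ, (2⁻¹ : ℝ≥0∞) ^ (k + 1) * k) *
        ∫⁻ p, edist (u j p.1) (u j p.2) ∂P.bistochastic := fun j => by
    change ∫⁻ p, edist (u j p.1) (u j p.2)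
      ∂(Measure.sum fun k : ℕ => (2⁻¹ : ℝ≥0∞) ^ (k + 1) • (P ^ k).bistochastic) ≤ _
    rw [lintegral_sum_measure, ← ENNReal.tsum_mul_right]
    refine ENNReal.tsum_le_tsum fun k => ?_
    rw [lintegral_smul_measure, smul_eq_mul, mul_assoc]
    gcongr
    exact lintegral_edist_pow_le P (hu j) k
  refine tendsto_of_tendsto_of_tendsto_of_le_of_le tendsto_const_nhds ?_ (fun _ => zero_le)
    hle
  have := ENNReal.Tendsto.const_mul h (Or.inr tsum_geometric_mul_ne_top)
  simpa using this

/-- If the only sets that a symmetric polymorphism preserves are trivial, all products of two sets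
of positive measure are charged by the mean of its powers. -/
lemma geomMean_pos (P : Polymorphism μ)
    (hinv : ∀ N : Set X, MeasurableSet N → P.bistochastic (N ×ˢ Nᶜ) = 0 → μ N = 0 ∨ μ Nᶜ = 0)
    {A B : Set X} (hA : MeasurableSet A) (hB : MeasurableSet B) (hA0 : μ A ≠ 0) (hB0 : μ B ≠ 0) :
    P.geomMean.bistochastic (A ×ˢ B) ≠ 0 := by
  -- The points that never reach `B`. The chain cannot leave `N`, so `N` is null or conull; since
  -- the power `k = 0` is included, a conull `N` would make `B` null.
  set N : Set X := {x | ∀ k : ℕ, (P ^ k).value x B = 0} with hN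
  have hNm : MeasurableSet N := by
    rw [hN, Set.ofPred_forall]
    exact MeasurableSet.iInter fun k =>
      (Kernel.measurable_coe _ hB) (measurableSet_singleton 0)
  have h1 : P.bistochastic (N ×ˢ Nᶜ) = 0 := by
    rw [← P.compProd_value, Measure.compProd_apply_prod hNm hNm.compl,
      setLIntegral_eq_zero_iff hNm (Kernel.measurable_coe _ hNm.compl)]
    have : ∀ᵐ x ∂μ, ∀ k : ℕ, (P ^ (k + 1)).value x = ((P ^ k).value ∘ₖ P.value) x := by
      rw [ae_all_iff]; intro k
      rw [pow_succ]; exact value_mul _ _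
    filter_upwards [this] with x hx hxN
    have h2 : ∀ᵐ y ∂P.value x, ∀ k : ℕ, (P ^ k).value y B = 0 := by
      rw [ae_all_iff]; intro k
      have h3 := hxN (k + 1)
      rw [hx k, Kernel.comp_apply' _ _ _ hB, lintegral_eq_zero_iff (Kernel.measurable_coe _ hB)]
        at h3
      exact h3
    exact h2
  have h2 : μ N = 0 := by
    refine (hinv N hNm h1).resolve_right fun h => hB0 ?_
    have h3 : ∀ᵐ x ∂μ, x ∈ N := by rw [ae_iff]; exact h
    have h4 : ∀ᵐ x ∂μ, x ∉ B := by
      filter_upwards [h3, value_one (μ := μ)] with x hx hx1 hxB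
      have := hx 0
      rw [pow_zero, hx1, Kernel.id_apply, Measure.dirac_apply' _ hB] at this
      simp [hxB] at this
    rw [ae_iff] at h4
    simpa using h4
  intro h3
  change (Measure.sum fun k : ℕ => (2⁻¹ : ℝ≥0∞) ^ (k + 1) • (P ^ k).bistochastic) _ = 0 at h3
  rw [Measure.sum_apply_eq_zero' (hA.prod hB)] at h3
  have h4 : ∀ᵐ x ∂μ, x ∈ A → x ∈ N := by
    have : ∀ k : ℕ, ∀ᵐ x ∂μ, x ∈ A → (P ^ k).value x B = 0 := fun k => by
      have h5 := h3 k
      rw [Measure.smul_apply, smul_eq_mul, mul_eq_zero] at h5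
      have h6 := h5.resolve_left (by simp)
      rw [← (P ^ k).compProd_value, Measure.compProd_apply_prod hA hB,
        setLIntegral_eq_zero_iff hA (Kernel.measurable_coe _ hB)] at h6
      exact h6
    rw [← ae_all_iff] at this
    filter_upwards [this] with x hx hxA k using hx k hxA
  exact hA0 (measure_mono_null_ae h4 h2)

end Polymorphism

/-! ### Self-couplings from couplings. -/

/-- The chain on `X` obtained from a coupling of `X` and `Z` by going to `Z` and back. -/
lemma exists_selfCoupling {X Z : Type*} [MeasurableSpace X] [StandardBorelSpace X] [Nonempty X]
    [MeasurableSpace Z] {μ : Measure X} [IsProbabilityMeasure μ]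
    (J : Measure (X × Z)) [IsProbabilityMeasure J] (hJ : J.fst = μ)
    {u : ℕ → X → ℝ} {v : ℕ → Z → ℝ} (hu : ∀ j, Measurable (u j)) (hv : ∀ j, Measurable (v j))
    (hgood : Tendsto (fun j => ∫⁻ p, edist (u j p.1) (v j p.2) ∂J) atTop (𝓝 0))
    (herg : ∀ (A : Set X) (B : Set Z), MeasurableSet A → MeasurableSet B →
      (∀ᵐ p ∂J, p.1 ∈ A ↔ p.2 ∈ B) → μ A = 0 ∨ μ Aᶜ = 0) :
    ∃ ρ : Polymorphism μ,
      Tendsto (fun j => ∫⁻ p, edist (u j p.1) (u j p.2) ∂ρ.bistochastic) atTop (𝓝 0) ∧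
      ∀ A B : Set X, MeasurableSet A → MeasurableSet B → μ A ≠ 0 → μ B ≠ 0 →
        ρ.bistochastic (A ×ˢ B) ≠ 0 := by
  set J' : Measure (Z × X) := J.map Prod.swap with hJ'
  have hJp : IsProbabilityMeasure J' :=
    Measure.isProbabilityMeasure_map measurable_swap.aemeasurable
  have hJs : J'.snd = μ := by rw [hJ', Measure.snd_map_swap, hJ]
  set K := J'.condKernel with hK
  have hdis : J'.fst ⊗ₘ K = J' := J'.disintegrate _
  -- Two points of `X`, conditionally independent given `z`; the law of this pair is the symmetric
  -- chain whose powers are averaged.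
  set g : Measure (Z × X × X) := J'.fst ⊗ₘ (K ×ₖ K) with hg
  have hg1 : g.map (fun p => (p.1, p.2.1)) = J' := by
    have := Measure.compProd_map (μ := J'.fst) (κ := K ×ₖ K)
      (f := (Prod.fst : X × X → X)) measurable_fst
    rw [show (fun p : Z × X × X => (p.1, p.2.1)) = Prod.map id Prod.fst from rfl, hg, ← this,
      ← Kernel.fst_eq, Kernel.fst_prod, hdis]
  have hg2 : g.map (fun p => (p.1, p.2.2)) = J' := by
    have := Measure.compProd_map (μ := J'.fst) (κ := K ×ₖ K)
      (f := (Prod.snd : X × X → X)) measurable_snd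
    rw [show (fun p : Z × X × X => (p.1, p.2.2)) = Prod.map id Prod.snd from rfl, hg, ← this,
      ← Kernel.snd_eq, Kernel.snd_prod, hdis]
  let θ : Polymorphism μ :=
    { bistochastic := g.snd
      fst_eq := by
        rw [← hJs, ← hg1, Measure.fst, Measure.snd, Measure.snd,
          Measure.map_map (by fun_prop) (by fun_prop), Measure.map_map (by fun_prop) (by fun_prop)]
        rfl
      snd_eq := by
        rw [← hJs, ← hg2, Measure.snd, Measure.snd, Measure.snd,
          Measure.map_map (by fun_prop) (by fun_prop), Measure.map_map (by fun_prop) (by fun_prop)]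
        rfl }
  have hswap : ∀ {f : X × Z → ℝ≥0∞}, Measurable f →
      ∫⁻ p, f p ∂J = ∫⁻ p, f (p.2, p.1) ∂J' := fun {f} hf => by
    rw [hJ', lintegral_map (f := fun p : Z × X => f (p.2, p.1)) (by fun_prop) measurable_swap]
    rfl
  refine ⟨θ.geomMean, θ.tendsto_lintegral_edist_geomMean hu ?_, fun A B hA hB hA0 hB0 =>
    θ.geomMean_pos (fun N hN h0 => ?_) hA hB hA0 hB0⟩
  · have hle : ∀ j, ∫⁻ p, edist (u j p.1) (u j p.2) ∂θ.bistochastic ≤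
        2 * ∫⁻ p, edist (u j p.1) (v j p.2) ∂J := fun j => by
      have hm := measurable_edist_pair (hu j) (hv j)
      have hm' : Measurable fun p : Z × X => edist (u j p.2) (v j p.1) :=
        ((hu j).comp measurable_snd).edist ((hv j).comp measurable_fst)
      have hm1 : Measurable fun a : Z × X × X => edist (u j a.2.1) (v j a.1) :=
        hm'.comp (by fun_prop : Measurable fun p : Z × X × X => (p.1, p.2.1))
      change ∫⁻ p, edist (u j p.1) (u j p.2) ∂(g.map Prod.snd) ≤ _
      rw [lintegral_map (measurable_edist_pair (hu j) (hu j)) measurable_snd, two_mul, hswap hm]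
      conv_rhs => enter [1]; rw [← hg1]
      conv_rhs => enter [2]; rw [← hg2]
      rw [lintegral_map hm' (by fun_prop), lintegral_map hm' (by fun_prop),
        ← lintegral_add_left (hm1 : Measurable fun a : Z × X × X =>
          edist (u j (a.1, a.2.1).2) (v j (a.1, a.2.1).1))]
      gcongr with p
      exact (edist_triangle_right _ _ _)
    refine tendsto_of_tendsto_of_tendsto_of_le_of_le tendsto_const_nhds ?_ (fun _ => zero_le) hle
    simpa using ENNReal.Tendsto.const_mul hgood (Or.inr (by simp : (2 : ℝ≥0∞) ≠ ∞))
  -- If the chain never passes from `N` to its complement, almost every conditional measure `K z`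
  -- lives on one of the two. So `J` identifies `N` with a set of `Z`, and `herg` applies.
  · have h1 : ∫⁻ z, K z N * K z Nᶜ ∂J'.fst = 0 := by
      have : g.snd (N ×ˢ Nᶜ) = ∫⁻ z, K z N * K z Nᶜ ∂J'.fst := by
        rw [hg, Measure.snd_compProd, Measure.bind_apply (hN.prod hN.compl)
          (Kernel.aemeasurable _)]
        refine lintegral_congr fun z => ?_
        rw [Kernel.prod_apply, Measure.prod_prod]
      rw [← this]; exact h0
    replace h1 := (lintegral_eq_zero_iff ((Kernel.measurable_coe K hN).mul
      (Kernel.measurable_coe K hN.compl))).1 h1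
    have hBm : MeasurableSet {z | K z Nᶜ = 0} :=
      (Kernel.measurable_coe _ hN.compl) (measurableSet_singleton 0)
    refine herg N {z | K z Nᶜ = 0} hN hBm ?_
    have h2 : ∀ᵐ p ∂J', p.2 ∈ N ↔ p.1 ∈ {z | K z Nᶜ = 0} := by
      rw [← hdis, Measure.ae_compProd_iff]
      · filter_upwards [h1] with z hz
        by_cases hz0 : K z Nᶜ = 0
        · have : ∀ᵐ x ∂K z, x ∈ N := by rw [ae_iff]; exact hz0
          filter_upwards [this] with x hx
          simp [hx, hz0]
        · have hz1 : K z N = 0 := by simpa [hz0] using hz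
          have : ∀ᵐ x ∂K z, x ∉ N := by rw [ae_iff]; simpa using hz1
          filter_upwards [this] with x hx
          simp [hx, hz0]
      · exact MeasurableSet.iff (measurable_snd hN) (measurable_fst hBm)
    rw [hJ', ae_map_iff measurable_swap.aemeasurable
      (MeasurableSet.iff (measurable_snd hN) (measurable_fst hBm))] at h2
    exact h2

/-! ### Coupling inside cells by exhaustion. -/

namespace Polymorphism

variable {X : Type*} [MeasurableSpace X] [StandardBorelSpace X] [Nonempty X]
  {μ : Measure X} [IsProbabilityMeasure μ]

section Coupling

variable {ι : Type*} [Countable ι] [MeasurableSpace ι] [MeasurableSingletonClass ι]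

/-- The part that the pair of densities `(f, g)` can share along pairs of points in a common
cell. -/
def cellMin (γ : X → ι) (f g : X → ℝ≥0∞) (p : X × X) : ℝ≥0∞ :=
  Set.indicator {p : X × X | γ p.1 = γ p.2} (fun p => min (f p.1) (g p.2)) p

lemma measurable_cellMin {γ : X → ι} (hγ : Measurable γ) {f g : X → ℝ≥0∞} (hf : Measurable f)
    (hg : Measurable g) : Measurable (cellMin γ f g) :=
  ((hf.comp measurable_fst).min (hg.comp measurable_snd)).indicator
    (measurableSet_eq_fun (hγ.comp measurable_fst) (hγ.comp measurable_snd))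

lemma cellMin_le_left (γ : X → ι) (f g : X → ℝ≥0∞) (p : X × X) : cellMin γ f g p ≤ f p.1 :=
  (Set.indicator_le_self _ _ _).trans (min_le_left _ _)

lemma cellMin_le_right (γ : X → ι) (f g : X → ℝ≥0∞) (p : X × X) : cellMin γ f g p ≤ g p.2 :=
  (Set.indicator_le_self _ _ _).trans (min_le_right _ _)

lemma cellMin_mono (γ : X → ι) {f g f' g' : X → ℝ≥0∞} (hf : f ≤ f') (hg : g ≤ g') :
    cellMin γ f g ≤ cellMin γ f' g' := fun p => by
  unfold cellMin
  refine Set.indicator_le_indicator ?_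
  exact min_le_min (hf _) (hg _)

lemma setLIntegral_eq_of_fst (P : Polymorphism μ) {F : X × X → ℝ≥0∞} (hF : Measurable F)
    {s : Set X} (hs : MeasurableSet s) :
    (P.bistochastic.withDensity F).fst s = ∫⁻ x in s, ∫⁻ y, F (x, y) ∂P.value x ∂μ := by
  rw [Measure.fst_apply hs, withDensity_apply _ (measurable_fst hs),
    ← lintegral_indicator (measurable_fst hs),
    lintegral_bistochastic P (hF.indicator (measurable_fst hs)), ← lintegral_indicator hs]
  refine lintegral_congr fun x => ?_
  by_cases hx : x ∈ s <;> simp [Set.indicator, hx]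

lemma setLIntegral_eq_of_snd (P : Polymorphism μ) {F : X × X → ℝ≥0∞} (hF : Measurable F)
    {s : Set X} (hs : MeasurableSet s) :
    (P.bistochastic.withDensity F).snd s = ∫⁻ y in s, ∫⁻ x, F (x, y) ∂P.conj.value y ∂μ := by
  have h := setLIntegral_eq_of_fst P.conj (F := fun p => F p.swap)
    (hF.comp measurable_swap) hs
  simp only [Prod.swap_prod_mk] at h
  rw [← h, Measure.snd_apply hs, Measure.fst_apply hs, withDensity_apply _ (measurable_snd hs),
    withDensity_apply _ (measurable_fst hs)]
  change _ = ∫⁻ a in _, F a.swap ∂(P.bistochastic.map Prod.swap)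
  rw [setLIntegral_map (f := fun a : X × X => F a.swap) (measurable_fst hs)
    (hF.comp measurable_swap) measurable_swap]
  rfl

variable (ρ : Polymorphism μ) (γ : X → ι)

/-- One step of the exhaustion of two densities by a coupling. -/
def exhaustStep (q : (X → ℝ≥0∞) × (X → ℝ≥0∞)) : (X → ℝ≥0∞) × (X → ℝ≥0∞) :=
  (fun x => q.1 x - ∫⁻ y, cellMin γ q.1 q.2 (x, y) ∂ρ.value x,
    fun y => q.2 y - ∫⁻ x, cellMin γ q.1 q.2 (x, y) ∂ρ.conj.value y)

/-- The densities that remain after `n` steps of the exhaustion. -/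
def exhaust (f g : X → ℝ≥0∞) (n : ℕ) : (X → ℝ≥0∞) × (X → ℝ≥0∞) :=
  (exhaustStep ρ γ)^[n] (f, g)

lemma exhaust_succ (f g : X → ℝ≥0∞) (n : ℕ) :
    exhaust ρ γ f g (n + 1) = exhaustStep ρ γ (exhaust ρ γ f g n) :=
  Function.iterate_succ_apply' _ _ _

variable {γ}

lemma measurable_exhaust (hγ : Measurable γ) {f g : X → ℝ≥0∞} (hf : Measurable f)
    (hg : Measurable g) (n : ℕ) :
    Measurable (exhaust ρ γ f g n).1 ∧ Measurable (exhaust ρ γ f g n).2 := by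
  induction n with
  | zero => exact ⟨hf, hg⟩
  | succ n ih =>
    rw [exhaust_succ]
    have hc := measurable_cellMin hγ ih.1 ih.2
    exact ⟨ih.1.sub (Measurable.lintegral_kernel_prod_right' hc),
      ih.2.sub (Measurable.lintegral_kernel_prod_right' (hc.comp measurable_swap))⟩

variable (γ)

lemma lintegral_cellMin_le_left (f g : X → ℝ≥0∞) (x : X) :
    ∫⁻ y, cellMin γ f g (x, y) ∂ρ.value x ≤ f x :=
  (lintegral_mono fun y => cellMin_le_left γ f g (x, y)).trans (by simp)

lemma lintegral_cellMin_le_right (f g : X → ℝ≥0∞) (y : X) :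
    ∫⁻ x, cellMin γ f g (x, y) ∂ρ.conj.value y ≤ g y :=
  (lintegral_mono fun x => cellMin_le_right γ f g (x, y)).trans (by simp)

lemma sum_add_exhaust_fst (f g : X → ℝ≥0∞) (n : ℕ) (x : X) :
    ∑ k ∈ Finset.range n, ∫⁻ y, cellMin γ (exhaust ρ γ f g k).1 (exhaust ρ γ f g k).2 (x, y)
      ∂ρ.value x + (exhaust ρ γ f g n).1 x = f x := by
  induction n with
  | zero => simp [exhaust]
  | succ n ih =>
    rw [Finset.sum_range_succ, exhaust_succ, add_assoc]
    simp only [exhaustStep]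
    rw [add_tsub_cancel_of_le (lintegral_cellMin_le_left ρ γ _ _ x), ih]

lemma sum_add_exhaust_snd (f g : X → ℝ≥0∞) (n : ℕ) (y : X) :
    ∑ k ∈ Finset.range n, ∫⁻ x, cellMin γ (exhaust ρ γ f g k).1 (exhaust ρ γ f g k).2 (x, y)
      ∂ρ.conj.value y + (exhaust ρ γ f g n).2 y = g y := by
  induction n with
  | zero => simp [exhaust]
  | succ n ih =>
    rw [Finset.sum_range_succ, exhaust_succ, add_assoc]
    simp only [exhaustStep]
    rw [add_tsub_cancel_of_le (lintegral_cellMin_le_right ρ γ _ _ y), ih]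

lemma antitone_exhaust (f g : X → ℝ≥0∞) : Antitone (exhaust ρ γ f g) := by
  refine antitone_nat_of_succ_le fun n => ?_
  rw [exhaust_succ]
  exact ⟨fun x => tsub_le_self, fun x => tsub_le_self⟩

/-- Passage to the limit in the balance "mass already coupled plus mass remaining". -/
lemma tsum_add_iInf_of_sum_add {u v : ℕ → ℝ≥0∞} {c : ℝ≥0∞} (hv : Antitone v)
    (h : ∀ n, ∑ k ∈ Finset.range n, u k + v n = c) : ∑' k, u k + ⨅ n, v n = c := by
  have h1 := (ENNReal.tendsto_nat_tsum u).add (tendsto_atTop_iInf hv)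
  simp_rw [h] at h1
  exact tendsto_nhds_unique h1 tendsto_const_nhds

end Coupling

/-- Domination by one measure along a sequence of summable pieces. -/
lemma tendsto_lintegral_sum {Y : Type*} [MeasurableSpace Y] {ρ : Measure Y} {c : ℕ → Measure Y}
    (hc : ∀ n, c n ≤ ρ) (hfin : ∑' n, c n Set.univ ≠ ∞) {w : ℕ → Y → ℝ≥0∞}
    (hw1 : ∀ j y, w j y ≤ 1) (hw : Tendsto (fun j => ∫⁻ y, w j y ∂ρ) atTop (𝓝 0)) :
    Tendsto (fun j => ∫⁻ y, w j y ∂(Measure.sum c)) atTop (𝓝 0) := by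
  simp_rw [lintegral_sum_measure, ← lintegral_count]
  -- Dominated convergence in the index of the pieces: each term tends to 0 because `c n ≤ ρ`, and
  -- it is bounded by the mass of its piece.
  have := tendsto_lintegral_of_dominated_convergence (μ := (Measure.count : Measure ℕ))
    (F := fun j n => ∫⁻ y, w j y ∂c n) (f := fun _ => 0) (fun n => c n Set.univ)
    (fun _ => measurable_of_countable _)
    (fun j => Eventually.of_forall fun n => by
      refine (lintegral_mono (hw1 j)).trans (by simp))
    (by rwa [lintegral_count])
    (Eventually.of_forall fun n => tendsto_of_tendsto_of_tendsto_of_le_of_le tendsto_const_nhds hw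
      (fun _ => zero_le) (fun j => lintegral_mono' (hc n) le_rfl))
  simpa using this

/-- If a polymorphism charges all products of sets of positive measure, then any two measures
below `μ` with the same masses on the cells of a partition are coupled, inside the cells, by a
measure that inherits asymptotic vanishing from the polymorphism. -/
lemma exists_coupling (ρ : Polymorphism μ)
    (hpos : ∀ A B : Set X, MeasurableSet A → MeasurableSet B → μ A ≠ 0 → μ B ≠ 0 →
      ρ.bistochastic (A ×ˢ B) ≠ 0)
    {ι : Type*} [Countable ι] [MeasurableSpace ι] [MeasurableSingletonClass ι] {γ : X → ι}
    (hγ : Measurable γ) {a b : Measure X} (ha : a ≤ μ) (hb : b ≤ μ)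
    (hab : ∀ i, a (γ ⁻¹' {i}) = b (γ ⁻¹' {i})) :
    ∃ c : Measure (X × X), c.fst = a ∧ c.snd = b ∧ (∀ᵐ p ∂c, γ p.1 = γ p.2) ∧
      ∀ w : ℕ → X × X → ℝ≥0∞, (∀ j p, w j p ≤ 1) →
        Tendsto (fun j => ∫⁻ p, w j p ∂ρ.bistochastic) atTop (𝓝 0) →
        Tendsto (fun j => ∫⁻ p, w j p ∂c) atTop (𝓝 0) := by
  -- The density is at most 1 almost everywhere; truncation makes this hold everywhere, which later
  -- gives `c n ≤ ρ.bistochastic`.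
  have key : ∀ {a : Measure X}, a ≤ μ → ∃ f : X → ℝ≥0∞, Measurable f ∧ (∀ x, f x ≤ 1) ∧
      μ.withDensity f = a := fun {a} ha => by
    have : IsFiniteMeasure a := isFiniteMeasure_of_le μ ha
    refine ⟨fun x => min (a.rnDeriv μ x) 1, (a.measurable_rnDeriv μ).min measurable_const,
      fun x => min_le_right _ _, ?_⟩
    rw [← Measure.withDensity_rnDeriv_eq a μ (Measure.absolutelyContinuous_of_le ha)]
    refine withDensity_congr_ae ?_
    have h1 : ∀ᵐ x ∂μ, a.rnDeriv μ x ≤ 1 := by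
      refine ae_le_of_forall_setLIntegral_le_of_sigmaFinite (a.measurable_rnDeriv μ) ?_
      intro s hs _
      rw [Measure.setLIntegral_rnDeriv' (Measure.absolutelyContinuous_of_le ha) hs]
      simpa using ha s
    rw [Measure.withDensity_rnDeriv_eq a μ (Measure.absolutelyContinuous_of_le ha)]
    filter_upwards [h1] with x hx
    exact min_eq_left hx
  obtain ⟨f, hf, hf1, rfl⟩ := key ha
  obtain ⟨g, hg, hg1, rfl⟩ := key hb
  set e := exhaust ρ γ f g with he
  have hem := measurable_exhaust ρ hγ hf hg
  set F : ℕ → X × X → ℝ≥0∞ := fun n => cellMin γ (e n).1 (e n).2 with hF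
  have hFm : ∀ n, Measurable (F n) := fun n => measurable_cellMin hγ (hem n).1 (hem n).2
  set m : ℕ → X → ℝ≥0∞ := fun n x => ∫⁻ y, F n (x, y) ∂ρ.value x with hm
  set m' : ℕ → X → ℝ≥0∞ := fun n y => ∫⁻ x, F n (x, y) ∂ρ.conj.value y with hm'
  have hmm : ∀ n, Measurable (m n) := fun n => Measurable.lintegral_kernel_prod_right' (hFm n)
  have hmm' : ∀ n, Measurable (m' n) := fun n =>
    Measurable.lintegral_kernel_prod_right' ((hFm n).comp measurable_swap)
  set fi : X → ℝ≥0∞ := fun x => ⨅ n, (e n).1 x with hfi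
  set gi : X → ℝ≥0∞ := fun x => ⨅ n, (e n).2 x with hgi
  have hfim : Measurable fi := Measurable.iInf fun n => (hem n).1
  have hgim : Measurable gi := Measurable.iInf fun n => (hem n).2
  have hsf : ∀ x, ∑' n, m n x + fi x = f x := fun x =>
    tsum_add_iInf_of_sum_add (fun i j hij => (antitone_exhaust ρ γ f g hij).1 x)
      (fun n => sum_add_exhaust_fst ρ γ f g n x)
  have hsg : ∀ x, ∑' n, m' n x + gi x = g x := fun x =>
    tsum_add_iInf_of_sum_add (fun i j hij => (antitone_exhaust ρ γ f g hij).2 x)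
      (fun n => sum_add_exhaust_snd ρ γ f g n x)
  set c : ℕ → Measure (X × X) := fun n => ρ.bistochastic.withDensity (F n) with hc
  have hcf : ∀ n, (c n).fst = μ.withDensity (m n) := fun n => by
    ext s hs
    rw [hc, setLIntegral_eq_of_fst ρ (hFm n) hs, withDensity_apply _ hs]
  have hcs : ∀ n, (c n).snd = μ.withDensity (m' n) := fun n => by
    ext s hs
    rw [hc, setLIntegral_eq_of_snd ρ (hFm n) hs, withDensity_apply _ hs]
  have hcell : MeasurableSet {p : X × X | γ p.1 = γ p.2} :=
    measurableSet_eq_fun (hγ.comp measurable_fst) (hγ.comp measurable_snd)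
  have hcγ : ∀ n, ∀ᵐ p ∂c n, γ p.1 = γ p.2 := fun n => by
    rw [hc, ae_withDensity_iff (hFm n)]
    refine Eventually.of_forall fun p hp => ?_
    by_contra hne
    exact hp (Set.indicator_of_notMem (s := {p : X × X | γ p.1 = γ p.2}) hne _)
  have hcells : ∀ i, ∀ n, ∫⁻ x in γ ⁻¹' {i}, m n x ∂μ = ∫⁻ x in γ ⁻¹' {i}, m' n x ∂μ :=
    fun i n => by
    have hi : MeasurableSet (γ ⁻¹' {i}) := hγ (measurableSet_singleton i)
    rw [← withDensity_apply _ hi, ← withDensity_apply _ hi, ← hcf, ← hcs, Measure.fst_apply hi,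
      Measure.snd_apply hi]
    refine measure_congr ?_
    filter_upwards [hcγ n] with p hp
    change (γ p.1 = i) = (γ p.2 = i)
    rw [hp]
  -- Every step removes equal masses from the two sides of a cell, so the remainders still balance.
  have hlim : ∀ i, ∫⁻ x in γ ⁻¹' {i}, fi x ∂μ = ∫⁻ x in γ ⁻¹' {i}, gi x ∂μ := fun i => by
    have hi : MeasurableSet (γ ⁻¹' {i}) := hγ (measurableSet_singleton i)
    have h1 : ∑' n, ∫⁻ x in γ ⁻¹' {i}, m n x ∂μ + ∫⁻ x in γ ⁻¹' {i}, fi x ∂μ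
        = ∫⁻ x in γ ⁻¹' {i}, f x ∂μ := by
      rw [← lintegral_tsum fun n => (hmm n).aemeasurable, ← lintegral_add_right _ hfim]
      simp_rw [hsf]
    have h2 : ∑' n, ∫⁻ x in γ ⁻¹' {i}, m' n x ∂μ + ∫⁻ x in γ ⁻¹' {i}, gi x ∂μ
        = ∫⁻ x in γ ⁻¹' {i}, g x ∂μ := by
      rw [← lintegral_tsum fun n => (hmm' n).aemeasurable, ← lintegral_add_right _ hgim]
      simp_rw [hsg]
    have h3 := hab i
    rw [withDensity_apply _ hi, withDensity_apply _ hi, ← h1, ← h2] at h3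
    simp_rw [hcells i] at h3
    refine (ENNReal.add_right_inj ?_).1 h3
    refine ne_top_of_le_ne_top (b := ∫⁻ x in γ ⁻¹' {i}, g x ∂μ) ?_ (h2 ▸ le_self_add)
    rw [← withDensity_apply _ hi]
    exact ne_top_of_le_ne_top (measure_ne_top μ _) (hb _)
  have hcu : ∑' n, c n Set.univ ≠ ∞ := by
    have h1 : ∀ n, c n Set.univ = ∫⁻ x, m n x ∂μ := fun n => by
      rw [← Measure.fst_univ, hcf, withDensity_apply _ MeasurableSet.univ, Measure.restrict_univ]
    simp_rw [h1]
    rw [← lintegral_tsum fun n => (hmm n).aemeasurable]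
    refine ne_top_of_le_ne_top (b := ∫⁻ x, 1 ∂μ) (by simp) (lintegral_mono fun x => ?_)
    exact (le_self_add.trans (hsf x).le).trans (hf1 x)
  -- Every step couples at least the common part of the limiting remainders; if that were non-null,
  -- the total coupled mass would be infinite.
  have hzero : ∫⁻ p, cellMin γ fi gi p ∂ρ.bistochastic = 0 := by
    by_contra hne
    refine hcu (top_le_iff.1 ?_)
    rw [← ENNReal.tsum_const_eq_top_of_ne_zero (α := ℕ) hne]
    refine ENNReal.tsum_le_tsum fun n => ?_
    rw [hc, withDensity_apply _ MeasurableSet.univ, Measure.restrict_univ]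
    exact lintegral_mono (cellMin_mono γ (fun x => iInf_le _ n) (fun x => iInf_le _ n))
  rw [lintegral_eq_zero_iff (measurable_cellMin hγ hfim hgim)] at hzero
  -- By `hpos`, two non-null remainders in one cell would have a non-null common part; as their
  -- masses are equal, both vanish.
  have hnull : ∀ i, ∫⁻ x in γ ⁻¹' {i}, fi x ∂μ = 0 := fun i => by
    have hi : MeasurableSet (γ ⁻¹' {i}) := hγ (measurableSet_singleton i)
    have hA : MeasurableSet (γ ⁻¹' {i} ∩ {x | fi x ≠ 0}) :=
      hi.inter (hfim (measurableSet_singleton 0).compl)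
    have hB : MeasurableSet (γ ⁻¹' {i} ∩ {x | gi x ≠ 0}) :=
      hi.inter (hgim (measurableSet_singleton 0).compl)
    have h0 : ρ.bistochastic ((γ ⁻¹' {i} ∩ {x | fi x ≠ 0}) ×ˢ (γ ⁻¹' {i} ∩ {x | gi x ≠ 0})) = 0 := by
      refine measure_mono_null (fun p hp => ?_) (ae_iff.1 hzero)
      have h1 : γ p.1 = i := hp.1.1
      have h2 : γ p.2 = i := hp.2.1
      have h3 : cellMin γ fi gi p = min (fi p.1) (gi p.2) :=
        Set.indicator_of_mem (s := {p : X × X | γ p.1 = γ p.2})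
          (show γ p.1 = γ p.2 by rw [h1, h2]) _
      change ¬ cellMin γ fi gi p = 0
      rw [h3]
      exact (lt_min (pos_iff_ne_zero.2 hp.1.2) (pos_iff_ne_zero.2 hp.2.2)).ne'
    have hz : ∀ {u : X → ℝ≥0∞}, Measurable u → μ (γ ⁻¹' {i} ∩ {x | u x ≠ 0}) = 0 →
        ∫⁻ x in γ ⁻¹' {i}, u x ∂μ = 0 := fun {u} hu h => by
      rw [setLIntegral_eq_zero_iff hi hu, ae_iff]
      refine measure_mono_null (fun x hx => ?_) h
      have hx' : ¬ (x ∈ γ ⁻¹' {i} → u x = 0) := hx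
      exact Classical.not_imp.1 hx'
    by_contra hne
    have h1 : μ (γ ⁻¹' {i} ∩ {x | fi x ≠ 0}) ≠ 0 := fun h => hne (hz hfim h)
    have h2 : μ (γ ⁻¹' {i} ∩ {x | gi x ≠ 0}) ≠ 0 := fun h => hne ((hlim i).trans (hz hgim h))
    exact hpos _ _ hA hB h1 h2 h0
  have hae : ∀ {u : X → ℝ≥0∞}, Measurable u → (∀ i, ∫⁻ x in γ ⁻¹' {i}, u x ∂μ = 0) →
      ∀ᵐ x ∂μ, u x = 0 := fun {u} hu h => by
    have h1 : ∀ i, ∀ᵐ x ∂μ, x ∈ γ ⁻¹' {i} → u x = 0 := fun i =>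
      (setLIntegral_eq_zero_iff (hγ (measurableSet_singleton i)) hu).1 (h i)
    filter_upwards [ae_all_iff.2 h1] with x hx using hx (γ x) rfl
  refine ⟨Measure.sum c, ?_, ?_, ?_, fun w hw1 hw => tendsto_lintegral_sum (fun n => ?_) hcu hw1 hw⟩
  · rw [Measure.fst_sum]
    simp_rw [hcf]
    rw [← withDensity_tsum hmm]
    refine withDensity_congr_ae ?_
    filter_upwards [hae hfim hnull] with x hx
    rw [tsum_apply (Pi.summable.2 fun _ => ENNReal.summable), ← hsf x, hx, add_zero]
  · rw [Measure.snd_sum]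
    simp_rw [hcs]
    rw [← withDensity_tsum hmm']
    refine withDensity_congr_ae ?_
    filter_upwards [hae hgim fun i => (hlim i).symm.trans (hnull i)] with x hx
    rw [tsum_apply (Pi.summable.2 fun _ => ENNReal.summable), ← hsg x, hx, add_zero]
  · rw [Measure.ae_sum_iff' hcell]
    exact hcγ
  · calc c n ≤ ρ.bistochastic.withDensity 1 := withDensity_mono (Eventually.of_forall fun p =>
        ((cellMin_le_left γ _ _ p).trans
          ((antitone_exhaust ρ γ f g (Nat.zero_le n)).1 p.1)).trans (hf1 p.1))
      _ = ρ.bistochastic := withDensity_one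

end Polymorphism

/-! ### Splitting sets of a non-atomic space. -/

section Split

variable {X : Type*} [MeasurableSpace X] [StandardBorelSpace X] [Nonempty X]
  {μ : Measure X} [IsProbabilityMeasure μ]

/-- A standard Borel space embeds into the unit interval. -/
lemma exists_measurableEmbedding_Icc (X : Type*) [MeasurableSpace X] [StandardBorelSpace X]
    [Nonempty X] : ∃ h : X → ℝ, MeasurableEmbedding h ∧ ∀ x, h x ∈ Set.Ioo (0 : ℝ) 1 :=
  ⟨_, (MeasurableEmbedding.subtype_coe measurableSet_Icc).comp
      (measurableEmbedding_sigmoid_comp_embeddingReal X),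
    fun _ => ⟨Real.sigmoid_pos _, Real.sigmoid_lt_one _⟩⟩

/-- A non-atomic measure takes all intermediate values. -/
lemma exists_subset_measure_eq [NullSingletonClass μ] {Y : Set X} (hY : MeasurableSet Y)
    {c : ℝ≥0∞} (hc : c ≤ μ Y) : ∃ B ⊆ Y, MeasurableSet B ∧ μ B = c := by
  obtain ⟨h, he, h01⟩ := exists_measurableEmbedding_Icc X
  set ν := (μ.restrict Y).map h with hν
  have : NullSingletonClass ν := ⟨fun t => by
    rw [hν, Measure.map_apply he.measurable (measurableSet_singleton t)]
    exact (Set.subsingleton_singleton.preimage he.injective).measure_zero _⟩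
  -- After embedding in the line, the distribution function has no jumps, and the intermediate value
  -- theorem applies.
  have hcont : Continuous fun t => ∫ _ in (0 : ℝ)..t, (1 : ℝ) ∂ν :=
    intervalIntegral.continuous_primitive (fun a b => intervalIntegrable_const) 0
  have hval : ∀ t, 0 ≤ t → ∫ _ in (0 : ℝ)..t, (1 : ℝ) ∂ν = μ.real (Y ∩ {x | h x ≤ t}) :=
    fun t ht => by
    rw [intervalIntegral.integral_of_le ht, integral_const, smul_eq_mul, mul_one, measureReal_def,
      Measure.restrict_apply_univ, measureReal_def, hν,
      Measure.map_apply he.measurable measurableSet_Ioc,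
      Measure.restrict_apply (he.measurable measurableSet_Ioc), Set.inter_comm]
    congr 2
    ext x
    simp [(h01 x).1]
  have hctop : c ≠ ∞ := ne_top_of_le_ne_top (measure_ne_top μ Y) hc
  have hmem : c.toReal ∈ Set.Icc (∫ _ in (0 : ℝ)..0, (1 : ℝ) ∂ν) (∫ _ in (0 : ℝ)..1, (1 : ℝ) ∂ν) := by
    refine ⟨by simp, ?_⟩
    rw [hval 1 zero_le_one, measureReal_def]
    refine ENNReal.toReal_mono (measure_ne_top _ _) (hc.trans (measure_mono fun x hx => ?_))
    exact ⟨hx, (h01 x).2.le⟩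
  obtain ⟨t, ht, hteq⟩ := intermediate_value_Icc zero_le_one hcont.continuousOn hmem
  refine ⟨Y ∩ {x | h x ≤ t}, Set.inter_subset_left,
    hY.inter (he.measurable measurableSet_Iic), ?_⟩
  rw [← ENNReal.toReal_eq_toReal_iff' (measure_ne_top _ _) hctop, ← measureReal_def, ← hteq]
  exact (hval t ht.1).symm

lemma exists_subset_measure_cells_eq [NullSingletonClass μ] {ι : Type*} [Countable ι]
    [MeasurableSpace ι] [MeasurableSingletonClass ι] {γ : X → ι} (hγ : Measurable γ)
    {Y : Set X} (hY : MeasurableSet Y) {a : Measure X} (ha : a ≤ μ.restrict Y) :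
    ∃ C ⊆ Y, MeasurableSet C ∧ ∀ i, μ (C ∩ γ ⁻¹' {i}) = a (γ ⁻¹' {i}) := by
  have hi : ∀ i, MeasurableSet (γ ⁻¹' {i}) := fun i => hγ (measurableSet_singleton i)
  have h1 : ∀ i, a (γ ⁻¹' {i}) ≤ μ (γ ⁻¹' {i} ∩ Y) := fun i => by
    rw [← Measure.restrict_apply (hi i)]; exact ha _
  choose B hBs hBm hB using fun i => exists_subset_measure_eq ((hi i).inter hY) (h1 i)
  refine ⟨⋃ i, B i, Set.iUnion_subset fun i => (hBs i).trans Set.inter_subset_right,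
    MeasurableSet.iUnion hBm, fun i => ?_⟩
  rw [← hB i]
  congr 1
  ext x
  simp only [Set.mem_inter_iff, Set.mem_iUnion, Set.mem_preimage, Set.mem_singleton_iff]
  constructor
  · rintro ⟨⟨k, hk⟩, rfl⟩
    have : γ x = k := (hBs k hk).1
    rwa [this]
  · exact fun hx => ⟨⟨i, hx⟩, (hBs i hx).1⟩

end Split

/-! ### Split couplings, with control at all times. -/

namespace Polymorphism

variable {X : Type*} [MeasurableSpace X] [StandardBorelSpace X] [Nonempty X]
  {μ : Measure X} [IsProbabilityMeasure μ]

lemma edist_le_one {a b : ℝ} (ha : a ∈ Set.Icc (0 : ℝ) 1) (hb : b ∈ Set.Icc (0 : ℝ) 1) :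
    edist a b ≤ 1 := by
  rw [edist_dist, ← ENNReal.ofReal_one]
  exact ENNReal.ofReal_le_ofReal (by simpa using Real.dist_le_of_mem_Icc ha hb)

/-- Given `μ = a true + a false` on `Y`, the part `Y` is divided in two, and the two summands are
coupled, within the cells of a given partition, with the two parts. -/
lemma exists_split_coupling (ρ : Polymorphism μ)
    (hpos : ∀ A B : Set X, MeasurableSet A → MeasurableSet B → μ A ≠ 0 → μ B ≠ 0 →
      ρ.bistochastic (A ×ˢ B) ≠ 0)
    {u : ℕ → X → ℝ} (hu01 : ∀ j x, u j x ∈ Set.Icc (0 : ℝ) 1)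
    (hgood : Tendsto (fun j => ∫⁻ p, edist (u j p.1) (u j p.2) ∂ρ.bistochastic) atTop (𝓝 0))
    [NullSingletonClass μ] {ι : Type*} [Countable ι] [MeasurableSpace ι]
    [MeasurableSingletonClass ι] {γ : X → ι} (hγ : Measurable γ) {Y : Set X}
    (hY : MeasurableSet Y) {a : Bool → Measure X} (ha : a true + a false = μ.restrict Y) :
    ∃ (χ : X → Bool) (c : Bool → Measure (X × X)), Measurable χ ∧ ∀ β,
      (c β).fst = a β ∧ (c β).snd = μ.restrict (Y ∩ χ ⁻¹' {β}) ∧ (∀ᵐ p ∂c β, γ p.1 = γ p.2) ∧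
      Tendsto (fun j => ∫⁻ p, edist (u j p.1) (u j p.2) ∂c β) atTop (𝓝 0) := by
  classical
  have hle : ∀ β, a β ≤ μ.restrict Y := fun β => by
    rw [← ha]; cases β
    · exact Measure.le_add_left le_rfl
    · exact Measure.le_add_right le_rfl
  -- The set `C` takes the cell masses of `a true`; those of `a false` then match `Y \ C` by
  -- subtraction.
  obtain ⟨C, hCY, hC, hCa⟩ := exists_subset_measure_cells_eq hγ hY (hle true)
  have hχ : Measurable fun x => decide (x ∈ C) := measurable_to_bool (by
    convert hC using 1; ext x; simp)
  have hpre : ∀ β, MeasurableSet (Y ∩ (fun x => decide (x ∈ C)) ⁻¹' {β}) := fun β =>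
    hY.inter (hχ (measurableSet_singleton β))
  have hi : ∀ i, MeasurableSet (γ ⁻¹' {i}) := fun i => hγ (measurableSet_singleton i)
  have htrue : Y ∩ (fun x => decide (x ∈ C)) ⁻¹' {true} = C := by
    ext x; simpa using fun hx => hCY hx
  have hfalse : Y ∩ (fun x => decide (x ∈ C)) ⁻¹' {false} = Y \ C := by
    ext x; simp
  have hmass : ∀ β i, a β (γ ⁻¹' {i}) =
      μ.restrict (Y ∩ (fun x => decide (x ∈ C)) ⁻¹' {β}) (γ ⁻¹' {i}) := fun β i => by
    rw [Measure.restrict_apply (hi i), Set.inter_comm]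
    cases β
    · rw [hfalse]
      have h1 : a true (γ ⁻¹' {i}) + a false (γ ⁻¹' {i}) = μ (Y ∩ γ ⁻¹' {i}) := by
        rw [← Measure.add_apply, ha, Measure.restrict_apply (hi i), Set.inter_comm]
      have h2 : μ (C ∩ γ ⁻¹' {i}) + μ (Y \ C ∩ γ ⁻¹' {i}) = μ (Y ∩ γ ⁻¹' {i}) := by
        rw [← measure_inter_add_sdiff (Y ∩ γ ⁻¹' {i}) hC]
        congr 2
        · ext x
          exact ⟨fun h => ⟨⟨hCY h.1, h.2⟩, h.1⟩, fun h => ⟨h.2, h.1.2⟩⟩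
        · ext x
          exact ⟨fun h => ⟨⟨h.1.1, h.2⟩, h.1.2⟩, fun h => ⟨⟨h.1.1, h.2⟩, h.1.2⟩⟩
      rw [← h2, hCa] at h1
      exact (ENNReal.add_right_inj (ne_top_of_le_ne_top (measure_ne_top _ _) (hle true _))).1 h1
    · rw [htrue, hCa]
  choose c hc1 hc2 hc3 hc4 using fun β => exists_coupling ρ hpos hγ
    ((hle β).trans Measure.restrict_le_self) Measure.restrict_le_self (hmass β)
  exact ⟨_, c, hχ, fun β => ⟨hc1 β, hc2 β, hc3 β, hc4 β _
    (fun j p => edist_le_one (hu01 j _) (hu01 j _)) hgood⟩⟩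

/-- The same with a bound that holds for all times: the set `Y` is divided into small pieces which
are treated one after another at more and more remote times. -/
lemma exists_split_coupling_uniform (ρ : Polymorphism μ)
    (hpos : ∀ A B : Set X, MeasurableSet A → MeasurableSet B → μ A ≠ 0 → μ B ≠ 0 →
      ρ.bistochastic (A ×ˢ B) ≠ 0)
    {u : ℕ → X → ℝ} (hu : ∀ j, Measurable (u j))
    (hu01 : ∀ j x, u j x ∈ Set.Icc (0 : ℝ) 1)
    (hgood : Tendsto (fun j => ∫⁻ p, edist (u j p.1) (u j p.2) ∂ρ.bistochastic) atTop (𝓝 0))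
    [NullSingletonClass μ] {ι : Type*} [Countable ι]
    [MeasurableSpace ι] [MeasurableSingletonClass ι] {s : X → ι} (hs : Measurable s)
    {δ κ η : ℝ≥0∞} (hκ : κ ≠ 0) (hη : η ≠ 0) (n : ℕ) :
    ∀ (Y : Set X) (_ : MeasurableSet Y) (_ : μ Y ≤ n * δ) (N : ℕ) (a : Bool → Measure X)
      (_ : a true + a false = μ.restrict Y),
    ∃ (χ : X → Bool) (c : Bool → Measure (X × X)), Measurable χ ∧ (∀ β,
      (c β).fst = a β ∧ (c β).snd = μ.restrict (Y ∩ χ ⁻¹' {β}) ∧ (∀ᵐ p ∂c β, s p.1 = s p.2) ∧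
      Tendsto (fun j => ∫⁻ p, edist (u j p.1) (u j p.2) ∂c β) atTop (𝓝 0)) ∧
      (∀ j < N, ∑ β, ∫⁻ p, edist (u j p.1) (u j p.2) ∂c β ≤ κ * μ Y) ∧
      ∀ j, ∑ β, ∫⁻ p, edist (u j p.1) (u j p.2) ∂c β ≤ δ + κ * μ Y + n * η := by
  have hbound : ∀ {Y : Set X} {a : Bool → Measure X} {c : Bool → Measure (X × X)} {b : ℝ≥0∞} {j : ℕ}
      (_ : a true + a false = μ.restrict Y) (_ : ∀ β, (c β).fst = a β)
      (_ : ∀ β, ∀ᵐ p ∂c β, edist (u j p.1) (u j p.2) ≤ b),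
      ∑ β, ∫⁻ p, edist (u j p.1) (u j p.2) ∂c β ≤ b * μ Y := fun {Y a c b j} ha hc hb => by
    calc ∑ β, ∫⁻ p, edist (u j p.1) (u j p.2) ∂c β ≤ ∑ β, ∫⁻ _, b ∂c β :=
          Finset.sum_le_sum fun β _ => lintegral_mono_ae (hb β)
      _ = b * μ Y := by
          simp_rw [lintegral_const, ← Finset.mul_sum, ← Measure.fst_univ, hc]
          rw [Fintype.sum_bool, ← Measure.add_apply, ha, Measure.restrict_apply_univ]
  have hone : ∀ (j : ℕ) (p : X × X), edist (u j p.1) (u j p.2) ≤ 1 := fun j p =>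
    edist_le_one (hu01 j _) (hu01 j _)
  induction n with
  | zero =>
    intro Y hY hYn N a ha
    obtain ⟨χ, c, hχ, hc⟩ := exists_split_coupling ρ hpos hu01 hgood hs hY ha
    have h0 : μ Y = 0 := by simpa using hYn
    have h1 : ∀ j, ∑ β, ∫⁻ p, edist (u j p.1) (u j p.2) ∂c β ≤ 0 := fun j => by
      have := hbound (j := j) ha (fun β => (hc β).1) fun β => Eventually.of_forall (hone j)
      rwa [h0, mul_zero] at this
    exact ⟨χ, c, hχ, hc, fun j _ => (h1 j).trans zero_le, fun j => (h1 j).trans zero_le⟩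
  | succ n ih =>
    intro Y hY hYn N a ha
    -- A piece of mass at most `δ` is treated now and the rest by induction.
    obtain ⟨Y₁, hY₁s, hY₁, hY₁m⟩ := exists_subset_measure_eq hY (min_le_right δ (μ Y))
    set Y₂ := Y \ Y₁ with hY₂d
    have hY₂ : MeasurableSet Y₂ := hY.diff hY₁
    have hsum : μ Y₁ + μ Y₂ = μ Y := by
      rw [hY₂d, measure_sdiff hY₁s hY₁.nullMeasurableSet (measure_ne_top _ _)]
      exact add_tsub_cancel_of_le (measure_mono hY₁s)
    have hY₂n : μ Y₂ ≤ n * δ := by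
      rcases le_total δ (μ Y) with h | h
      · rw [min_eq_left h] at hY₁m
        have hδ : δ ≠ ∞ := ne_top_of_le_ne_top (measure_ne_top _ _) h
        rw [← hsum, hY₁m] at hYn
        push_cast at hYn
        rw [add_mul, one_mul, add_comm] at hYn
        exact (ENNReal.add_le_add_iff_right hδ).1 hYn
      · rw [min_eq_right h] at hY₁m
        have : μ Y₂ = 0 := by
          rw [hY₁m] at hsum
          exact (ENNReal.add_right_inj (measure_ne_top μ Y)).1 (hsum.trans (add_zero _).symm)
        rw [this]; exact zero_le
    have hr : ∀ {V : Set X}, MeasurableSet V → V ⊆ Y →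
        (a true).restrict V + (a false).restrict V = μ.restrict V := fun {V} hV hVY => by
      rw [← Measure.restrict_add, ha, Measure.restrict_restrict hV, Set.inter_eq_left.2 hVY]
    obtain ⟨K, hK⟩ := ENNReal.exists_inv_nat_lt hκ
    have hK0 : (0 : ℝ) < K := by
      rcases Nat.eq_zero_or_pos K with h | h
      · simp [h] at hK
      · exact_mod_cast h
    -- The cells also record `u j` up to `1 / K` for `j < N`, so coupled points have values closer
    -- than `κ` at those times.
    obtain ⟨χ₁, c₁, hχ₁, hc₁⟩ := exists_split_coupling ρ hpos hu01 hgood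
      (γ := fun x => (s x, fun j : Fin N => ⌊(K : ℝ) * u j x⌋))
      (hs.prodMk (measurable_pi_lambda _ fun j => ((hu j).const_mul _).floor)) hY₁
      (a := fun β => (a β).restrict Y₁) (hr hY₁ hY₁s)
    have hfl : ∀ j < N, ∀ β, ∀ᵐ p ∂c₁ β, edist (u j p.1) (u j p.2) ≤ κ := fun j hj β => by
      filter_upwards [(hc₁ β).2.2.1] with p hp
      have h1 : ⌊(K : ℝ) * u j p.1⌋ = ⌊(K : ℝ) * u j p.2⌋ :=
        congrFun (congrArg Prod.snd hp) (⟨j, hj⟩ : Fin N)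
      have h2 := Int.abs_sub_lt_one_of_floor_eq_floor h1
      rw [← mul_sub, abs_mul, abs_of_pos hK0] at h2
      refine le_trans ?_ hK.le
      rw [edist_dist, Real.dist_eq, ← ENNReal.ofReal_natCast, ← ENNReal.ofReal_inv_of_pos hK0]
      refine ENNReal.ofReal_le_ofReal ?_
      rw [inv_eq_one_div, le_div_iff₀ hK0, mul_comm]
      exact h2.le
    have hE₁ : Tendsto (fun j => ∑ β, ∫⁻ p, edist (u j p.1) (u j p.2) ∂c₁ β) atTop (𝓝 0) := by
      have := tendsto_finsetSum Finset.univ fun β _ => (hc₁ β).2.2.2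
      simpa using this
    -- From time `N₁` on this piece costs at most `η`. The remaining pieces will be controlled
    -- before `max N N₁`, so at each time at most one piece is in its uncontrolled phase, and that
    -- piece costs at most its mass.
    obtain ⟨N₁, hN₁⟩ := eventually_atTop.1 ((ENNReal.tendsto_nhds_zero.1 hE₁) η
      (pos_iff_ne_zero.2 hη))
    obtain ⟨χ₂, c₂, hχ₂, hc₂, hlt₂, hall₂⟩ := ih Y₂ hY₂ hY₂n (max N N₁)
      (fun β => (a β).restrict Y₂) (hr hY₂ Set.sdiff_subset)
    classical
    have hadd : ∀ j, ∑ β, ∫⁻ p, edist (u j p.1) (u j p.2) ∂(c₁ β + c₂ β) =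
        ∑ β, ∫⁻ p, edist (u j p.1) (u j p.2) ∂c₁ β +
          ∑ β, ∫⁻ p, edist (u j p.1) (u j p.2) ∂c₂ β := fun j => by
      simp_rw [lintegral_add_measure]; exact Finset.sum_add_distrib
    have hχ : Measurable (Set.piecewise Y₁ χ₁ χ₂) := hχ₁.piecewise hY₁ hχ₂
    refine ⟨Set.piecewise Y₁ χ₁ χ₂, fun β => c₁ β + c₂ β, hχ,
      fun β => ⟨?_, ?_, ?_, ?_⟩, fun j hj => ?_, fun j => ?_⟩
    · rw [Measure.fst_add, (hc₁ β).1, (hc₂ β).1, hY₂d]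
      have h0 : a β Yᶜ = 0 := by
        have hle : a β ≤ μ.restrict Y := by
          rw [← ha]; cases β
          · exact Measure.le_add_left le_rfl
          · exact Measure.le_add_right le_rfl
        have := hle Yᶜ
        rw [Measure.restrict_apply hY.compl] at this
        simpa using this
      rw [← Measure.restrict_union Set.disjoint_sdiff_right hY₂, Set.union_sdiff_cancel hY₁s]
      exact Measure.restrict_eq_self_of_ae_mem (by rw [ae_iff]; exact h0)
    · rw [Measure.snd_add, (hc₁ β).2.1, (hc₂ β).2.1, ← Measure.restrict_union ?_
        (hY₂.inter (hχ₂ (measurableSet_singleton β)))]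
      · congr 1
        ext x
        by_cases hx : x ∈ Y₁
        · have := hY₁s hx
          simp [hx, this, hY₂d]
        · simp [hx, hY₂d]
      · exact (Set.disjoint_sdiff_right (s := Y₁) (t := Y)).mono Set.inter_subset_left
          Set.inter_subset_left
    · rw [ae_add_measure_iff]
      exact ⟨(hc₁ β).2.2.1.mono fun p hp => congrArg Prod.fst hp, (hc₂ β).2.2.1⟩
    · simp_rw [lintegral_add_measure]
      simpa using (hc₁ β).2.2.2.add (hc₂ β).2.2.2
    · rw [hadd, ← hsum, mul_add]
      exact add_le_add (hbound (hr hY₁ hY₁s) (fun β => (hc₁ β).1) (hfl j hj))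
        (hlt₂ j (hj.trans_le (le_max_left _ _)))
    · rw [hadd]
      push_cast
      -- Before this time the current piece may be uncontrolled and the others are finely matched;
      -- afterwards the current piece is done and costs `η`.
      by_cases hjN₁ : j < max N N₁
      · have h1 : ∑ β, ∫⁻ p, edist (u j p.1) (u j p.2) ∂c₁ β ≤ δ :=
          (hbound (hr hY₁ hY₁s) (fun β => (hc₁ β).1)
            fun β => Eventually.of_forall (hone j)).trans
            (by rw [one_mul, hY₁m]; exact min_le_left _ _)
        calc _ ≤ δ + κ * μ Y₂ := add_le_add h1 (hlt₂ j hjN₁)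
          _ ≤ δ + κ * μ Y := by gcongr; exact Set.sdiff_subset
          _ ≤ _ := le_self_add
      · have h1 := hN₁ j ((le_max_right _ _).trans (not_lt.1 hjN₁))
        calc _ ≤ η + (δ + κ * μ Y₂ + n * η) := add_le_add h1 (hall₂ j)
          _ = δ + κ * μ Y₂ + (n + 1) * η := by ring
          _ ≤ _ := by gcongr; exact Set.sdiff_subset

end Polymorphism

/-! ### Asymptotic couplings and their refinement. -/

/-- A coupling `J` of `μ` and `m` that asymptotically matches the functions `u j` with the
functions `v j`. -/
structure IsAsymptoticCoupling {X Z : Type*} [MeasurableSpace X] [MeasurableSpace Z]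
    (μ : Measure X) (m : Measure Z) (u : ℕ → X → ℝ) (v : ℕ → Z → ℝ) (J : Measure (X × Z)) :
    Prop where
  fst_eq : J.fst = μ
  snd_eq : J.snd = m
  tendsto : Tendsto (fun j => ∫⁻ p, edist (u j p.1) (v j p.2) ∂J) atTop (𝓝 0)

namespace IsAsymptoticCoupling

variable {X Z : Type*} [MeasurableSpace X] [MeasurableSpace Z] {μ : Measure X} {m : Measure Z}
  {u : ℕ → X → ℝ} {v : ℕ → Z → ℝ} {J : Measure (X × Z)}

lemma lintegral_swap (J : Measure (X × Z)) (f : X → ℝ) (g : Z → ℝ) :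
    ∫⁻ p, edist (g p.1) (f p.2) ∂(J.map Prod.swap) = ∫⁻ p, edist (f p.1) (g p.2) ∂J := by
  rw [show (Prod.swap : X × Z → Z × X) = MeasurableEquiv.prodComm from rfl, lintegral_map_equiv]
  exact lintegral_congr fun p => edist_comm _ _

lemma swap (h : IsAsymptoticCoupling μ m u v J) :
    IsAsymptoticCoupling m μ v u (J.map Prod.swap) where
  fst_eq := by rw [Measure.fst_map_swap, h.snd_eq]
  snd_eq := by rw [Measure.snd_map_swap, h.fst_eq]
  tendsto := by simpa only [lintegral_swap] using h.tendsto

end IsAsymptoticCoupling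

/-- One step of the construction: a coupling is changed a little so that a given set in the second
space is identified with a set in the first space. -/
lemma IsAsymptoticCoupling.exists_refine {X Z : Type*} [MeasurableSpace X] [StandardBorelSpace X]
    [Nonempty X] [MeasurableSpace Z] [StandardBorelSpace Z] [Nonempty Z] {μ : Measure X}
    [IsProbabilityMeasure μ] [NullSingletonClass μ] {m : Measure Z}
    (ρ : Polymorphism μ)
    (hpos : ∀ A B : Set X, MeasurableSet A → MeasurableSet B → μ A ≠ 0 → μ B ≠ 0 →
      ρ.bistochastic (A ×ˢ B) ≠ 0)
    {u : ℕ → X → ℝ} {v : ℕ → Z → ℝ} (hu : ∀ j, Measurable (u j)) (hv : ∀ j, Measurable (v j))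
    (hu01 : ∀ j x, u j x ∈ Set.Icc (0 : ℝ) 1)
    (hρ : Tendsto (fun j => ∫⁻ p, edist (u j p.1) (u j p.2) ∂ρ.bistochastic) atTop (𝓝 0))
    {J : Measure (X × Z)} (hJ : IsAsymptoticCoupling μ m u v J)
    {ι : Type*} [Countable ι] [MeasurableSpace ι] [MeasurableSingletonClass ι]
    {s : X → ι} {t : Z → ι} (hs : Measurable s) (ht : Measurable t)
    (hst : ∀ᵐ p ∂J, s p.1 = t p.2) {B : Z → Bool} (hB : Measurable B) {ε : ℝ≥0∞} (hε : ε ≠ 0) :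
    ∃ (J' : Measure (X × Z)) (χ : X → Bool), Measurable χ ∧ IsAsymptoticCoupling μ m u v J' ∧
      (∀ᵐ p ∂J', s p.1 = t p.2) ∧ (∀ᵐ p ∂J', χ p.1 = B p.2) ∧
      ∀ j, ∫⁻ p, edist (u j p.1) (v j p.2) ∂J' ≤ ∫⁻ p, edist (u j p.1) (v j p.2) ∂J + ε := by
  have hJfin : IsFiniteMeasure J := ⟨by
    rw [← Measure.fst_univ, hJ.fst_eq]; exact measure_lt_top _ _⟩
  have hset : ∀ β, MeasurableSet {p : X × Z | B p.2 = β} := fun β =>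
    (hB.comp measurable_snd) (measurableSet_singleton β)
  set Jβ : Bool → Measure (X × Z) := fun β => J.restrict {p | B p.2 = β} with hJβ
  have hJsum : Jβ true + Jβ false = J := by
    rw [hJβ, ← Measure.restrict_union _ (hset false)]
    · have : {p : X × Z | B p.2 = true} ∪ {p | B p.2 = false} = Set.univ := by
        ext p; cases h : B p.2 <;> simp [h]
      rw [this, Measure.restrict_univ]
    · rw [Set.disjoint_left]
      intro p hp hp'
      have h1 : B p.2 = true := hp
      have h2 : B p.2 = false := hp'
      simp [h1] at h2
  obtain ⟨n, hn0, hn⟩ : ∃ n : ℕ, n ≠ 0 ∧ (n : ℝ≥0∞)⁻¹ ≤ ε / 3 := by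
    obtain ⟨n, hn⟩ := ENNReal.exists_inv_nat_lt (a := ε / 3) (by simp [hε])
    refine ⟨n, ?_, hn.le⟩
    rintro rfl
    simp at hn
  have hn0' : (n : ℝ≥0∞) ≠ 0 := by exact_mod_cast hn0
  have hε3 : ε / 3 ≠ 0 := by simp [hε]
  have hη : ε / 3 / n ≠ 0 := ENNReal.div_ne_zero.2 ⟨hε3, ENNReal.natCast_ne_top n⟩
  -- With `δ = 1 / n`, `κ = ε / 3` and `η = ε / (3n)`, each of the three error terms is at most `ε /
  -- 3`. The bound before time `N` serves only the induction there, hence `N = 0`.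
  obtain ⟨χ, c, hχ, hc, -, hcε⟩ := ρ.exists_split_coupling_uniform hpos hu hu01 hρ hs
    (δ := (n : ℝ≥0∞)⁻¹) (κ := ε / 3) (η := ε / 3 / n) hε3 hη n Set.univ
    MeasurableSet.univ (by simp [ENNReal.mul_inv_cancel hn0' (ENNReal.natCast_ne_top n)]) 0
    (fun β => (Jβ β).fst) (by rw [← Measure.fst_add, hJsum, hJ.fst_eq, Measure.restrict_univ])
  have hcε' : ∀ j, ∑ β, ∫⁻ p, edist (u j p.1) (u j p.2) ∂c β ≤ ε := fun j => by
    refine (hcε j).trans ?_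
    rw [measure_univ, mul_one, ENNReal.mul_div_cancel hn0' (ENNReal.natCast_ne_top n)]
    calc _ ≤ ε / 3 + ε / 3 + ε / 3 := by gcongr
      _ = ε := ENNReal.add_thirds ε
  have hcfin : ∀ β, IsFiniteMeasure (c β) := fun β => ⟨by
    rw [← Measure.fst_univ, (hc β).1]; exact measure_lt_top _ _⟩
  -- Gluing along the old point of `X` and forgetting it yields the new coupling: the new point lies
  -- in the half `χ = β` while its partner lies in `B = β`.
  choose g hg1 hg2 using fun β => exists_gluing (c β) (Jβ β) (hc β).1
  have hgJ : ∀ β, (g β).snd.fst = μ.restrict (χ ⁻¹' {β}) := fun β => by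
    rw [← Set.univ_inter (χ ⁻¹' {β}), ← (hc β).2.1, ← hg1 β, Measure.fst, Measure.snd,
      Measure.snd, Measure.map_map (by fun_prop) (by fun_prop),
      Measure.map_map (by fun_prop) (by fun_prop)]
    rfl
  have hgJ' : ∀ β, (g β).snd.snd = (Jβ β).snd := fun β => by
    rw [← hg2 β, Measure.snd, Measure.snd, Measure.snd,
      Measure.map_map (by fun_prop) (by fun_prop),
      Measure.map_map (by fun_prop) (by fun_prop)]
    rfl
  have hm1 : Measurable fun p : X × X × Z => (p.1, p.2.1) := by fun_prop
  have hm2 : Measurable fun p : X × X × Z => (p.1, p.2.2) := by fun_prop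
  have hint : ∀ j, ∫⁻ p, edist (u j p.1) (v j p.2) ∂((g true).snd + (g false).snd) ≤
      ∑ β, ∫⁻ p, edist (u j p.1) (u j p.2) ∂c β + ∫⁻ p, edist (u j p.1) (v j p.2) ∂J := fun j => by
    have huv := measurable_edist_pair (hu j) (hv j)
    have huu := measurable_edist_pair (hu j) (hu j)
    have h1 : ∀ β, ∫⁻ p, edist (u j p.1) (v j p.2) ∂(g β).snd ≤
        ∫⁻ p, edist (u j p.1) (u j p.2) ∂c β + ∫⁻ p, edist (u j p.1) (v j p.2) ∂Jβ β := fun β => by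
      conv_rhs => rw [← hg1 β]
      rw [← hg2 β, Measure.snd, lintegral_map huv measurable_snd, lintegral_map huu hm1,
        lintegral_map huv hm2, ← lintegral_add_left (f := fun p : X × X × Z =>
          edist (u j p.1) (u j p.2.1)) (huu.comp hm1)]
      gcongr with p
      exact edist_triangle_left _ _ _
    rw [lintegral_add_measure, Fintype.sum_bool]
    refine (add_le_add (h1 true) (h1 false)).trans (le_of_eq ?_)
    conv_rhs => rw [← hJsum, lintegral_add_measure]
    ring
  have hae : ∀ {p : X × Z → Prop}, MeasurableSet {x | p x} → (∀ β, ∀ᵐ x ∂g β, p x.2) →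
      ∀ᵐ x ∂((g true).snd + (g false).snd), p x := fun {p} hp h => by
    rw [ae_add_measure_iff]
    exact ⟨(ae_map_iff measurable_snd.aemeasurable hp).2 (h true),
      (ae_map_iff measurable_snd.aemeasurable hp).2 (h false)⟩
  have hstβ : ∀ β, ∀ᵐ x ∂g β, s x.2.1 = t x.2.2 := fun β => by
    have h1 : ∀ᵐ x ∂g β, s x.1 = s x.2.1 :=
      ae_of_ae_map (f := fun p : X × X × Z => (p.1, p.2.1)) hm1.aemeasurable
        (by rw [hg1 β]; exact (hc β).2.2.1)
    have h2 : ∀ᵐ x ∂g β, s x.1 = t x.2.2 :=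
      ae_of_ae_map (f := fun p : X × X × Z => (p.1, p.2.2)) hm2.aemeasurable
        (by rw [hg2 β]; exact ae_restrict_of_ae hst)
    filter_upwards [h1, h2] with x hx1 hx2 using hx1.symm.trans hx2
  have hχβ : ∀ β, ∀ᵐ x ∂g β, χ x.2.1 = B x.2.2 := fun β => by
    have h1 : ∀ᵐ x ∂g β, χ x.2.1 = β := by
      have h3 : ∀ᵐ x ∂(g β).snd.fst, χ x = β := by
        rw [hgJ β]; exact ae_restrict_mem (hχ (measurableSet_singleton β))
      exact ae_of_ae_map measurable_snd.aemeasurable (ae_of_ae_map measurable_fst.aemeasurable h3)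
    have h2 : ∀ᵐ x ∂g β, B x.2.2 = β :=
      ae_of_ae_map (f := fun p : X × X × Z => (p.1, p.2.2)) (p := fun y => B y.2 = β)
        hm2.aemeasurable (by rw [hg2 β]; exact ae_restrict_mem (hset β))
    filter_upwards [h1, h2] with x hx1 hx2 using hx1.trans hx2.symm
  refine ⟨(g true).snd + (g false).snd, χ, hχ, ⟨?_, ?_, ?_⟩,
    hae (measurableSet_eq_fun (hs.comp measurable_fst) (ht.comp measurable_snd)) hstβ,
    hae (measurableSet_eq_fun (hχ.comp measurable_fst) (hB.comp measurable_snd)) hχβ,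
    fun j => ?_⟩
  · rw [Measure.fst_add, hgJ, hgJ, ← Measure.restrict_union _ (hχ (measurableSet_singleton false))]
    · have : χ ⁻¹' {true} ∪ χ ⁻¹' {false} = Set.univ := by
        ext x; cases h : χ x <;> simp [h]
      rw [this, Measure.restrict_univ]
    · exact Disjoint.preimage _ (by simp)
  · rw [Measure.snd_add, hgJ', hgJ', ← Measure.snd_add, hJsum, hJ.snd_eq]
  · have h1 : Tendsto (fun j => ∑ β, ∫⁻ p, edist (u j p.1) (u j p.2) ∂c β +
        ∫⁻ p, edist (u j p.1) (v j p.2) ∂J) atTop (𝓝 0) := by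
      have := (tendsto_finsetSum Finset.univ fun β _ => (hc β).2.2.2).add hJ.tendsto
      simpa using this
    exact tendsto_of_tendsto_of_tendsto_of_le_of_le tendsto_const_nhds h1 (fun _ => zero_le) hint
  · refine (hint j).trans ?_
    rw [add_comm]
    gcongr
    exact hcε' j

section Refine

variable {X Z : Type*} [MeasurableSpace X] [StandardBorelSpace X] [Nonempty X]
  [MeasurableSpace Z] [StandardBorelSpace Z] [Nonempty Z] {μ : Measure X} [IsProbabilityMeasure μ]
  [NullSingletonClass μ] {m : Measure Z} [IsProbabilityMeasure m] [NullSingletonClass m]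
  {u : ℕ → X → ℝ} {v : ℕ → Z → ℝ}

/-- The data of an asymptotic coupling together with matching countable partitions of both
spaces. -/
structure MatchedCoupling (μ : Measure X) (m : Measure Z) (u : ℕ → X → ℝ) (v : ℕ → Z → ℝ) where
  J : Measure (X × Z)
  s : X → ℕ
  t : Z → ℕ
  isAsymptoticCoupling : IsAsymptoticCoupling μ m u v J
  measurable_s : Measurable s
  measurable_t : Measurable t
  ae_eq : ∀ᵐ p ∂J, s p.1 = t p.2

/-- One step back and forth. First `B` is matched with a set of `X`, then, with exchanged spaces,
`A` with a set of `Z`. The first match is put into the partitions and so survives the second half;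
each half costs `ε / 2`. -/
lemma MatchedCoupling.exists_refine (ρ : Polymorphism μ)
    (hρpos : ∀ A B : Set X, MeasurableSet A → MeasurableSet B → μ A ≠ 0 → μ B ≠ 0 →
      ρ.bistochastic (A ×ˢ B) ≠ 0)
    (hρ : Tendsto (fun j => ∫⁻ p, edist (u j p.1) (u j p.2) ∂ρ.bistochastic) atTop (𝓝 0))
    (σ : Polymorphism m)
    (hσpos : ∀ A B : Set Z, MeasurableSet A → MeasurableSet B → m A ≠ 0 → m B ≠ 0 →
      σ.bistochastic (A ×ˢ B) ≠ 0)
    (hσ : Tendsto (fun j => ∫⁻ p, edist (v j p.1) (v j p.2) ∂σ.bistochastic) atTop (𝓝 0))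
    (hu : ∀ j, Measurable (u j)) (hv : ∀ j, Measurable (v j))
    (hu01 : ∀ j x, u j x ∈ Set.Icc (0 : ℝ) 1) (hv01 : ∀ j z, v j z ∈ Set.Icc (0 : ℝ) 1)
    (q : MatchedCoupling μ m u v) {A : X → Bool} (hA : Measurable A) {B : Z → Bool}
    (hB : Measurable B) {ε : ℝ≥0∞} (hε : ε ≠ 0) :
    ∃ (q' : MatchedCoupling μ m u v) (χ : X → Bool) (τ : Z → Bool), Measurable χ ∧ Measurable τ ∧
      (∀ x z, q'.s x = q'.t z → q.s x = q.t z ∧ A x = τ z ∧ χ x = B z) ∧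
      ∀ j, ∫⁻ p, edist (u j p.1) (v j p.2) ∂q'.J ≤ ∫⁻ p, edist (u j p.1) (v j p.2) ∂q.J + ε := by
  have hε2 : ε / 2 ≠ 0 := by simp [hε]
  obtain ⟨J₁, χ, hχ, hJ₁, hst₁, hχB, hle₁⟩ := q.isAsymptoticCoupling.exists_refine ρ hρpos hu hv
    hu01 hρ q.measurable_s q.measurable_t q.ae_eq hB hε2
  have hpair : ∀ᵐ p ∂J₁.map Prod.swap, (q.t p.1, B p.1) = (q.s p.2, χ p.2) := by
    rw [ae_map_iff measurable_swap.aemeasurable]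
    · filter_upwards [hst₁, hχB] with p h1 h2
      simp [h1, h2]
    · exact measurableSet_eq_fun
        ((q.measurable_t.comp measurable_fst).prodMk (hB.comp measurable_fst))
        ((q.measurable_s.comp measurable_snd).prodMk (hχ.comp measurable_snd))
  obtain ⟨J₂, τ, hτ, hJ₂, hst₂, hτA, hle₂⟩ := hJ₁.swap.exists_refine σ hσpos hv hu hv01 hσ
    (q.measurable_t.prodMk hB) (q.measurable_s.prodMk hχ) hpair hA hε2
  have hs : Measurable fun x => Encodable.encode ((q.s x, χ x), A x) :=
    (measurable_of_countable (Encodable.encode : (ℕ × Bool) × Bool → ℕ)).comp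
      ((q.measurable_s.prodMk hχ).prodMk hA)
  have ht : Measurable fun z => Encodable.encode ((q.t z, B z), τ z) :=
    (measurable_of_countable (Encodable.encode : (ℕ × Bool) × Bool → ℕ)).comp
      ((q.measurable_t.prodMk hB).prodMk hτ)
  refine ⟨⟨J₂.map Prod.swap, _, _, hJ₂.swap, hs, ht, ?_⟩, χ, τ, hχ, hτ, fun x z h => ?_,
    fun j => ?_⟩
  · refine (ae_map_iff measurable_swap.aemeasurable (measurableSet_eq_fun (hs.comp measurable_fst)
      (ht.comp measurable_snd))).2 ?_
    filter_upwards [hst₂, hτA] with p h1 h2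
    change Encodable.encode ((q.s p.2, χ p.2), A p.2) = Encodable.encode ((q.t p.1, B p.1), τ p.1)
    rw [h1, h2]
  · have h1 := Encodable.encode_injective h
    simp only [Prod.mk.injEq] at h1
    exact ⟨h1.1.1, h1.2, h1.1.2⟩
  · change ∫⁻ p, edist (u j p.1) (v j p.2) ∂(J₂.map Prod.swap) ≤ _
    rw [IsAsymptoticCoupling.lintegral_swap]
    refine (hle₂ j).trans ?_
    rw [IsAsymptoticCoupling.lintegral_swap]
    refine (add_le_add (hle₁ j) le_rfl).trans ?_
    rw [add_assoc, ENNReal.add_halves]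

/-- Iteration of the back-and-forth step. Each partition refines its predecessors, so every match
made once holds under all later couplings. -/
lemma IsAsymptoticCoupling.exists_seq {J₀ : Measure (X × Z)}
    (hJ₀ : IsAsymptoticCoupling μ m u v J₀) (ρ : Polymorphism μ)
    (hρpos : ∀ A B : Set X, MeasurableSet A → MeasurableSet B → μ A ≠ 0 → μ B ≠ 0 →
      ρ.bistochastic (A ×ˢ B) ≠ 0)
    (hρ : Tendsto (fun j => ∫⁻ p, edist (u j p.1) (u j p.2) ∂ρ.bistochastic) atTop (𝓝 0))
    (σ : Polymorphism m)
    (hσpos : ∀ A B : Set Z, MeasurableSet A → MeasurableSet B → m A ≠ 0 → m B ≠ 0 →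
      σ.bistochastic (A ×ˢ B) ≠ 0)
    (hσ : Tendsto (fun j => ∫⁻ p, edist (v j p.1) (v j p.2) ∂σ.bistochastic) atTop (𝓝 0))
    (hu : ∀ j, Measurable (u j)) (hv : ∀ j, Measurable (v j))
    (hu01 : ∀ j x, u j x ∈ Set.Icc (0 : ℝ) 1) (hv01 : ∀ j z, v j z ∈ Set.Icc (0 : ℝ) 1)
    {A : ℕ → X → Bool} (hA : ∀ k, Measurable (A k)) {B : ℕ → Z → Bool}
    (hB : ∀ k, Measurable (B k)) {ε : ℕ → ℝ≥0∞} (hε : ∀ k, ε k ≠ 0) :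
    ∃ (J : ℕ → Measure (X × Z)) (χ : ℕ → X → Bool) (τ : ℕ → Z → Bool),
      (∀ k, Measurable (χ k)) ∧ (∀ k, Measurable (τ k)) ∧
      (∀ k, IsAsymptoticCoupling μ m u v (J k)) ∧
      (∀ k, ∀ᵐ p ∂J k, ∀ l < k, A l p.1 = τ l p.2 ∧ χ l p.1 = B l p.2) ∧
      ∀ k j, ∫⁻ p, edist (u j p.1) (v j p.2) ∂J (k + 1) ≤
        ∫⁻ p, edist (u j p.1) (v j p.2) ∂J k + ε k := by
  choose next chi tau hchi htau hdec hle using fun (k : ℕ) (q : MatchedCoupling μ m u v) =>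
    q.exists_refine ρ hρpos hρ σ hσpos hσ hu hv hu01 hv01 (hA k) (hB k) (hε k)
  -- The start uses the partitions into one cell, which `J₀` matches trivially.
  let q : ℕ → MatchedCoupling μ m u v := fun k => Nat.rec
    ⟨J₀, fun _ => 0, fun _ => 0, hJ₀, measurable_const, measurable_const,
      Eventually.of_forall fun _ => rfl⟩ (fun k q => next k q) k
  have hdec' : ∀ k x z, (q k).s x = (q k).t z →
      ∀ l < k, A l x = tau l (q l) z ∧ chi l (q l) x = B l z := by
    intro k x z
    induction k with
    | zero => intro _ l hl; exact absurd hl (Nat.not_lt_zero l)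
    | succ k ih =>
      intro h l hl
      obtain ⟨h1, h2, h3⟩ := hdec k (q k) x z h
      rcases Nat.lt_succ_iff_lt_or_eq.1 hl with h4 | rfl
      · exact ih h1 l h4
      · exact ⟨h2, h3⟩
  exact ⟨fun k => (q k).J, fun k => chi k (q k), fun k => tau k (q k), fun k => hchi k _,
    fun k => htau k _, fun k => (q k).isAsymptoticCoupling,
    fun k => (q k).ae_eq.mono fun p hp => hdec' k p.1 p.2 hp, fun k j => hle k (q k) j⟩

end Refine

/-! ### Isomorphisms from injective codings. -/

section Upgrade

variable {X Z W : Type*} [MeasurableSpace X] [StandardBorelSpace X]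
  [MeasurableSpace Z] [StandardBorelSpace Z] [MeasurableSpace W] [StandardBorelSpace W]

/-- A non-null standard Borel set without atoms contains an uncountable null set. -/
lemma exists_null_not_countable {ν : Measure W} [IsFiniteMeasure ν] [NullSingletonClass ν]
    {U : Set W} (hU : MeasurableSet U) (hU0 : ν U ≠ 0) :
    ∃ V ⊆ U, MeasurableSet V ∧ ν V = 0 ∧ ¬ V.Countable := by
  have hUS : StandardBorelSpace U := hU.standardBorel
  have hUc : ¬ Countable U := fun h => hU0 ((Set.to_countable U).measure_zero ν)
  have hR : ¬ Countable (ℝ × ℝ) := fun h =>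
    not_countable (α := ℝ) (Function.Injective.countable (f := fun x : ℝ => (x, (0 : ℝ)))
      fun a b hab => congrArg Prod.fst hab)
  let e : U ≃ᵐ ℝ × ℝ := PolishSpace.measurableEquivOfNotCountable hUc hR
  let V : ℝ → Set W := fun a => Subtype.val '' (e ⁻¹' (Prod.fst ⁻¹' {a}))
  have hVm : ∀ a, MeasurableSet (V a) := fun a => (MeasurableEmbedding.subtype_coe hU
    ).measurableSet_image.2 (e.measurable (measurable_fst (measurableSet_singleton a)))
  have hVd : Pairwise (Function.onFun Disjoint V) := fun a b hab => by
    refine Set.disjoint_image_of_injective Subtype.val_injective ?_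
    refine Disjoint.preimage _ (Disjoint.preimage _ ?_)
    simpa using hab
  -- In the coordinates `ℝ × ℝ` the vertical lines form an uncountable disjoint family of
  -- uncountable sets, and only countably many of them can be non-null.
  have hcount : Set.Countable {a | 0 < ν (V a)} :=
    Measure.countable_meas_pos_of_disjoint_iUnion hVm hVd
  obtain ⟨a, ha⟩ : ∃ a, a ∉ {a | 0 < ν (V a)} := by
    by_contra! h
    have h1 : (Set.univ : Set ℝ).Countable := hcount.mono fun a _ => h a
    exact Set.not_countable_univ h1
  refine ⟨V a, by rintro _ ⟨x, -, rfl⟩; exact x.2, hVm a, ?_, fun hc => ?_⟩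
  · exact le_antisymm (not_lt.1 ha) zero_le
  · have h1 : (e ⁻¹' (Prod.fst ⁻¹' {a})).Countable :=
      Set.countable_of_injective_of_countable_image Subtype.val_injective.injOn hc
    have h2 : ((fun y : ℝ => e.symm (a, y)) ⁻¹' (e ⁻¹' (Prod.fst ⁻¹' {a}))).Countable :=
      h1.preimage_of_injOn fun y _ z _ hyz => by
        have := e.symm.injective hyz
        exact congrArg Prod.snd this
    have h3 : (fun y : ℝ => e.symm (a, y)) ⁻¹' (e ⁻¹' (Prod.fst ⁻¹' {a})) = Set.univ := by
      ext y; simp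
    rw [h3] at h2
    exact Set.not_countable_univ h2

lemma exists_preimage_measurableEquiv {r : X → W} (hr : MeasurableEmbedding r) {D : Set W}
    (hD : MeasurableSet D) (hDr : D ⊆ Set.range r) :
    ∃ e : (r ⁻¹' D) ≃ᵐ D, ∀ x, (e x : W) = r x := by
  let e : (r ⁻¹' D) ≃ D := Equiv.ofBijective (fun x => ⟨r x, x.2⟩)
    ⟨fun x y hxy => Subtype.ext (hr.injective (congrArg Subtype.val hxy)), fun w => by
      obtain ⟨x, hx⟩ := hDr w.2
      exact ⟨⟨x, by rw [Set.mem_preimage, hx]; exact w.2⟩, Subtype.ext hx⟩⟩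
  have he : Measurable e := (hr.measurable.comp measurable_subtype_coe).subtype_mk
  refine ⟨⟨e, he, fun A hA => ?_⟩, fun x => rfl⟩
  have h3 : e.symm ⁻¹' A = Subtype.val ⁻¹' (r '' (Subtype.val '' A)) := by
    ext w
    constructor
    · intro hw
      exact ⟨_, ⟨_, hw, rfl⟩, congrArg Subtype.val (e.apply_symm_apply w)⟩
    · rintro ⟨_, ⟨x, hx, rfl⟩, hxw⟩
      have : e x = w := Subtype.ext hxw
      change e.symm w ∈ A
      rw [← this, Equiv.symm_apply_apply]
      exact hx
  rw [h3]
  exact measurable_subtype_coe (hr.measurableSet_image.2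
    ((MeasurableEmbedding.subtype_coe (hr.measurable hD)).measurableSet_image.2 hA))

/-- Ensures that what is left over outside the common part of two codings is uncountable, so that
leftovers are Borel isomorphic. -/
lemma not_countable_compl_preimage_diff {r : X → W} {U V : Set W} (hVr : V ⊆ Set.range r)
    (hVc : ¬ V.Countable) : ¬ Countable ((r ⁻¹' (U \ V))ᶜ : Set X) := by
  intro hc
  refine hVc (((Set.to_countable ((r ⁻¹' (U \ V))ᶜ : Set X)).image r).mono fun w hw => ?_)
  obtain ⟨x, rfl⟩ := hVr hw
  exact ⟨x, fun hx => hx.2 hw, rfl⟩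

/-- Two injective codings with the same distribution give an isomorphism of non-atomic
probability spaces. -/
lemma exists_measurableEquiv_of_map_eq {μ : Measure X} [IsProbabilityMeasure μ]
    [NullSingletonClass μ] {m : Measure Z} {s : X → W} {t : Z → W} (hs : Measurable s)
    (ht : Measurable t) (hsi : Function.Injective s) (hti : Function.Injective t)
    (h : μ.map s = m.map t) :
    ∃ R : X ≃ᵐ Z, MeasurePreserving R μ m ∧ ∀ᵐ x ∂μ, t (R x) = s x := by
  have hse := hs.measurableEmbedding hsi
  have hte := ht.measurableEmbedding hti
  set ν := μ.map s with hν
  have : IsProbabilityMeasure ν := Measure.isProbabilityMeasure_map hs.aemeasurable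
  have : NullSingletonClass ν := ⟨fun w => by
    rw [hν, Measure.map_apply hs (measurableSet_singleton w)]
    exact (Set.subsingleton_singleton.preimage hsi).measure_zero _⟩
  set U := Set.range s ∩ Set.range t with hUdef
  have hUm : MeasurableSet U := hse.measurableSet_range.inter hte.measurableSet_range
  have h1 : ∀ᵐ w ∂ν, w ∈ Set.range s := ae_map_mem_range s hse.measurableSet_range μ
  have h2 : ∀ᵐ w ∂ν, w ∈ Set.range t := by
    rw [h]; exact ae_map_mem_range t hte.measurableSet_range m
  have hU1 : ∀ᵐ w ∂ν, w ∈ U := by filter_upwards [h1, h2] with w hw1 hw2 using ⟨hw1, hw2⟩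
  have hU0 : ν U ≠ 0 := by
    rw [prob_compl_eq_zero_iff hUm |>.1 (by rw [ae_iff] at hU1; exact hU1)]
    exact one_ne_zero
  obtain ⟨V, hVU, hVm, hV0, hVc⟩ := exists_null_not_countable hUm hU0
  -- The codes common to both spaces, without the null set `V`. Over `D` the isomorphism is dictated
  -- by the codes; the two uncountable null leftovers are matched arbitrarily.
  set D := U \ V with hD
  have hDm : MeasurableSet D := hUm.diff hVm
  have hD1 : ∀ᵐ w ∂ν, w ∈ D := by
    have : ∀ᵐ w ∂ν, w ∉ V := by rw [ae_iff]; simpa using hV0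
    filter_upwards [hU1, this] with w hw1 hw2 using ⟨hw1, hw2⟩
  have hDs : D ⊆ Set.range s := fun w hw => hw.1.1
  have hDt : D ⊆ Set.range t := fun w hw => hw.1.2
  have hsD : MeasurableSet (s ⁻¹' D) := hs hDm
  have htD : MeasurableSet (t ⁻¹' D) := ht hDm
  obtain ⟨e₁, he₁⟩ := exists_preimage_measurableEquiv hse hDm hDs
  obtain ⟨e₂, he₂⟩ := exists_preimage_measurableEquiv hte hDm hDt
  have := hsD.compl.standardBorel
  have := htD.compl.standardBorel
  let e₃ : ((s ⁻¹' D)ᶜ : Set X) ≃ᵐ ((t ⁻¹' D)ᶜ : Set Z) :=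
    PolishSpace.measurableEquivOfNotCountable
      (not_countable_compl_preimage_diff (hVU.trans Set.inter_subset_left) hVc)
      (not_countable_compl_preimage_diff (hVU.trans Set.inter_subset_right) hVc)
  classical
  let R : X ≃ᵐ Z := (MeasurableEquiv.sumCompl hsD).symm.trans
    ((MeasurableEquiv.sumCongr (e₁.trans e₂.symm) e₃).trans (MeasurableEquiv.sumCompl htD))
  have hR : ∀ x ∈ s ⁻¹' D, t (R x) = s x := fun x hx => by
    have h3 : R x = (e₂.symm (e₁ ⟨x, hx⟩) : Z) := by
      change (MeasurableEquiv.sumCompl htD) ((MeasurableEquiv.sumCongr (e₁.trans e₂.symm) e₃)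
        ((MeasurableEquiv.sumCompl hsD).symm x)) = _
      have : (MeasurableEquiv.sumCompl hsD).symm x = Sum.inl ⟨x, hx⟩ := by
        rw [MeasurableEquiv.symm_apply_eq]; rfl
      rw [this]; rfl
    rw [h3, ← he₂, MeasurableEquiv.apply_symm_apply, he₁]
  have hRae : ∀ᵐ x ∂μ, t (R x) = s x := by
    filter_upwards [ae_of_ae_map hs.aemeasurable hD1] with x hx using hR x hx
  refine ⟨R, ⟨R.measurable, ?_⟩, hRae⟩
  have h3 : (μ.map R).map t = m.map t := by
    rw [Measure.map_map ht R.measurable, ← h]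
    exact Measure.map_congr hRae
  have h4 := congrArg (Measure.comap t) h3
  rwa [hte.comap_map, hte.comap_map] at h4

end Upgrade

/-! ### From asymptotic couplings to isomorphisms. -/

section AsymptoticIsomorphism

/-- Counting the levels `i / K` below `a` approximates `a` up to `1 / K`. -/
lemma abs_sum_level_sub_le {a : ℝ} (ha : a ∈ Set.Icc (0 : ℝ) 1) {K : ℕ} (hK : 0 < K) :
    |(∑ i ∈ Finset.Icc 1 K, if (i : ℝ) / K ≤ a then (1 : ℝ) else 0) / K - a| ≤ 1 / K := by
  have hK' : (0 : ℝ) < K := by exact_mod_cast hK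
  have hfl : ⌊K * a⌋₊ ≤ K := by
    have : (K : ℝ) * a ≤ K := mul_le_of_le_one_right hK'.le ha.2
    exact Nat.floor_le_of_le this
  -- The number of levels below `a` is `⌊K * a⌋₊`.
  have h1 : (Finset.Icc 1 K).filter (fun i : ℕ => (i : ℝ) / K ≤ a) = Finset.Icc 1 ⌊K * a⌋₊ := by
    ext i
    simp only [Finset.mem_filter, Finset.mem_Icc]
    rw [div_le_iff₀ hK', mul_comm a, ← Nat.le_floor_iff (mul_nonneg hK'.le ha.1)]
    constructor
    · exact fun h => ⟨h.1.1, h.2⟩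
    · exact fun h => ⟨⟨h.1, h.2.trans hfl⟩, h.2⟩
  rw [Finset.sum_boole, h1, Nat.card_Icc, Nat.add_sub_cancel]
  have h2 := Nat.floor_le (mul_nonneg hK'.le ha.1)
  have h3 := Nat.lt_floor_add_one (K * a)
  have h4 : (⌊K * a⌋₊ : ℝ) / K - a = (⌊K * a⌋₊ - K * a) / K := by field_simp
  rw [h4, abs_div, abs_of_pos hK']
  gcongr
  rw [abs_le]
  constructor <;> linarith

variable {X Z : Type*} [MeasurableSpace X] [StandardBorelSpace X] [Nonempty X]
  [MeasurableSpace Z] [StandardBorelSpace Z] [Nonempty Z] {μ : Measure X} [IsProbabilityMeasure μ]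
  [NullSingletonClass μ] {m : Measure Z} [IsProbabilityMeasure m] [NullSingletonClass m]
  {u : ℕ → X → ℝ} {v : ℕ → Z → ℝ}

/-- Couplings that match more and more terms of two sequences of functions show that these
sequences have the same distribution. -/
lemma map_eq_of_forall_coupling {E : Type*} [MeasurableSpace E] [Countable E]
    [MeasurableSingletonClass E] {s : ℕ → X → E} {t : ℕ → Z → E}
    (hs : ∀ k, Measurable (s k)) (ht : ∀ k, Measurable (t k))
    (h : ∀ k, ∃ J : Measure (X × Z), J.fst = μ ∧ J.snd = m ∧ ∀ᵐ p ∂J, ∀ l < k, s l p.1 = t l p.2) :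
    μ.map (fun x k => s k x) = m.map (fun z k => t k z) := by
  have hs' : Measurable fun x k => s k x := measurable_pi_lambda _ hs
  have ht' : Measurable fun z k => t k z := measurable_pi_lambda _ ht
  have := Measure.isProbabilityMeasure_map (μ := μ) hs'.aemeasurable
  have := Measure.isProbabilityMeasure_map (μ := m) ht'.aemeasurable
  refine IsProjectiveLimit.unique (P := fun I => (m.map fun z k => t k z).map I.restrict)
    (fun I => ?_) (fun I => rfl)
  -- A coupling that matches all coordinates in the finite set `I`; finite marginals determine the
  -- law.
  obtain ⟨J, hJ1, hJ2, hJ⟩ := h (I.sup id + 1)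
  have hr := Finset.measurable_restrict (X := fun _ : ℕ => E) I
  change (μ.map fun x k => s k x).map I.restrict = (m.map fun z k => t k z).map I.restrict
  rw [Measure.map_map hr hs', Measure.map_map hr ht', ← hJ1, ← hJ2, Measure.fst, Measure.snd,
    Measure.map_map (hr.comp hs') measurable_fst, Measure.map_map (hr.comp ht') measurable_snd]
  refine Measure.map_congr ?_
  filter_upwards [hJ] with p hp
  funext i
  exact hp i (Nat.lt_succ_of_le (Finset.le_sup (f := id) i.2))

/-- An ergodic asymptotic coupling of two non-atomic spaces can be replaced by an isomorphism. -/
theorem IsAsymptoticCoupling.exists_measurableEquiv {J₀ : Measure (X × Z)}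
    (hJ₀ : IsAsymptoticCoupling μ m u v J₀)
    (hu : ∀ j, Measurable (u j)) (hv : ∀ j, Measurable (v j))
    (hu01 : ∀ j x, u j x ∈ Set.Icc (0 : ℝ) 1) (hv01 : ∀ j z, v j z ∈ Set.Icc (0 : ℝ) 1)
    (herg : ∀ (A : Set X) (B : Set Z), MeasurableSet A → MeasurableSet B →
      (∀ᵐ p ∂J₀, p.1 ∈ A ↔ p.2 ∈ B) → μ A = 0 ∨ μ Aᶜ = 0) :
    ∃ R : X ≃ᵐ Z, MeasurePreserving R μ m ∧
      Tendsto (fun j => ∫⁻ x, edist (u j x) (v j (R x)) ∂μ) atTop (𝓝 0) := by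
  have hJp : IsProbabilityMeasure J₀ := ⟨by rw [← Measure.fst_univ, hJ₀.fst_eq]; exact measure_univ⟩
  have hJp' : IsProbabilityMeasure (J₀.map Prod.swap) :=
    Measure.isProbabilityMeasure_map measurable_swap.aemeasurable
  obtain ⟨ρ, hρ, hρpos⟩ := exists_selfCoupling J₀ hJ₀.fst_eq hu hv hJ₀.tendsto herg
  -- The ergodicity hypothesis passes to `Z` because sets identified by `J₀` have equal measures.
  obtain ⟨σ, hσ, hσpos⟩ := exists_selfCoupling (J₀.map Prod.swap) hJ₀.swap.fst_eq hv hu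
    hJ₀.swap.tendsto (fun A B hA hB h => by
      have h1 : ∀ᵐ p ∂J₀, p.1 ∈ B ↔ p.2 ∈ A := by
        filter_upwards [ae_of_ae_map measurable_swap.aemeasurable h] with p hp using hp.symm
      have h2 : ∀ {A' : Set Z} {B' : Set X}, MeasurableSet A' → MeasurableSet B' →
          (∀ᵐ p ∂J₀, p.1 ∈ B' ↔ p.2 ∈ A') → m A' = μ B' := fun {A' B'} hA' hB' h' => by
        rw [← hJ₀.fst_eq, ← hJ₀.snd_eq, Measure.fst_apply hB', Measure.snd_apply hA']
        exact measure_congr (h'.mono fun p hp => propext hp.symm)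
      rw [h2 hA hB h1, h2 hA.compl hB.compl (h1.mono fun p hp => not_congr hp)]
      exact herg B A hB hA h1)
  obtain ⟨cX, hcX, hcXi⟩ := MeasurableSpace.measurable_injection_nat_bool_of_countablySeparated X
  obtain ⟨cZ, hcZ, hcZi⟩ := MeasurableSpace.measurable_injection_nat_bool_of_countablySeparated Z
  classical
  -- The first summand separates the points of `Z`. The second, with index `(i, K, j)`, records the
  -- level set `i / K ≤ v j`, so that the codes also approximate every `v j`.
  let B' : ℕ ⊕ ℕ × ℕ × ℕ → Z → Bool := fun i z =>
    Sum.elim (fun i => cZ z i) (fun i => decide ((i.1 : ℝ) / i.2.1 ≤ v i.2.2 z)) i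
  have hB' : ∀ i, Measurable (B' i) := by
    rintro (i | i)
    · exact (measurable_pi_apply i).comp hcZ
    · refine measurable_to_bool ?_
      convert measurableSet_le (f := fun _ : Z => (i.1 : ℝ) / i.2.1) measurable_const (hv i.2.2)
        using 1
      ext z; simp [B']
  -- Indices that decode to nothing give a constant set, which is harmless.
  let B : ℕ → Z → Bool := fun k z => ((Encodable.decode k).map fun i => B' i z).getD true
  have hBenc : ∀ i, B (Encodable.encode i) = B' i := fun i => by
    funext z; simp only [B, Encodable.encodek, Option.map_some, Option.getD_some]
  have hB : ∀ k, Measurable (B k) := fun k => by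
    change Measurable fun z => (Option.map (fun i => B' i z) _).getD true
    generalize (Encodable.decode k : Option (ℕ ⊕ ℕ × ℕ × ℕ)) = o
    cases o with
    | none => exact measurable_const
    | some i => exact hB' i
  let A : ℕ → X → Bool := fun k x => cX x k
  have hA : ∀ k, Measurable (A k) := fun k => (measurable_pi_apply k).comp hcX
  obtain ⟨J, χ, τ, hχ, hτ, hJ, hdec, hle⟩ := hJ₀.exists_seq ρ hρpos hρ σ hσpos hσ hu hv hu01 hv01
    hA hB (ε := fun k => (2⁻¹ : ℝ≥0∞) ^ k) (fun k => by simp)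
  have hmap : μ.map (fun x k => (A k x, χ k x)) = m.map (fun z k => (τ k z, B k z)) :=
    map_eq_of_forall_coupling (fun k => (hA k).prodMk (hχ k)) (fun k => (hτ k).prodMk (hB k))
      fun k => ⟨J k, (hJ k).fst_eq, (hJ k).snd_eq, (hdec k).mono fun p hp l hl => by
        rw [(hp l hl).1, (hp l hl).2]⟩
  obtain ⟨R, hRm, hR⟩ := exists_measurableEquiv_of_map_eq
    (measurable_pi_lambda _ fun k => (hA k).prodMk (hχ k))
    (measurable_pi_lambda _ fun k => (hτ k).prodMk (hB k))
    (fun x y hxy => hcXi (funext fun k => congrArg Prod.fst (congrFun hxy k)))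
    (fun x y hxy => hcZi (funext fun k => by
      have := congrArg Prod.snd (congrFun hxy (Encodable.encode (Sum.inl k : ℕ ⊕ ℕ × ℕ × ℕ)))
      rw [hBenc] at this; exact this)) hmap
  refine ⟨R, hRm, ?_⟩
  -- The function `H` reads `v j` up to `1 / K` from the code of `x`. This is valid both along `R`
  -- and along `J k` once `k` exceeds the finitely many indices involved, whence two errors `1 / K`.
  have happrox : ∀ j k₀, ∀ K : ℕ, 0 < K → ∃ k ≥ k₀, ∫⁻ x, edist (u j x) (v j (R x)) ∂μ ≤
      ∫⁻ p, edist (u j p.1) (v j p.2) ∂J k + 2 * (K : ℝ≥0∞)⁻¹ := fun j k₀ K hK => by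
    have hK' : (0 : ℝ) < K := by exact_mod_cast hK
    let code : ℕ → ℕ := fun i => Encodable.encode (Sum.inr (i, K, j) : ℕ ⊕ ℕ × ℕ × ℕ)
    let H : X → ℝ := fun x => (∑ i ∈ Finset.Icc 1 K, if χ (code i) x = true then (1 : ℝ) else 0) / K
    have hH : Measurable H := (Finset.measurable_sum _ fun i _ =>
      Measurable.ite ((hχ _) (measurableSet_singleton true)) measurable_const
        measurable_const).div_const _
    have hHv : ∀ x z, (∀ i ∈ Finset.Icc 1 K, χ (code i) x = B (code i) z) →
        edist (H x) (v j z) ≤ (K : ℝ≥0∞)⁻¹ := fun x z hxz => by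
      have h1 : H x = (∑ i ∈ Finset.Icc 1 K, if (i : ℝ) / K ≤ v j z then (1 : ℝ) else 0) / K := by
        simp only [H]
        congr 1
        refine Finset.sum_congr rfl fun i hi => ?_
        rw [hxz i hi, show B (code i) z = decide ((i : ℝ) / K ≤ v j z) from
          congrFun (hBenc _) z]
        simp
      rw [h1, edist_dist, Real.dist_eq, ← ENNReal.ofReal_natCast, ← ENNReal.ofReal_inv_of_pos hK',
        ← one_div]
      exact ENNReal.ofReal_le_ofReal (abs_sum_level_sub_le (hv01 j z) hK)
    refine ⟨max k₀ ((Finset.Icc 1 K).sup code + 1), le_max_left _ _, ?_⟩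
    set k := max k₀ ((Finset.Icc 1 K).sup code + 1) with hk
    have hcode : ∀ i ∈ Finset.Icc 1 K, code i < k := fun i hi =>
      (Nat.lt_succ_of_le (Finset.le_sup hi)).trans_le (le_max_right _ _)
    have h1 : ∫⁻ x, edist (u j x) (v j (R x)) ∂μ ≤ ∫⁻ x, edist (u j x) (H x) ∂μ + (K : ℝ≥0∞)⁻¹ := by
      calc _ ≤ ∫⁻ x, (edist (u j x) (H x) + (K : ℝ≥0∞)⁻¹) ∂μ := by
            refine lintegral_mono_ae ?_
            filter_upwards [hR] with x hx
            refine (edist_triangle _ (H x) _).trans ?_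
            gcongr
            exact hHv x (R x) fun i _ => (congrArg Prod.snd (congrFun hx (code i))).symm
        _ = _ := by rw [lintegral_add_right _ measurable_const]; simp
    have h2 : ∫⁻ x, edist (u j x) (H x) ∂μ ≤
        ∫⁻ p, edist (u j p.1) (v j p.2) ∂J k + (K : ℝ≥0∞)⁻¹ := by
      have hJk : IsProbabilityMeasure (J k) :=
        ⟨by rw [← Measure.fst_univ, (hJ k).fst_eq]; exact measure_univ⟩
      rw [← (hJ k).fst_eq, Measure.fst, lintegral_map ((hu j).edist hH) measurable_fst]
      calc _ ≤ ∫⁻ p, (edist (u j p.1) (v j p.2) + (K : ℝ≥0∞)⁻¹) ∂J k := by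
            refine lintegral_mono_ae ?_
            filter_upwards [hdec k] with p hp
            refine (edist_triangle _ (v j p.2) _).trans ?_
            gcongr
            rw [edist_comm]
            exact hHv p.1 p.2 fun i hi => (hp (code i) (hcode i hi)).2
        _ = _ := by rw [lintegral_add_right _ measurable_const]; simp
    calc _ ≤ _ := h1
      _ ≤ _ := add_le_add h2 le_rfl
      _ = _ := by rw [add_assoc, two_mul]
  -- The estimate is uniform in `j`; this is why the refinement costs had to be small at all times.
  have htail : ∀ j k₀ n, ∫⁻ p, edist (u j p.1) (v j p.2) ∂J (k₀ + n) ≤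
      ∫⁻ p, edist (u j p.1) (v j p.2) ∂J k₀ + ∑' i, (2⁻¹ : ℝ≥0∞) ^ (i + k₀) := fun j k₀ n => by
    have h1 : ∫⁻ p, edist (u j p.1) (v j p.2) ∂J (k₀ + n) ≤
        ∫⁻ p, edist (u j p.1) (v j p.2) ∂J k₀ + ∑ i ∈ Finset.range n, (2⁻¹ : ℝ≥0∞) ^ (i + k₀) := by
      induction n with
      | zero => simp
      | succ n ih =>
        rw [Finset.sum_range_succ, ← add_assoc, ← add_assoc]
        refine (hle (k₀ + n) j).trans ?_
        rw [add_comm k₀ n] at ih ⊢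
        gcongr
    refine h1.trans ?_
    gcongr
    exact ENNReal.sum_le_tsum _
  -- Here `K → ∞`, with `j` and `k₀` fixed.
  have hfinal : ∀ j k₀, ∫⁻ x, edist (u j x) (v j (R x)) ∂μ ≤
      ∫⁻ p, edist (u j p.1) (v j p.2) ∂J k₀ + ∑' i, (2⁻¹ : ℝ≥0∞) ^ (i + k₀) := fun j k₀ => by
    have h1 : Tendsto (fun K : ℕ => ∫⁻ p, edist (u j p.1) (v j p.2) ∂J k₀ +
        ∑' i, (2⁻¹ : ℝ≥0∞) ^ (i + k₀) + 2 * (K : ℝ≥0∞)⁻¹) atTop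
        (𝓝 (∫⁻ p, edist (u j p.1) (v j p.2) ∂J k₀ + ∑' i, (2⁻¹ : ℝ≥0∞) ^ (i + k₀) + 2 * 0)) :=
      tendsto_const_nhds.add (ENNReal.Tendsto.const_mul ENNReal.tendsto_inv_nat_nhds_zero
        (Or.inr (by simp)))
    rw [mul_zero, add_zero] at h1
    refine ge_of_tendsto h1 ?_
    filter_upwards [eventually_gt_atTop 0] with K hK
    obtain ⟨k, hk, hkle⟩ := happrox j k₀ K hK
    obtain ⟨n, rfl⟩ := Nat.exists_eq_add_of_le hk
    exact hkle.trans (by gcongr; exact htail j k₀ n)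
  rw [ENNReal.tendsto_nhds_zero]
  intro ε hε
  have hsum : ∑' i, (2⁻¹ : ℝ≥0∞) ^ i ≠ ∞ := by
    rw [ENNReal.tsum_geometric, ENNReal.one_sub_inv_two, inv_inv]; simp
  obtain ⟨k₀, hk₀⟩ := ((ENNReal.tendsto_nhds_zero.1 (ENNReal.tendsto_sum_nat_add _ hsum)) (ε / 2)
    (ENNReal.half_pos hε.ne')).exists
  filter_upwards [(ENNReal.tendsto_nhds_zero.1 (hJ k₀).tendsto) (ε / 2)
    (ENNReal.half_pos hε.ne')] with j hj
  calc _ ≤ _ := hfinal j k₀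
    _ ≤ ε / 2 + ε / 2 := add_le_add hj hk₀
    _ = ε := ENNReal.add_halves ε

end AsymptoticIsomorphism

/-! ### The one-sided Markov chain. -/

namespace Polymorphism

section Trajectory

variable {X : Type*} [MeasurableSpace X] [StandardBorelSpace X] [Nonempty X]
  {μ : Measure X} [IsProbabilityMeasure μ]

/-- The transition kernels of the Markov chain of a polymorphism, as functions of the history. -/
def step (P : Polymorphism μ) (n : ℕ) : Kernel ((i : Finset.Iic n) → X) X :=
  P.value.comap (fun h => h ⟨n, by simp⟩) (measurable_pi_apply _)

instance (P : Polymorphism μ) (n : ℕ) : IsMarkovKernel (P.step n) := by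
  unfold step; infer_instance

lemma trajectory_apply (P : Polymorphism μ) (x : X) :
    P.trajectory x = Kernel.traj (X := fun _ => X) P.step 0 (fun _ => x) := rfl

/-- The finite piece of a sequence after time `1`. -/
def shiftIic (b : ℕ) (h : (i : Finset.Iic (b + 1)) → X) : (i : Finset.Iic b) → X :=
  fun i => h ⟨i + 1, by have := Finset.mem_Iic.1 i.2; simp; omega⟩

lemma measurable_shiftIic (b : ℕ) : Measurable (shiftIic (X := X) b) :=
  measurable_pi_lambda _ fun _ => measurable_pi_apply _

lemma partialTraj_succ_self_apply (P : Polymorphism μ) (b : ℕ) (h : (i : Finset.Iic b) → X) :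
    Kernel.partialTraj (X := fun _ => X) P.step b (b + 1) h = (P.value (h ⟨b, by simp⟩)).map
      (fun z i => if hi : i.1 ≤ b then h ⟨i.1, Finset.mem_Iic.2 hi⟩ else z) := by
  have hm : Measurable (IicProdIoc (X := fun _ : ℕ => X) b (b + 1)) := measurable_IicProdIoc
  rw [Kernel.partialTraj_succ_self, Kernel.map_apply _ hm, Kernel.prod_apply,
    Kernel.id_apply, Kernel.map_apply _ (by fun_prop), Measure.dirac_prod,
    Measure.map_map hm (by fun_prop), Measure.map_map (by fun_prop) (by fun_prop)]
  change Measure.map _ (P.value (h ⟨b, by simp⟩)) = _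
  congr 1
  funext z i
  simp only [Function.comp_apply, IicProdIoc]
  split_ifs with hi
  · rfl
  · obtain ⟨i, hi'⟩ := i
    obtain rfl : i = b + 1 := by have := Finset.mem_Iic.1 hi'; simp only at hi; omega
    rfl

/-- Time homogeneity: the next state depends only on the last one, so deleting the initial state
commutes with each extension by one step. -/
lemma partialTraj_map_shiftIic (P : Polymorphism μ) (x : X) (b : ℕ) (z : X) :
    (Kernel.partialTraj (X := fun _ => X) P.step 1 (b + 1)
      (fun i => if i.1 = 0 then x else z)).map (shiftIic b) =
    Kernel.partialTraj (X := fun _ => X) P.step 0 b (fun _ => z) := by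
  induction b with
  | zero =>
    rw [Kernel.partialTraj_self, Kernel.partialTraj_self, Kernel.id_apply, Kernel.id_apply,
      Measure.map_dirac' (measurable_shiftIic 0)]
    congr 1
  | succ b ih =>
    rw [Kernel.partialTraj_succ_eq_comp (Nat.le_add_left 1 b),
      Kernel.partialTraj_succ_eq_comp (Nat.zero_le b), Kernel.comp_apply, Kernel.comp_apply, ← ih]
    ext s hs
    rw [Measure.map_apply (measurable_shiftIic _) hs,
      Measure.bind_apply (measurable_shiftIic _ hs) (Kernel.aemeasurable _),
      Measure.bind_apply hs (Kernel.aemeasurable _),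
      lintegral_map (Kernel.measurable_coe _ hs) (measurable_shiftIic _)]
    refine lintegral_congr fun h => ?_
    rw [partialTraj_succ_self_apply, partialTraj_succ_self_apply,
      ← Measure.map_apply (measurable_shiftIic _) hs, Measure.map_map (measurable_shiftIic _)]
    · congr 2
      funext z i
      simp only [Function.comp_apply, shiftIic]
      by_cases hi : i.1 ≤ b
      · rw [dif_pos hi, dif_pos (by omega)]
      · rw [dif_neg hi, dif_neg (by omega)]
    · refine measurable_pi_lambda _ fun i => ?_
      by_cases hi : i.1 ≤ b + 1
      · simp only [dif_pos hi]; exact measurable_const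
      · simp only [dif_neg hi]; exact measurable_id

/-- The future of the Markov chain after its first step is the Markov chain started at the first
step. -/
lemma trajectory_map_shift (P : Polymorphism μ) :
    P.trajectory.map (fun w n => w (n + 1)) = P.trajectory ∘ₖ P.value := by
  have hm : Measurable fun (w : ℕ → X) n => w (n + 1) :=
    measurable_pi_lambda _ fun _ => measurable_pi_apply _
  -- The trajectory is determined by its finite pieces, so it suffices to compare these.
  have h1 : ∀ x z, (Kernel.traj (X := fun _ => X) P.step 1
      (fun i => if i.1 = 0 then x else z)).map (fun w n => w (n + 1)) = P.trajectory z := by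
    intro x z
    have h3 : Measurable fun (z : X) (i : Finset.Iic 1) => if i.1 = 0 then x else z :=
      measurable_pi_lambda _ fun i => by
        by_cases hi : i.1 = 0
        · simp only [hi, if_true]; exact measurable_const
        · simp only [hi, if_false]; exact measurable_id
    have h4 : Measurable fun h : (i : Finset.Iic 0) → X => h ⟨0, by simp⟩ := measurable_pi_apply _
    have h2 := Kernel.eq_traj (X := fun _ => X) P.step (a := 0)
      (((Kernel.traj (X := fun _ => X) P.step 1).comap _ (h3.comp h4)).map fun w n => w (n + 1))
      fun b => by
        ext h : 1
        have h5 : h = fun _ => h ⟨0, by simp⟩ := by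
          funext i
          congr 1
          exact Subtype.ext (Nat.le_zero.1 (Finset.mem_Iic.1 i.2))
        rw [Kernel.map_apply _ (by fun_prop), Kernel.map_apply _ hm, Kernel.comap_apply,
          Measure.map_map (by fun_prop) hm]
        conv_rhs => rw [h5, ← P.partialTraj_map_shiftIic x, ← Kernel.traj_map_frestrictLe_apply,
          Measure.map_map (measurable_shiftIic _) (by fun_prop)]
        rfl
    rw [trajectory_apply, ← h2, Kernel.map_apply _ hm]
    rfl
  ext x : 1
  rw [Kernel.map_apply _ hm, trajectory_apply,
    ← Kernel.traj_comp_partialTraj (X := fun _ => X) (κ := P.step) zero_le_one,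
    Kernel.comp_apply, Kernel.comp_apply,
    show Kernel.partialTraj (X := fun _ => X) P.step 0 1 (fun _ => x) = _ from
      partialTraj_succ_self_apply P 0 _]
  ext s hs
  rw [Measure.map_apply hm hs, Measure.bind_apply (hm hs) (Kernel.aemeasurable _),
    Measure.bind_apply hs (Kernel.aemeasurable _), lintegral_map (Kernel.measurable_coe _ (hm hs))]
  · refine lintegral_congr fun z => ?_
    rw [← h1 x z, Measure.map_apply hm hs]
    congr 2
    funext i
    simp
  · refine measurable_pi_lambda _ fun i => ?_
    by_cases hi : i.1 ≤ 0
    · simp only [dif_pos hi]; exact measurable_const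
    · simp only [dif_neg hi]; exact measurable_id

lemma trajectory_map_zero (P : Polymorphism μ) (x : X) :
    (P.trajectory x).map (fun w => w 0) = Measure.dirac x := by
  have h := Kernel.traj_map_frestrictLe_apply (X := fun _ => X) (κ := P.step) 0 0 (fun _ => x)
  rw [Kernel.partialTraj_self, Kernel.id_apply] at h
  have h2 := congrArg (Measure.map fun h : (i : Finset.Iic 0) → X => h ⟨0, by simp⟩) h
  rw [Measure.map_map (by fun_prop) (by fun_prop), Measure.map_dirac' (by fun_prop)] at h2
  exact h2

lemma ae_trajectory_zero (P : Polymorphism μ) (x : X) : ∀ᵐ w ∂P.trajectory x, w 0 = x := by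
  have h : ∀ᵐ z ∂((P.trajectory x).map (fun w : ℕ → X => w 0)), z = x := by
    rw [trajectory_map_zero]
    exact (ae_dirac_iff (measurableSet_eq)).2 rfl
  exact ae_of_ae_map (measurable_pi_apply 0).aemeasurable h

/-- The `n`-step transition probabilities are the values of the powers. -/
lemma trajectory_map_eval (P : Polymorphism μ) (n : ℕ) :
    P.trajectory.map (fun w => w n) =ᵐ[μ] (P ^ n).value := by
  induction n with
  | zero =>
    rw [pow_zero]
    filter_upwards [value_one (μ := μ)] with x hx
    rw [hx, Kernel.map_apply _ (by fun_prop), trajectory_map_zero, Kernel.id_apply]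
  | succ n ih =>
    rw [pow_succ]
    filter_upwards [value_mul (P ^ n) P, comp_congr_left ih P] with x hx hx'
    rw [hx, ← hx', ← Kernel.map_comp, ← trajectory_map_shift, ← Kernel.map_comp_right _
      (f := fun (w : ℕ → X) k => w (k + 1)) (by fun_prop) (g := fun w : ℕ → X => w n) (by fun_prop)]
    rfl

end Trajectory

end Polymorphism

/-! ### Shifts, the past tail, and stationarity. -/

namespace Polymorphism

section Shift

variable {X : Type*} [MeasurableSpace X]

/-- The future of a two-sided sequence, starting at time `0`. -/
def fwd (y : ℤ → X) (n : ℕ) : X := y n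

/-- The past of a two-sided sequence, starting at time `0` and read backwards. -/
def back (y : ℤ → X) (n : ℕ) : X := y (-n)

/-- The powers of the left shift. -/
def shiftBy (n : ℤ) (y : ℤ → X) : ℤ → X := fun k => y (k + n)

lemma measurable_fwd : Measurable (fwd (X := X)) :=
  measurable_pi_lambda _ fun _ => measurable_pi_apply _

lemma measurable_back : Measurable (back (X := X)) :=
  measurable_pi_lambda _ fun _ => measurable_pi_apply _

lemma measurable_shiftBy (n : ℤ) : Measurable (shiftBy (X := X) n) :=
  measurable_pi_lambda _ fun _ => measurable_pi_apply _

lemma leftShift_eq_shiftBy : leftShift (X := X) = shiftBy 1 := rfl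

lemma shiftBy_shiftBy (m n : ℤ) (y : ℤ → X) : shiftBy m (shiftBy n y) = shiftBy (m + n) y := by
  funext k
  simp only [shiftBy, add_assoc]

lemma shiftBy_zero (y : ℤ → X) : shiftBy 0 y = y := by
  funext k
  simp only [shiftBy, add_zero]

lemma measurable_shiftBy_pastTail (n : ℤ) :
    Measurable[pastTail X, pastTail X] (shiftBy (X := X) n) := by
  rw [measurable_iff_comap_le]
  refine le_iInf fun N => ?_
  refine (MeasurableSpace.comap_mono (iInf_le _ (N + n.natAbs))).trans ?_
  rw [MeasurableSpace.comap_iSup]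
  refine iSup_le fun k => ?_
  rw [MeasurableSpace.comap_comp]
  have hk : k.1 + n ≤ -(N : ℤ) := by have := k.2; omega
  exact le_iSup (fun k : {k : ℤ // k ≤ -(N : ℤ)} =>
    MeasurableSpace.comap (fun y : ℤ → X => y k) inferInstance) ⟨k.1 + n, hk⟩

/-- Hence a tail function can be evaluated from the past alone, which allows the use of the
conditional independence of past and future. -/
lemma pastTail_le_comap_back :
    pastTail X ≤ MeasurableSpace.comap (back (X := X)) inferInstance := by
  refine (iInf_le _ 0).trans (iSup_le fun k => ?_)
  rw [← measurable_iff_comap_le]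
  have hk : (fun y : ℤ → X => y k) = (fun w : ℕ → X => w k.1.natAbs) ∘ back := by
    funext y
    have h1 : -((k.1.natAbs : ℕ) : ℤ) = k.1 := by have := k.2; omega
    simp only [Function.comp_apply, back, h1]
  rw [hk]
  exact (measurable_pi_apply _).comp (comap_measurable _)

lemma pastTail_le : pastTail X ≤ (inferInstance : MeasurableSpace (ℤ → X)) :=
  pastTail_le_comap_back.trans measurable_back.comap_le

lemma exists_eq_comp_back {Z : Type*} [MeasurableSpace Z] [StandardBorelSpace Z] [Nonempty Z]
    {F : (ℤ → X) → Z} (hF : Measurable[pastTail X] F) :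
    ∃ F' : (ℕ → X) → Z, Measurable F' ∧ F = F' ∘ back :=
  (hF.mono pastTail_le_comap_back le_rfl).exists_eq_measurable_comp

end Shift

section Markov

variable {X : Type*} [MeasurableSpace X] [StandardBorelSpace X] [Nonempty X]
  {μ : Measure X} [IsProbabilityMeasure μ]

/-- `glue` discards the initial state of the backward chain; nothing is lost, since both chains
almost surely start at the same state. -/
lemma markovMeasure_map_fwd_back (P : Polymorphism μ) :
    P.markovMeasure.map (fun y => (fwd y, back y)) = (P.trajectory ×ₖ P.conj.trajectory) ∘ₘ μ := by
  have hm : Measurable fun y : ℤ → X => (fwd y, back y) := measurable_fwd.prodMk measurable_back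
  rw [markovMeasure, Measure.map_map hm measurable_glue]
  conv_rhs => rw [← Measure.map_id (μ := (P.trajectory ×ₖ P.conj.trajectory) ∘ₘ μ)]
  refine Measure.map_congr ?_
  have h0 : MeasurableSet {w : (ℕ → X) × (ℕ → X) | w.1 0 = w.2 0} :=
    measurableSet_eq_fun (by fun_prop) (by fun_prop)
  have h1 : ∀ᵐ w ∂((P.trajectory ×ₖ P.conj.trajectory) ∘ₘ μ), w.1 0 = w.2 0 := by
    refine (Measure.ae_comp_iff h0).2 (ae_of_all _ fun x => ?_)
    rw [Kernel.prod_apply]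
    refine (Measure.ae_prod_iff_ae_ae h0).2 ?_
    filter_upwards [P.ae_trajectory_zero x] with w hw
    filter_upwards [P.conj.ae_trajectory_zero x] with w' hw'
    rw [hw, hw']
  filter_upwards [h1] with w hw
  refine Prod.ext rfl (funext fun n => ?_)
  cases n with
  | zero => exact hw
  | succ n => rfl

/-- The future and the past are conditionally independent given the present. -/
lemma lintegral_fwd_mul_back (P : Polymorphism μ) {f g : (ℕ → X) → ℝ≥0∞} (hf : Measurable f)
    (hg : Measurable g) : ∫⁻ y, f (fwd y) * g (back y) ∂P.markovMeasure =
      ∫⁻ x, (∫⁻ w, f w ∂P.trajectory x) * ∫⁻ w, g w ∂P.conj.trajectory x ∂μ := by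
  have hm : Measurable fun y : ℤ → X => (fwd y, back y) := measurable_fwd.prodMk measurable_back
  rw [← lintegral_map (μ := P.markovMeasure) (f := fun w => f w.1 * g w.2) (by fun_prop) hm,
    markovMeasure_map_fwd_back, Measure.lintegral_bind (Kernel.aemeasurable _) (by fun_prop)]
  refine lintegral_congr fun x => ?_
  rw [Kernel.prod_apply, lintegral_prod_mul hf.aemeasurable hg.aemeasurable]

lemma lintegral_trajectory_succ (P : Polymorphism μ) {f : (ℕ → X) → ℝ≥0∞} (hf : Measurable f)
    (x : X) : ∫⁻ w, f (fun n => w (n + 1)) ∂P.trajectory x =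
      ∫⁻ z, ∫⁻ w, f w ∂P.trajectory z ∂P.value x := by
  rw [← lintegral_map (μ := P.trajectory x) hf (by fun_prop),
    ← Kernel.map_apply _ (by fun_prop), trajectory_map_shift, Kernel.comp_apply,
    Measure.lintegral_bind (Kernel.aemeasurable _) hf.aemeasurable]

/-- A path can be cut along the step from time 0 to time 1. With the origin at either end of this
step, the law is the integral over `P.bistochastic` of a future from the second state times a past
from the first. -/
lemma measurePreserving_leftShift (P : Polymorphism μ) :
    MeasurePreserving leftShift P.markovMeasure P.markovMeasure := by
  have hS : Measurable (leftShift (X := X)) := measurable_shiftBy 1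
  -- The past now omits the present, hence the index `k - 1`; `glue` never reads `k = 0`.
  let G : (ℕ → X) × (ℕ → X) → ℤ → X := fun w => glue (w.1, fun k => w.2 (k - 1))
  have hG : Measurable G := measurable_glue.comp (by fun_prop)
  let φ : (ℤ → X) → (ℕ → X) × (ℕ → X) := fun y => (fun n => fwd y (n + 1), back y)
  let ψ : (ℤ → X) → (ℕ → X) × (ℕ → X) := fun y => (fwd y, fun n => back y (n + 1))
  have hφ : Measurable φ := by
    have := measurable_fwd (X := X); have := measurable_back (X := X); fun_prop
  have hψ : Measurable ψ := by
    have := measurable_fwd (X := X); have := measurable_back (X := X); fun_prop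
  have hGφ : G ∘ φ = leftShift := by
    funext y n
    cases n with
    | ofNat n => rfl
    | negSucc n =>
      change y (-(n : ℤ)) = y (Int.negSucc n + 1)
      congr 1
      omega
  have hGψ : G ∘ ψ = id := by
    funext y n
    cases n with
    | ofNat n => rfl
    | negSucc n => rfl
  refine ⟨hS, ?_⟩
  rw [← hGφ, ← Measure.map_map hG hφ]
  conv_rhs => rw [← Measure.map_id (μ := P.markovMeasure), ← hGψ, ← Measure.map_map hG hψ]
  congr 1
  have := Measure.isProbabilityMeasure_map (μ := P.markovMeasure) hφ.aemeasurable
  refine Measure.ext_prod_iff.2 fun {A B} hA hB => ?_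
  have h1 : ∀ {m : Measure (ℤ → X)} {f : (ℤ → X) → (ℕ → X) × (ℕ → X)}, Measurable f →
      m.map f (A ×ˢ B) =
        ∫⁻ y, A.indicator 1 (f y).1 * B.indicator (1 : (ℕ → X) → ℝ≥0∞) (f y).2 ∂m := fun {m f} hf => by
    rw [Measure.map_apply hf (hA.prod hB), ← lintegral_indicator_one (hf (hA.prod hB))]
    refine lintegral_congr fun y => ?_
    by_cases h : (f y).1 ∈ A <;> by_cases h' : (f y).2 ∈ B <;> simp [h, h', Set.indicator]
  rw [h1 hφ, h1 hψ]
  have hA' : Measurable (A.indicator (1 : (ℕ → X) → ℝ≥0∞)) := measurable_one.indicator hA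
  have hB' : Measurable (B.indicator (1 : (ℕ → X) → ℝ≥0∞)) := measurable_one.indicator hB
  have h2 := P.lintegral_fwd_mul_back (f := fun w => A.indicator 1 fun n => w (n + 1))
    (hA'.comp (by fun_prop)) hB'
  have h3 := P.lintegral_fwd_mul_back (g := fun w => B.indicator 1 fun n => w (n + 1))
    hA' (hB'.comp (by fun_prop))
  refine h2.trans (Eq.trans ?_ h3.symm)
  simp_rw [lintegral_trajectory_succ _ hA', lintegral_trajectory_succ _ hB',
    lintegral_indicator_one hA, lintegral_indicator_one hB]
  have h4 := P.trajectory.measurable_coe hA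
  have h5 := P.conj.trajectory.measurable_coe hB
  have h6 := P.lintegral_bistochastic (f := fun p => P.trajectory p.2 A * P.conj.trajectory p.1 B)
    (by fun_prop)
  have h7 := P.conj.lintegral_bistochastic
    (f := fun p => P.trajectory p.1 A * P.conj.trajectory p.2 B) (by fun_prop)
  simp_rw [lintegral_mul_const _ h4] at h6
  simp_rw [lintegral_const_mul _ h5] at h7
  rw [← h6, ← h7]
  change _ = ∫⁻ p, _ ∂(P.bistochastic.map Prod.swap)
  rw [lintegral_map (by fun_prop) measurable_swap]
  rfl

lemma measurePreserving_shiftBy (P : Polymorphism μ) (n : ℤ) :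
    MeasurePreserving (shiftBy n) P.markovMeasure P.markovMeasure := by
  have h1 : ∀ n : ℕ, MeasurePreserving (shiftBy n) P.markovMeasure P.markovMeasure := fun n => by
    induction n with
    | zero =>
      convert! MeasurePreserving.id P.markovMeasure
      exact funext shiftBy_zero
    | succ n ih =>
      convert! ih.comp P.measurePreserving_leftShift
      funext y
      rw [leftShift_eq_shiftBy, Function.comp_apply, shiftBy_shiftBy, Nat.cast_succ]
  obtain ⟨n, rfl | rfl⟩ := n.eq_nat_or_neg
  · exact h1 n
  · refine ⟨measurable_shiftBy _, ?_⟩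
    conv_lhs => rw [← (h1 n).map_eq]
    rw [Measure.map_map (measurable_shiftBy _) (measurable_shiftBy _)]
    convert! Measure.map_id
    funext y
    rw [Function.comp_apply, shiftBy_shiftBy, neg_add_cancel, shiftBy_zero, id]

end Markov

end Polymorphism

/-! ### Conditioning tail functions on the present. -/

namespace Polymorphism

section PastMean

variable {X : Type*} [MeasurableSpace X] [StandardBorelSpace X] [Nonempty X]
  {μ : Measure X} [IsProbabilityMeasure μ]

/-- A two-sided sequence with a given past. -/
def unback {X : Type*} (w : ℕ → X) : ℤ → X := fun k => w k.natAbs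

lemma measurable_unback : Measurable (unback (X := X)) :=
  measurable_pi_lambda _ fun _ => measurable_pi_apply _

lemma back_unback (w : ℕ → X) : back (unback w) = w := by
  funext n
  simp only [back, unback, Int.natAbs_neg, Int.natAbs_natCast]

lemma apply_unback_back {Z : Type*} [MeasurableSpace Z] [StandardBorelSpace Z] [Nonempty Z]
    {F : (ℤ → X) → Z} (hF : Measurable[pastTail X] F) (y : ℤ → X) : F (unback (back y)) = F y := by
  obtain ⟨F', -, rfl⟩ := exists_eq_comp_back hF
  simp only [Function.comp_apply, back_unback]

lemma measurable_apply_unback {Z : Type*} [MeasurableSpace Z] {F : (ℤ → X) → Z}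
    (hF : Measurable[pastTail X] F) : Measurable fun w => F (unback w) :=
  (hF.mono pastTail_le le_rfl).comp measurable_unback

lemma measurePreserving_eval (P : Polymorphism μ) (n : ℤ) :
    MeasurePreserving (fun y : ℤ → X => y n) P.markovMeasure μ := by
  have h0 : MeasurePreserving (fun y : ℤ → X => y 0) P.markovMeasure μ := by
    refine ⟨measurable_pi_apply 0, Measure.ext fun A hA => ?_⟩
    rw [Measure.map_apply (measurable_pi_apply 0) hA,
      ← lintegral_indicator_one (measurable_pi_apply 0 hA), ← lintegral_indicator_one hA]
    have hA' : Measurable (A.indicator (1 : X → ℝ≥0∞)) := measurable_one.indicator hA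
    have h := P.lintegral_fwd_mul_back (f := fun w => A.indicator 1 (w 0)) (g := fun _ => 1)
      (by fun_prop) measurable_const
    simp only [mul_one, lintegral_const, measure_univ] at h
    refine h.trans (lintegral_congr fun x => ?_)
    rw [lintegral_congr_ae (g := fun _ => A.indicator 1 x)]
    · simp
    · filter_upwards [P.ae_trajectory_zero x] with w hw
      rw [hw]
  convert! h0.comp (P.measurePreserving_shiftBy n) using 1
  funext y
  simp [shiftBy]

/-- Conditionally on the past, the state at time `n` is distributed according to the `n`-step
transition probabilities. -/
lemma lintegral_eval_mul_back (P : Polymorphism μ) (n : ℕ) {f : X → ℝ≥0∞} {g : (ℕ → X) → ℝ≥0∞}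
    (hf : Measurable f) (hg : Measurable g) : ∫⁻ y, f (y n) * g (back y) ∂P.markovMeasure =
      ∫⁻ y, (∫⁻ z, f z ∂(P ^ n).value (y 0)) * g (back y) ∂P.markovMeasure := by
  have h1 := P.lintegral_fwd_mul_back (f := fun w => f (w n)) (by fun_prop) hg
  have hf' : Measurable fun x => ∫⁻ z, f z ∂(P ^ n).value x := hf.lintegral_kernel
  have h2 := P.lintegral_fwd_mul_back (f := fun w => ∫⁻ z, f z ∂(P ^ n).value (w 0))
    (hf'.comp (measurable_pi_apply 0)) hg
  refine h1.trans (Eq.trans (lintegral_congr_ae ?_) h2.symm)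
  filter_upwards [P.trajectory_map_eval n] with x hx
  refine congrArg (· * _) ?_
  rw [lintegral_congr_ae (f := fun w : ℕ → X => ∫⁻ z, f z ∂(P ^ n).value (w 0))
    (g := fun _ => ∫⁻ z, f z ∂(P ^ n).value x)]
  · rw [lintegral_const, measure_univ, mul_one, ← hx, Kernel.map_apply _ (by fun_prop),
      lintegral_map hf (by fun_prop)]
  · filter_upwards [P.ae_trajectory_zero x] with w hw
    rw [hw]

/-- The joint distribution of the states at times `0` and `n`. -/
lemma markovMeasure_map_pair (P : Polymorphism μ) (n : ℕ) :
    P.markovMeasure.map (fun y => (y 0, y n)) = (P ^ n).bistochastic := by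
  have hm : Measurable fun y : ℤ → X => (y 0, y n) := by fun_prop
  have := Measure.isProbabilityMeasure_map (μ := P.markovMeasure) hm.aemeasurable
  refine Measure.ext_prod_iff.2 fun {A B} hA hB => ?_
  have hA' : Measurable (A.indicator (1 : X → ℝ≥0∞)) := measurable_one.indicator hA
  have hB' : Measurable (B.indicator (1 : X → ℝ≥0∞)) := measurable_one.indicator hB
  have h1 : ∀ x z : X, (A ×ˢ B).indicator (1 : X × X → ℝ≥0∞) (x, z) =
      B.indicator 1 z * A.indicator 1 x := fun x z => by
    by_cases h : x ∈ A <;> by_cases h' : z ∈ B <;> simp [h, h', Set.indicator]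
  rw [Measure.map_apply hm (hA.prod hB), ← lintegral_indicator_one (hm (hA.prod hB)),
    ← lintegral_indicator_one (hA.prod hB), lintegral_bistochastic _
      (measurable_one.indicator (hA.prod hB))]
  simp_rw [h1, lintegral_mul_const _ hB']
  have h2 := P.lintegral_eval_mul_back n (g := fun w => A.indicator 1 (w 0)) hB' (by fun_prop)
  have h3 := (P.measurePreserving_eval 0).lintegral_comp
    (f := fun x => (∫⁻ z, B.indicator 1 z ∂(P ^ n).value x) * A.indicator 1 x)
    (hB'.lintegral_kernel.mul hA')
  rw [← h3]
  refine Eq.trans (lintegral_congr fun y => ?_) h2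
  exact h1 (y 0) (y n)

/-- The conditional expectation of a function of the past given the state at time `0`. -/
def pastMean (P : Polymorphism μ) (F : (ℤ → X) → ℝ) (x : X) : ℝ :=
  ∫ w, F (unback w) ∂P.conj.trajectory x

variable {F : (ℤ → X) → ℝ}

lemma measurable_pastMean (P : Polymorphism μ) (hF : Measurable[pastTail X] F) :
    Measurable (P.pastMean F) :=
  ((measurable_apply_unback hF).stronglyMeasurable.integral_kernel).measurable

lemma pastMean_mem_Icc (P : Polymorphism μ)
    (hF01 : ∀ y, F y ∈ Set.Icc (0 : ℝ) 1) (x : X) : P.pastMean F x ∈ Set.Icc (0 : ℝ) 1 := by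
  refine ⟨integral_nonneg fun w => (hF01 _).1, ?_⟩
  refine (integral_mono_of_nonneg (ae_of_all _ fun w => (hF01 _).1) (integrable_const 1)
    (ae_of_all _ fun w => (hF01 _).2)).trans ?_
  simp

lemma ofReal_pastMean (P : Polymorphism μ) (hF : Measurable[pastTail X] F)
    (hF01 : ∀ y, F y ∈ Set.Icc (0 : ℝ) 1) (x : X) :
    ENNReal.ofReal (P.pastMean F x) =
      ∫⁻ w, ENNReal.ofReal (F (unback w)) ∂P.conj.trajectory x := by
  refine ofReal_integral_eq_lintegral_ofReal ?_ (ae_of_all _ fun w => (hF01 _).1)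
  refine Integrable.of_bound (measurable_apply_unback hF).aestronglyMeasurable 1
    (ae_of_all _ fun w => ?_)
  rw [Real.norm_eq_abs, abs_of_nonneg (hF01 _).1]
  exact (hF01 _).2

/-- By conditional independence, adding the future to the present does not change the conditional
expectation of a function of the past. -/
lemma lintegral_fwd_mul_pastMean (P : Polymorphism μ) (hF : Measurable[pastTail X] F)
    (hF01 : ∀ y, F y ∈ Set.Icc (0 : ℝ) 1) {f : (ℕ → X) → ℝ≥0∞} (hf : Measurable f) :
    ∫⁻ y, f (fwd y) * ENNReal.ofReal (P.pastMean F (y 0)) ∂P.markovMeasure =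
      ∫⁻ y, f (fwd y) * ENNReal.ofReal (F y) ∂P.markovMeasure := by
  have hp := P.measurable_pastMean hF
  have h1 := P.lintegral_fwd_mul_back hf
    (g := fun w => ENNReal.ofReal (F (unback w))) (measurable_apply_unback hF).ennreal_ofReal
  have h2 := P.lintegral_fwd_mul_back hf
    (g := fun w => ENNReal.ofReal (P.pastMean F (w 0))) (by fun_prop)
  simp_rw [apply_unback_back hF] at h1
  rw [h1]
  refine h2.trans (lintegral_congr fun x => ?_)
  refine congrArg (_ * ·) ?_
  rw [← ofReal_pastMean P hF hF01 x]
  refine (lintegral_congr_ae (g := fun _ => ENNReal.ofReal (P.pastMean F x)) ?_).trans (by simp)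
  filter_upwards [P.conj.ae_trajectory_zero x] with w hw
  rw [hw]

/-- The `σ`-fields generated by the coordinates at the times `k ≥ -n`. -/
def futureFiltration (X : Type*) [MeasurableSpace X] :
    Filtration ℕ (inferInstance : MeasurableSpace (ℤ → X)) where
  seq n := MeasurableSpace.comap (fun y => fwd (shiftBy (-n) y)) inferInstance
  mono' m n hmn := by
    obtain ⟨k, rfl⟩ := Nat.exists_eq_add_of_le hmn
    rw [← measurable_iff_comap_le]
    have h : (fun y : ℤ → X => fwd (shiftBy (-m) y)) =
        (fun w i => w (i + k)) ∘ fun y => fwd (shiftBy (-(m + k : ℕ)) y) := by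
      funext y i
      simp only [Function.comp_apply, fwd, shiftBy]
      congr 1
      push_cast
      ring
    rw [h]
    exact (measurable_pi_lambda _ fun i => measurable_pi_apply (i + k)).comp (comap_measurable _)
  le' n := (measurable_fwd.comp (measurable_shiftBy _)).comap_le

lemma iSup_futureFiltration :
    ⨆ n, futureFiltration X n = (inferInstance : MeasurableSpace (ℤ → X)) := by
  refine le_antisymm (iSup_le fun n => (futureFiltration X).le n) (iSup_le fun k => ?_)
  refine le_trans ?_ (le_iSup _ k.natAbs)
  rw [← measurable_iff_comap_le]
  have h : (fun y : ℤ → X => y k) =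
      (fun w : ℕ → X => w (k + k.natAbs).toNat) ∘ fun y => fwd (shiftBy (-k.natAbs) y) := by
    funext y
    simp only [Function.comp_apply, fwd, shiftBy]
    congr 1
    omega
  rw [h]
  exact (measurable_pi_apply _).comp (comap_measurable _)

/-- The Markov property at time `-n`. A tail function is still a function of the past of that time,
so shifting the origin reduces to `lintegral_fwd_mul_pastMean`. -/
lemma condExp_futureFiltration (P : Polymorphism μ) (hF : Measurable[pastTail X] F)
    (hF01 : ∀ y, F y ∈ Set.Icc (0 : ℝ) 1) (n : ℕ) :
    (fun y => P.pastMean (F ∘ shiftBy n) (y (-n))) =ᵐ[P.markovMeasure]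
      P.markovMeasure[F | futureFiltration X n] := by
  have hFn : Measurable[pastTail X] (F ∘ shiftBy n) := hF.comp (measurable_shiftBy_pastTail n)
  have hFn01 : ∀ y, (F ∘ shiftBy n) y ∈ Set.Icc (0 : ℝ) 1 := fun y => hF01 _
  have hF' : Measurable F := hF.mono pastTail_le le_rfl
  have hp := P.measurable_pastMean hFn
  have hp01 := P.pastMean_mem_Icc hFn01
  have hint : ∀ {f : (ℤ → X) → ℝ}, Measurable f → (∀ y, f y ∈ Set.Icc (0 : ℝ) 1) →
      Integrable f P.markovMeasure := fun {f} hf h => by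
    refine Integrable.of_bound hf.aestronglyMeasurable 1 (ae_of_all _ fun w => ?_)
    rw [Real.norm_eq_abs, abs_of_nonneg (h _).1]
    exact (h _).2
  have hpm : Measurable fun y : ℤ → X => P.pastMean (F ∘ shiftBy n) (y (-n)) := by fun_prop
  refine ae_eq_condExp_of_forall_setIntegral_eq ((futureFiltration X).le n) (hint hF' hF01)
    (fun s hs _ => (hint hpm fun y => hp01 _).integrableOn) (fun s hs _ => ?_) ?_
  · obtain ⟨C, hC, rfl⟩ := hs
    have hC' : Measurable (C.indicator (1 : (ℕ → X) → ℝ≥0∞)) := measurable_one.indicator hC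
    have hms : MeasurableSet ((fun y : ℤ → X => fwd (shiftBy (-n) y)) ⁻¹' C) :=
      (measurable_fwd.comp (measurable_shiftBy _)) hC
    rw [integral_eq_lintegral_of_nonneg_ae (ae_of_all _ fun y => (hp01 _).1)
      hpm.aestronglyMeasurable, integral_eq_lintegral_of_nonneg_ae (ae_of_all _ fun y => (hF01 _).1)
      hF'.aestronglyMeasurable]
    congr 1
    have h1 : ∀ f : (ℤ → X) → ℝ≥0∞,
        ∫⁻ y in (fun y : ℤ → X => fwd (shiftBy (-n) y)) ⁻¹' C, f y ∂P.markovMeasure =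
          ∫⁻ y, C.indicator 1 (fwd (shiftBy (-n) y)) * f y ∂P.markovMeasure := fun f => by
      rw [← lintegral_indicator hms]
      refine lintegral_congr fun y => ?_
      by_cases h : fwd (shiftBy (-n) y) ∈ C <;> simp [h, Set.indicator]
    rw [h1, h1]
    have hfw := measurable_fwd (X := X)
    have h2 := (P.measurePreserving_shiftBy (-n)).lintegral_comp (f := fun y =>
      C.indicator 1 (fwd y) * ENNReal.ofReal (P.pastMean (F ∘ shiftBy n) (y 0)))
      ((hC'.comp hfw).mul (hp.comp (measurable_pi_apply 0)).ennreal_ofReal)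
    have hFn' := hFn.mono pastTail_le le_rfl
    have h3 := (P.measurePreserving_shiftBy (-n)).lintegral_comp (f := fun y =>
      C.indicator 1 (fwd y) * ENNReal.ofReal ((F ∘ shiftBy n) y)) ((hC'.comp hfw).mul hFn'.ennreal_ofReal)
    rw [lintegral_fwd_mul_pastMean P hFn hFn01 hC', ← h3] at h2
    simp only [Function.comp_apply, shiftBy_shiftBy, add_neg_cancel, shiftBy_zero] at h2
    convert h2 using 5 with y
    simp only [shiftBy, zero_add]
  · refine Measurable.aestronglyMeasurable ?_
    have h : (fun y : ℤ → X => P.pastMean (F ∘ shiftBy n) (y (-n))) =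
        (fun w : ℕ → X => P.pastMean (F ∘ shiftBy n) (w 0)) ∘ fun y => fwd (shiftBy (-n) y) := by
      funext y
      simp [fwd, shiftBy]
    rw [h]
    exact Measurable.comp (by fun_prop) (comap_measurable _)

/-- A tail function, shifted far into the past, is almost determined by the state at time `0`. -/
lemma tendsto_lintegral_edist_pastMean (P : Polymorphism μ) (hF : Measurable[pastTail X] F)
    (hF01 : ∀ y, F y ∈ Set.Icc (0 : ℝ) 1) :
    Tendsto (fun n : ℕ => ∫⁻ y, edist (P.pastMean (F ∘ shiftBy n) (y 0)) (F (shiftBy n y))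
      ∂P.markovMeasure) atTop (𝓝 0) := by
  have hF' : Measurable F := hF.mono pastTail_le le_rfl
  have hint : Integrable F P.markovMeasure := by
    refine Integrable.of_bound hF'.aestronglyMeasurable 1 (ae_of_all _ fun w => ?_)
    rw [Real.norm_eq_abs, abs_of_nonneg (hF01 _).1]
    exact (hF01 _).2
  -- Lévy's upward theorem; stationarity then moves the time `-n` to the origin.
  have h := hint.tendsto_eLpNorm_condExp (ℱ := futureFiltration X)
    (by rw [iSup_futureFiltration]; exact hF'.stronglyMeasurable)
  refine h.congr fun n => ?_
  have hp := P.measurable_pastMean (hF.comp (measurable_shiftBy_pastTail n))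
  have hs := measurable_shiftBy (X := X) n
  rw [eLpNorm_one_eq_lintegral_enorm, ← (P.measurePreserving_shiftBy (-n)).lintegral_comp
    (f := fun y => edist (P.pastMean (F ∘ shiftBy n) (y 0)) (F (shiftBy n y))) (by fun_prop)]
  refine lintegral_congr_ae ?_
  filter_upwards [P.condExp_futureFiltration hF hF01 n] with y hy
  rw [Pi.sub_apply, ← hy, shiftBy_shiftBy, add_neg_cancel, shiftBy_zero, edist_eq_enorm_sub]
  simp only [shiftBy, zero_add]

end PastMean

end Polymorphism

/-! ### Primality and tail events seen from the present. -/

namespace Polymorphism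

section Prime

variable {X : Type*} [MeasurableSpace X] [StandardBorelSpace X] [Nonempty X]
  {μ : Measure X} [IsProbabilityMeasure μ]

lemma measurable_indicator_pastTail {E : Set (ℤ → X)} (hE : MeasurableSet[pastTail X] E) :
    Measurable[pastTail X] (E.indicator (1 : (ℤ → X) → ℝ≥0∞)) :=
  Measurable.indicator (m := pastTail X) (f := fun _ => 1)
    (@measurable_const _ _ _ (pastTail X) 1) hE

lemma ae_of_ae_eval (P : Polymorphism μ) (n : ℤ) {p : X → Prop} (hp : MeasurableSet {x | p x})
    (h : ∀ᵐ y ∂P.markovMeasure, p (y n)) : ∀ᵐ x ∂μ, p x := by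
  have h1 := (ae_map_iff (measurable_pi_apply n).aemeasurable hp).2 h
  rwa [(P.measurePreserving_eval n).map_eq] at h1

/-- If a tail event is a function of the state at time `0`, then the shifted event is also a
function of this state, which determines whether the next state lies in the given set. -/
lemma exists_successor_of_tail (P : Polymorphism μ) {A : Set X} (hA : MeasurableSet A)
    {F : Set (ℤ → X)} (hF : MeasurableSet[pastTail X] F)
    (h : ∀ᵐ y ∂P.markovMeasure, y 0 ∈ A ↔ y ∈ F) :
    ∃ A' : Set X, MeasurableSet A' ∧ (∀ᵐ y ∂P.markovMeasure, y 0 ∈ A' ↔ y ∈ leftShift ⁻¹' F) ∧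
      ∀ᵐ x ∂μ, ∀ᵐ z ∂P.value x, z ∈ A ↔ x ∈ A' := by
  have hmA := P.value.measurable_coe hA
  have hF' : MeasurableSet[pastTail X] (leftShift ⁻¹' F) := measurable_shiftBy_pastTail 1 hF
  have h1 : ∀ᵐ y ∂P.markovMeasure, y 1 ∈ A ↔ y ∈ leftShift ⁻¹' F := by
    filter_upwards [P.measurePreserving_leftShift.quasiMeasurePreserving.ae h] with y hy using hy
  -- Given the past, `y 1` is distributed according to `P.value (y 0)`; a tail event that excludes
  -- `B` at time 1 therefore forces transition probability 0. Applied to `A` and its complement,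
  -- this gives a 0-1 law for `P.value (y 0) A`.
  have h2 : ∀ {B : Set X} {E : Set (ℤ → X)}, MeasurableSet B → MeasurableSet[pastTail X] E →
      (∀ᵐ y ∂P.markovMeasure, ¬ (y 1 ∈ B ∧ y ∈ E)) →
      ∀ᵐ y ∂P.markovMeasure, y ∈ E → P.value (y 0) B = 0 := by
    intro B E hB hE hBE
    have hg : Measurable fun w => E.indicator (1 : (ℤ → X) → ℝ≥0∞) (unback w) :=
      measurable_apply_unback (measurable_indicator_pastTail hE)
    have hB' : Measurable (B.indicator (1 : X → ℝ≥0∞)) := measurable_one.indicator hB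
    have h3 := P.lintegral_eval_mul_back 1 hB' hg
    have h4 : ∀ y, E.indicator (1 : (ℤ → X) → ℝ≥0∞) (unback (back y)) = E.indicator 1 y := fun y =>
      apply_unback_back (measurable_indicator_pastTail hE) y
    simp_rw [h4, pow_one, lintegral_indicator_one hB] at h3
    rw [lintegral_congr_ae (g := fun _ => 0), lintegral_zero, eq_comm, lintegral_eq_zero_iff] at h3
    · filter_upwards [h3] with y hy hyE
      simpa [hyE] using hy
    · exact ((P.value.measurable_coe hB).comp (measurable_pi_apply 0)).mul
        (measurable_one.indicator (pastTail_le _ hE))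
    · filter_upwards [hBE] with y hy
      by_cases h5 : y 1 ∈ B
      · have h6 : y ∉ E := fun h6 => hy ⟨h5, h6⟩
        simp [h6]
      · simp [h5]
  have h5 := h2 hA.compl hF' (h1.mono fun y hy hy' => hy'.1 (hy.2 hy'.2))
  have h6 := h2 hA hF'.compl (h1.mono fun y hy hy' => hy'.2 (hy.1 hy'.1))
  have h7 : ∀ x, P.value x Aᶜ = 0 ↔ P.value x A = 1 := fun x => by
    rw [prob_compl_eq_zero_iff hA]
  refine ⟨{x | P.value x A = 1}, hmA (measurableSet_singleton 1), ?_, ?_⟩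
  · filter_upwards [h5, h6] with y hy hy'
    refine ⟨fun hyA => ?_, fun hyF => (h7 _).1 (hy hyF)⟩
    by_contra hyF
    have h8 : P.value (y 0) A = 1 := hyA
    rw [hy' hyF] at h8
    exact zero_ne_one h8
  · have h8 : ∀ᵐ x ∂μ, P.value x A = 1 ∨ P.value x A = 0 := by
      refine P.ae_of_ae_eval 0
        ((hmA (measurableSet_singleton 1)).union (hmA (measurableSet_singleton 0))) ?_
      filter_upwards [h5, h6] with y hy hy'
      by_cases hyF : y ∈ leftShift ⁻¹' F
      · exact Or.inl ((h7 _).1 (hy hyF))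
      · exact Or.inr (hy' hyF)
    filter_upwards [h8] with x hx
    obtain hx | hx := hx
    · filter_upwards [(h7 x).2 hx] with z hz
      exact ⟨fun _ => hx, fun _ => by simpa using hz⟩
    · filter_upwards [measure_eq_zero_iff_ae_notMem.1 hx] with z hz
      refine ⟨fun hz' => absurd hz' hz, fun hx' => ?_⟩
      have hx'' : P.value x A = 1 := hx'
      rw [hx] at hx''
      exact absurd hx'' zero_ne_one

/-- For a prime polymorphism, a tail event that is a function of the state at time `0` is
trivial. -/
lemma IsPrime.measure_eq_zero_or_of_tail {P : Polymorphism μ} (hP : P.IsPrime) {A : Set X}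
    (hA : MeasurableSet A) {F : Set (ℤ → X)} (hF : MeasurableSet[pastTail X] F)
    (h : ∀ᵐ y ∂P.markovMeasure, y 0 ∈ A ↔ y ∈ F) : μ A = 0 ∨ μ Aᶜ = 0 := by
  classical
  let E := {A : Set X // MeasurableSet A ∧ ∃ F : Set (ℤ → X), MeasurableSet[pastTail X] F ∧
    ∀ᵐ y ∂P.markovMeasure, y 0 ∈ A ↔ y ∈ F}
  have hnext : ∀ A : E, ∃ A' : E, ∀ᵐ x ∂μ, ∀ᵐ z ∂P.value x, z ∈ A.1 ↔ x ∈ A'.1 := by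
    rintro ⟨A, hA, F, hF, h⟩
    obtain ⟨A', hA', h1, h2⟩ := P.exists_successor_of_tail hA hF h
    exact ⟨⟨A', hA', _, measurable_shiftBy_pastTail 1 hF, h1⟩, h2⟩
  choose nxt hnxt using hnext
  -- Iterated predecessors of `A`: after one step of the chain, membership in the `n`-th set repeats
  -- the earlier membership in the next one.
  let a : ℕ → E := fun n => nxt^[n] ⟨A, hA, F, hF, h⟩
  have ha : ∀ n, ∀ᵐ x ∂μ, ∀ᵐ z ∂P.value x, z ∈ (a n).1 ↔ x ∈ (a (n + 1)).1 := fun n => by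
    simp only [a, Function.iterate_succ_apply']
    exact hnxt _
  obtain ⟨e, he, -⟩ := exists_measurableEmbedding_Icc (ℕ → Bool)
  let s : X → ℕ → Bool := fun x n => decide (x ∈ (a n).1)
  have hs : Measurable s := measurable_pi_lambda _ fun n =>
    measurable_to_bool (by
      convert (a n).2.1 using 1
      ext x
      simp [s])
  have hsh : Measurable fun (w : ℕ → Bool) n => w (n + 1) := by fun_prop
  -- The endomorphism of the factor is the shift of codes, extended measurably from the range of `e`
  -- to the line.
  obtain ⟨g, hg, hge⟩ := he.exists_measurable_extend (he.measurable.comp hsh) fun _ => ⟨0⟩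
  obtain ⟨c, hc⟩ := hP (fun x => e (s x)) g (he.measurable.comp hs) hg (by
    filter_upwards [ae_all_iff.2 ha] with x hx
    filter_upwards [ae_all_iff.2 hx] with z hz
    rw [show g (e (s x)) = _ from congrFun hge (s x)]
    refine congrArg e (funext fun n => ?_)
    simp only [s, hz n])
  obtain ⟨x₀, hx₀⟩ := hc.exists
  have h1 : ∀ᵐ x ∂μ, x ∈ A ↔ x₀ ∈ A := by
    filter_upwards [hc] with x hx
    have h2 := congrFun (he.injective (hx.trans hx₀.symm)) 0
    exact decide_eq_decide.1 h2
  by_cases hxA : x₀ ∈ A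
  · right
    filter_upwards [h1] with x hx
    simpa using hx.2 hxA
  · left
    exact measure_eq_zero_iff_ae_notMem.2 (h1.mono fun x hx hx' => hxA (hx.1 hx'))

end Prime

end Polymorphism

/-! ### A trivial past implies mixing. -/

namespace Polymorphism

section Mixing

variable {X : Type*} [MeasurableSpace X] [StandardBorelSpace X] [Nonempty X]
  {μ : Measure X} [IsProbabilityMeasure μ]

lemma integral_eval (P : Polymorphism μ) (n : ℤ) {f : X → ℝ} (hf : Measurable f) :
    ∫ y, f (y n) ∂P.markovMeasure = ∫ x, f x ∂μ := by
  rw [← integral_map (φ := fun y : ℤ → X => y n) (f := f)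
    (measurable_pi_apply n).aemeasurable hf.aestronglyMeasurable,
    (P.measurePreserving_eval n).map_eq]

/-- The probability that the chain is in `B` after `n` steps. -/
def stepProb (P : Polymorphism μ) (B : Set X) (n : ℕ) (x : X) : ℝ := ((P ^ n).value x).real B

variable {B : Set X}

lemma measurable_stepProb (P : Polymorphism μ) (hB : MeasurableSet B) (n : ℕ) :
    Measurable (P.stepProb B n) :=
  ((P ^ n).value.measurable_coe hB).ennreal_toReal

lemma abs_stepProb_le (P : Polymorphism μ) (n : ℕ) (x : X) : |P.stepProb B n x| ≤ 1 := by
  rw [stepProb, abs_of_nonneg measureReal_nonneg]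
  exact measureReal_le_one

lemma integral_stepProb (P : Polymorphism μ) (hB : MeasurableSet B) (n : ℕ) :
    ∫ x, P.stepProb B n x ∂μ = μ.real B := by
  change ∫ x, ((P ^ n).value x B).toReal ∂μ = _
  rw [integral_toReal ((P ^ n).value.measurable_coe hB).aemeasurable
    (ae_of_all _ fun x => measure_lt_top _ _)]
  congr 1
  conv_rhs => rw [← (P ^ n).value_comp]
  rw [Measure.bind_apply hB (Kernel.aemeasurable _)]

/-- `P.stepProb B n (y (-n))` is the reverse martingale of conditional probabilities of `y 0 ∈ B`:
averaging it given the state at time `-(n + k)` yields the later term, by Chapman–Kolmogorov. -/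
lemma integral_stepProb_mul (P : Polymorphism μ) (hB : MeasurableSet B) (n k : ℕ) :
    ∫ y, P.stepProb B n (y (-n)) * P.stepProb B (n + k) (y (-(n + k : ℕ))) ∂P.markovMeasure =
      ∫ x, P.stepProb B (n + k) x ^ 2 ∂μ := by
  have hn := (P ^ n).value.measurable_coe hB
  have hk := (P ^ (n + k)).value.measurable_coe hB
  have h1 : ∀ x, P.stepProb B (n + k) x ^ 2 =
      ((P ^ (n + k)).value x B * (P ^ (n + k)).value x B).toReal := fun x => by
    rw [ENNReal.toReal_mul, sq]; rfl
  have h2 : ∀ y : ℤ → X, P.stepProb B n (y (-n)) * P.stepProb B (n + k) (y (-(n + k : ℕ))) =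
      ((P ^ n).value (y (-n)) B * (P ^ (n + k)).value (y (-(n + k : ℕ))) B).toReal := fun y => by
    rw [ENNReal.toReal_mul]; rfl
  simp_rw [h1, h2]
  rw [integral_toReal (by fun_prop) (ae_of_all _ fun x => ENNReal.mul_lt_top (measure_lt_top _ _)
    (measure_lt_top _ _)), integral_toReal (by fun_prop) (ae_of_all _ fun x => ENNReal.mul_lt_top
    (measure_lt_top _ _) (measure_lt_top _ _))]
  congr 1
  have h3 := (P.measurePreserving_shiftBy (-(n + k : ℕ))).lintegral_comp
    (f := fun y => (P ^ n).value (y k) B * (P ^ (n + k)).value (y 0) B) (by fun_prop)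
  have h4 : ∀ y : ℤ → X, (P ^ n).value (y (-n)) B * (P ^ (n + k)).value (y (-(n + k : ℕ))) B =
      (P ^ n).value (shiftBy (-(n + k : ℕ)) y k) B *
        (P ^ (n + k)).value (shiftBy (-(n + k : ℕ)) y 0) B := fun y => by
    simp only [shiftBy, zero_add]
    congr 3
    push_cast
    ring_nf
  simp_rw [h4]
  rw [h3, ← lintegral_map (f := fun p : X × X => (P ^ n).value p.2 B * (P ^ (n + k)).value p.1 B)
    (g := fun y : ℤ → X => (y 0, y k)) (by fun_prop) (by fun_prop), markovMeasure_map_pair,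
    lintegral_bistochastic _ (by fun_prop)]
  refine lintegral_congr_ae ?_
  filter_upwards [value_mul (P ^ n) (P ^ k)] with x hx
  rw [lintegral_mul_const _ hn, pow_add, hx, Kernel.comp_apply' _ _ _ hB]

/-- Pythagoras for this martingale. It gives at once the monotonicity of the second moments and the
Cauchy property. -/
lemma integral_sq_stepProb_sub (P : Polymorphism μ) (hB : MeasurableSet B) (n k : ℕ) :
    ∫ y, (P.stepProb B n (y (-n)) - P.stepProb B (n + k) (y (-(n + k : ℕ)))) ^ 2 ∂P.markovMeasure =
      ∫ x, P.stepProb B n x ^ 2 ∂μ - ∫ x, P.stepProb B (n + k) x ^ 2 ∂μ := by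
  have hm := P.measurable_stepProb hB
  have hint : ∀ i j : ℕ, Integrable (fun y : ℤ → X => P.stepProb B i (y (-i)) *
      P.stepProb B j (y (-j))) P.markovMeasure := fun i j => by
    have := hm i
    have := hm j
    refine Integrable.of_bound (by fun_prop) 1 (ae_of_all _ fun y => ?_)
    rw [Real.norm_eq_abs, abs_mul]
    exact mul_le_one₀ (P.abs_stepProb_le _ _) (abs_nonneg _) (P.abs_stepProb_le _ _)
  have h1 : ∀ y : ℤ → X, (P.stepProb B n (y (-n)) - P.stepProb B (n + k) (y (-(n + k : ℕ)))) ^ 2 =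
      P.stepProb B n (y (-n)) * P.stepProb B n (y (-n)) -
        2 * (P.stepProb B n (y (-n)) * P.stepProb B (n + k) (y (-(n + k : ℕ)))) +
        P.stepProb B (n + k) (y (-(n + k : ℕ))) * P.stepProb B (n + k) (y (-(n + k : ℕ))) :=
    fun y => by ring
  have hint' : Integrable (fun y : ℤ → X => P.stepProb B n (y (-n)) * P.stepProb B n (y (-n)) -
      2 * (P.stepProb B n (y (-n)) * P.stepProb B (n + k) (y (-(n + k : ℕ))))) P.markovMeasure :=
    (hint n n).sub ((hint n (n + k)).const_mul 2)
  simp_rw [h1]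
  rw [integral_add hint' (hint _ _),
    integral_sub (hint n n) ((hint n (n + k)).const_mul 2), integral_const_mul,
    integral_stepProb_mul P hB, P.integral_eval (-n) (f := fun x => P.stepProb B n x *
      P.stepProb B n x) ((hm n).mul (hm n)), P.integral_eval (-(n + k : ℕ))
      (f := fun x => P.stepProb B (n + k) x * P.stepProb B (n + k) x) ((hm _).mul (hm _))]
  simp_rw [sq]
  ring

/-- The transition probabilities, evaluated along a path, converge along a subsequence. -/
lemma exists_subseq_ae_tendsto_stepProb (P : Polymorphism μ) (hB : MeasurableSet B) :
    ∃ φ : ℕ → ℕ, StrictMono φ ∧ ∀ᵐ y ∂P.markovMeasure,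
      ∃ l, Tendsto (fun i => P.stepProb B (φ i) (y (-(φ i : ℤ)))) atTop (𝓝 l) := by
  have hm := P.measurable_stepProb hB
  set a : ℕ → ℝ := fun n => ∫ x, P.stepProb B n x ^ 2 ∂μ with ha
  have hsub : ∀ n k, ∫ y, (P.stepProb B n (y (-n)) -
      P.stepProb B (n + k) (y (-(n + k : ℕ)))) ^ 2 ∂P.markovMeasure = a n - a (n + k) :=
    fun n k => P.integral_sq_stepProb_sub hB n k
  have hanti : Antitone a := fun n m hnm => by
    obtain ⟨k, rfl⟩ := Nat.exists_eq_add_of_le hnm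
    have h1 : 0 ≤ a n - a (n + k) := by
      rw [← hsub]
      exact integral_nonneg fun y => sq_nonneg _
    linarith
  obtain ⟨l, hl⟩ : ∃ l, Tendsto a atTop (𝓝 l) :=
    ⟨_, tendsto_atTop_ciInf hanti ⟨0, by
      rintro _ ⟨n, rfl⟩
      exact integral_nonneg fun x => sq_nonneg _⟩⟩
  have hge : ∀ n, l ≤ a n := fun n => hanti.le_of_tendsto hl n
  -- A subsequence so fast that the `L¹` distances are summable, which yields convergence almost
  -- everywhere.
  obtain ⟨φ, hφ, hφl⟩ := extraction_forall_of_eventually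
    (P := fun i n => a n < l + ((1 / 2 : ℝ) ^ i) ^ 2)
    fun i => hl.eventually_lt_const (by have : (0 : ℝ) < ((1 / 2 : ℝ) ^ i) ^ 2 := by positivity
                                        linarith)
  refine ⟨φ, hφ, ?_⟩
  have hdist : ∀ N n k : ℕ, a n < l + ((1 / 2 : ℝ) ^ N) ^ 2 →
      ∫⁻ y, ‖P.stepProb B n (y (-n)) - P.stepProb B (n + k) (y (-(n + k : ℕ)))‖ₑ
        ∂P.markovMeasure ≤ ENNReal.ofReal ((1 / 2 : ℝ) ^ N) := fun N n k hn => by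
    have hn' := hm n
    have hk' := hm (n + k)
    set D : (ℤ → X) → ℝ := fun y => P.stepProb B n (y (-n)) -
      P.stepProb B (n + k) (y (-(n + k : ℕ))) with hD
    have hDm : Measurable D := by fun_prop
    have hDb : ∀ y, |D y| ≤ 2 := fun y => by
      have h1 := P.abs_stepProb_le (B := B) n (y (-n))
      have h2 := P.abs_stepProb_le (B := B) (n + k) (y (-(n + k : ℕ)))
      exact (abs_sub _ _).trans (by linarith)
    have hDi : Integrable D P.markovMeasure :=
      Integrable.of_bound hDm.aestronglyMeasurable 2 (ae_of_all _ hDb)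
    have hDi2 : Integrable (fun y => D y ^ 2) P.markovMeasure :=
      Integrable.of_bound (by fun_prop) 4 (ae_of_all _ fun y => by
        rw [Real.norm_eq_abs, abs_pow]
        have := hDb y
        nlinarith [abs_nonneg (D y)])
    set ε : ℝ := (1 / 2 : ℝ) ^ N
    have hε : 0 < ε := by positivity
    have h1 : ∫ y, D y ^ 2 ∂P.markovMeasure ≤ ε ^ 2 := by
      rw [hsub]
      have := hge (n + k)
      linarith
    -- From `2ε|D| ≤ D² + ε²`, the bound `ε²` on the second moment gives `ε` for the first.
    have h2 : ∫ y, 2 * ε * |D y| ∂P.markovMeasure ≤ ∫ y, (D y ^ 2 + ε ^ 2) ∂P.markovMeasure := by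
      refine integral_mono (hDi.abs.const_mul _) (hDi2.add (integrable_const _)) fun y => ?_
      have h3 := sq_nonneg (|D y| - ε)
      have h4 := sq_abs (D y)
      simp only
      nlinarith
    rw [integral_const_mul, integral_add hDi2 (integrable_const _)] at h2
    simp only [integral_const, probReal_univ, one_smul] at h2
    have h3 : ∫ y, |D y| ∂P.markovMeasure ≤ ε := by nlinarith
    rw [← ofReal_integral_norm_eq_lintegral_enorm hDi]
    exact ENNReal.ofReal_le_ofReal h3
  refine Lp.ae_tendsto_of_cauchy_eLpNorm (p := 1) (B := fun N => 2 * ENNReal.ofReal ((1 / 2 : ℝ) ^ N))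
    (f := fun i (y : ℤ → X) => P.stepProb B (φ i) (y (-(φ i : ℤ))))
    (fun i => ((hm _).comp (measurable_pi_apply _)).aestronglyMeasurable) le_rfl ?_ ?_
  · rw [ENNReal.tsum_mul_left]
    refine ENNReal.mul_ne_top (by simp) ?_
    rw [← ENNReal.ofReal_tsum_of_nonneg (fun n => by positivity) summable_geometric_two]
    exact ENNReal.ofReal_ne_top
  · have h1 : ∀ N n m : ℕ, N ≤ n → n ≤ m → eLpNorm ((fun y : ℤ → X => P.stepProb B (φ n)
        (y (-(φ n : ℤ)))) - fun y => P.stepProb B (φ m) (y (-(φ m : ℤ)))) 1 P.markovMeasure <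
        2 * ENNReal.ofReal ((1 / 2 : ℝ) ^ N) := fun N n m hN hnm => by
      obtain ⟨k, hk⟩ := Nat.exists_eq_add_of_le (hφ.monotone hnm)
      rw [eLpNorm_one_eq_lintegral_enorm]
      simp only [Pi.sub_apply, hk]
      refine (hdist N _ _ ((hanti (hφ.monotone hN)).trans_lt (hφl N))).trans_lt ?_
      rw [two_mul]
      exact ENNReal.lt_add_right ENNReal.ofReal_ne_top (by simp)
    intro N n m hn hm
    obtain h | h := le_total n m
    · exact h1 N n m hn h
    · rw [eLpNorm_sub_comm]
      exact h1 N m n hm h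

/-- The superior limit of functions that depend on more and more remote coordinates is a tail
function. -/
lemma measurable_limsup_pastTail {φ : ℕ → ℕ} (hφ : StrictMono φ) {f : ℕ → X → ℝ}
    (hf : ∀ i, Measurable (f i)) :
    Measurable[pastTail X] fun y : ℤ → X => limsup (fun i => f i (y (-(φ i : ℤ)))) atTop := by
  intro s hs
  refine MeasurableSpace.measurableSet_iInf.2 fun N => ?_
  -- The first `N` terms can be dropped, and those left only use times at most `-N`, since `φ i ≥
  -- i`.
  have h : (fun y : ℤ → X => limsup (fun i => f i (y (-(φ i : ℤ)))) atTop) =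
      fun y => limsup (fun i => f (i + N) (y (-(φ (i + N) : ℤ)))) atTop := by
    funext y
    exact (limsup_nat_add (fun i => f i (y (-(φ i : ℤ)))) N).symm
  rw [h]
  refine Measurable.limsup (fun i => (hf _).comp ?_) hs
  have hk : -(φ (i + N) : ℤ) ≤ -(N : ℤ) := by
    have := hφ.le_apply (x := i + N)
    omega
  exact (comap_measurable _).mono (le_iSup (fun k : {k : ℤ // k ≤ -(N : ℤ)} =>
    MeasurableSpace.comap (fun y : ℤ → X => y k) inferInstance) ⟨_, hk⟩) le_rfl

/-- A polymorphism whose Markov process has a trivial past is mixing. -/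
lemma isMixing_of_tail_trivial (P : Polymorphism μ)
    (h : ∀ F : Set (ℤ → X), MeasurableSet[pastTail X] F →
      P.markovMeasure F = 0 ∨ P.markovMeasure Fᶜ = 0) : P.IsMixing := by
  intro B hB
  have hm := P.measurable_stepProb hB
  obtain ⟨φ, hφ, hlim⟩ := P.exists_subseq_ae_tendsto_stepProb hB
  obtain ⟨c, hc⟩ : ∃ c, (fun y : ℤ → X => limsup (fun i => P.stepProb B (φ i) (y (-(φ i : ℤ))))
      atTop) =ᵐ[P.markovMeasure] Function.const _ c := by
    refine exists_eventuallyEq_const_of_forall_separating MeasurableSet fun U hU => ?_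
    obtain h1 | h1 := h _ (measurable_limsup_pastTail hφ (fun i => hm (φ i)) hU)
    · exact Or.inr (measure_eq_zero_iff_ae_notMem.1 h1)
    · left
      filter_upwards [h1] with y hy
      simpa using hy
  have hlim' : ∀ᵐ y ∂P.markovMeasure,
      Tendsto (fun i => P.stepProb B (φ i) (y (-(φ i : ℤ)))) atTop (𝓝 c) := by
    filter_upwards [hlim, hc] with y ⟨l, hl⟩ hy
    rwa [← show l = c from hl.limsup_eq.symm.trans hy]
  -- Integration identifies the constant: every term has integral `μ.real B`.
  have h1 : Tendsto (fun i => ∫ x, P.stepProb B (φ i) x ∂μ) atTop (𝓝 c) := by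
    have h2 := tendsto_integral_of_dominated_convergence (μ := P.markovMeasure)
      (F := fun i y => P.stepProb B (φ i) (y (-(φ i : ℤ)))) (f := fun _ => c) (fun _ => 1)
      (fun i => ((hm _).comp (measurable_pi_apply _)).aestronglyMeasurable) (integrable_const _)
      (fun i => ae_of_all _ fun y => P.abs_stepProb_le _ _) hlim'
    simpa [P.integral_eval _ (hm _)] using h2
  simp_rw [P.integral_stepProb hB] at h1
  obtain rfl := tendsto_nhds_unique tendsto_const_nhds h1
  set a : ℕ → ℝ := fun n => ∫ x, (P.stepProb B n x - μ.real B) ^ 2 ∂μ with ha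
  change Tendsto a atTop (𝓝 0)
  have h3 : Tendsto (a ∘ φ) atTop (𝓝 0) := by
    have h2 := tendsto_integral_of_dominated_convergence (μ := P.markovMeasure)
      (F := fun i y => (P.stepProb B (φ i) (y (-(φ i : ℤ))) - μ.real B) ^ 2)
      (f := fun _ => (μ.real B - μ.real B) ^ 2) (fun _ => 4)
      (fun i => ((((hm _).comp (measurable_pi_apply _)).sub_const _).pow_const
        2).aestronglyMeasurable) (integrable_const _)
      (fun i => ae_of_all _ fun y => by
        have h4 := abs_le.1 (P.abs_stepProb_le (B := B) (φ i) (y (-(φ i : ℤ))))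
        have h5 : 0 ≤ μ.real B := measureReal_nonneg
        have h6 : μ.real B ≤ 1 := measureReal_le_one
        rw [Real.norm_eq_abs, abs_of_nonneg (sq_nonneg _)]
        nlinarith) (hlim'.mono fun y hy => (hy.sub_const _).pow 2)
    simp only [sub_self, ne_eq, OfNat.ofNat_ne_zero, not_false_eq_true, zero_pow, integral_zero]
      at h2
    refine h2.congr fun i => ?_
    exact P.integral_eval _ (f := fun x => (P.stepProb B (φ i) x - μ.real B) ^ 2)
      (((hm _).sub_const _).pow_const 2)
  have hexp : ∀ n, a n = ∫ x, P.stepProb B n x ^ 2 ∂μ - μ.real B ^ 2 := fun n => by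
    have hi : Integrable (P.stepProb B n) μ :=
      Integrable.of_bound (hm n).aestronglyMeasurable 1 (ae_of_all _ fun x => P.abs_stepProb_le _ _)
    have hi2 : Integrable (fun x => P.stepProb B n x ^ 2) μ :=
      Integrable.of_bound ((hm n).pow_const 2).aestronglyMeasurable 1 (ae_of_all _ fun x => by
        rw [Real.norm_eq_abs, abs_pow]
        exact pow_le_one₀ (abs_nonneg _) (P.abs_stepProb_le _ _))
    have h4 : ∀ x, (P.stepProb B n x - μ.real B) ^ 2 = P.stepProb B n x ^ 2 -
        2 * μ.real B * P.stepProb B n x + μ.real B ^ 2 := fun x => by ring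
    have hi3 : Integrable (fun x => P.stepProb B n x ^ 2 - 2 * μ.real B * P.stepProb B n x) μ :=
      hi2.sub (hi.const_mul _)
    simp only [ha, h4]
    rw [integral_add hi3 (integrable_const _),
      integral_sub hi2 (hi.const_mul _), integral_const_mul, P.integral_stepProb hB]
    simp only [integral_const, probReal_univ, one_smul]
    ring
  -- Monotonicity extends the convergence from the subsequence to all `n`.
  have hanti : Antitone a := fun n m hnm => by
    obtain ⟨k, rfl⟩ := Nat.exists_eq_add_of_le hnm
    have h4 := P.integral_sq_stepProb_sub hB n k
    have h5 : 0 ≤ ∫ y, (P.stepProb B n (y (-n)) - P.stepProb B (n + k) (y (-(n + k : ℕ)))) ^ 2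
      ∂P.markovMeasure := integral_nonneg fun y => sq_nonneg _
    rw [hexp, hexp]
    linarith
  exact (tendsto_iff_tendsto_subseq_of_antitone hanti hφ.tendsto_atTop).2 h3

end Mixing

end Polymorphism

/-! ### The tail quotient: countable generation and non-atomicity. -/

/-- A standard Borel space is generated by a countable `π`-system. -/
lemma exists_countable_isPiSystem (Y : Type*) [mY : MeasurableSpace Y] [StandardBorelSpace Y]
    [Nonempty Y] : ∃ C : ℚ → Set Y, (∀ r, MeasurableSet (C r)) ∧ IsPiSystem (Set.range C) ∧
      mY = MeasurableSpace.generateFrom (Set.range C) := by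
  obtain ⟨e, he, -⟩ := exists_measurableEmbedding_Icc Y
  refine ⟨fun r => e ⁻¹' Set.Iic (r : ℝ), fun r => he.measurable measurableSet_Iic, ?_, ?_⟩
  · rintro _ ⟨r, rfl⟩ _ ⟨s, rfl⟩ -
    refine ⟨min r s, ?_⟩
    simp only [← Set.preimage_inter, Set.Iic_inter_Iic, Rat.cast_min]
  · have h : Set.range (fun r : ℚ => e ⁻¹' Set.Iic (r : ℝ)) =
        Set.preimage e '' ⋃ a : ℚ, {Set.Iic (a : ℝ)} := by
      ext s
      simp
    rw [h, ← MeasurableSpace.comap_generateFrom, ← Real.borel_eq_generateFrom_Iic_rat,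
      ← he.comap_eq, BorelSpace.measurable_eq (α := ℝ)]

namespace Polymorphism

section TailFactor

variable {X : Type*} [MeasurableSpace X] [StandardBorelSpace X] [Nonempty X]
  {μ : Measure X} [IsProbabilityMeasure μ]

/-- The tail `σ`-field of the past is generated mod `0` by a map to a standard Borel space. -/
lemma exists_tail_map (P : Polymorphism μ) :
    ∃ h : (ℤ → X) → ℚ → ℝ≥0∞, Measurable[pastTail X] h ∧
      ∀ F, MeasurableSet[pastTail X] F → ∃ B, MeasurableSet B ∧ F =ᵐ[P.markovMeasure] h ⁻¹' B := by
  obtain ⟨C, hC, hpi, hgen⟩ := exists_countable_isPiSystem (ℤ → X)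
  let K := condExpKernel P.markovMeasure (pastTail X)
  let h : (ℤ → X) → ℚ → ℝ≥0∞ := fun y r => K y (C r)
  refine ⟨h, ?_, fun F hF => ?_⟩
  · exact @measurable_pi_lambda _ _ _ (pastTail X) _ _ fun r => measurable_condExpKernel (hC r)
  -- The conditional measure is determined by its values on the countable π-system, so it is a
  -- function of `h`. A tail event is recovered mod 0 as the set where its conditional probability
  -- is 1.
  have h1 : @Measurable _ _ (MeasurableSpace.comap h inferInstance) _ (fun y => K y) := by
    refine @Measurable.measure_of_isPiSystem_of_isProbabilityMeasure _ _
      (MeasurableSpace.comap h inferInstance) _ _ (fun y => inferInstance) _ hgen hpi ?_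
    rintro _ ⟨r, rfl⟩
    exact (measurable_pi_apply r).comp (comap_measurable h)
  have h2 : @Measurable _ _ (MeasurableSpace.comap h inferInstance) _ (fun y => K y F) :=
    (Measure.measurable_coe (pastTail_le _ hF)).comp h1
  obtain ⟨B, hB, hBF⟩ := h2 (measurableSet_singleton 1)
  refine ⟨B, hB, ?_⟩
  rw [hBF]
  have h3 := condExpKernel_ae_eq_condExp (μ := P.markovMeasure) pastTail_le (pastTail_le _ hF)
  have h4 : P.markovMeasure[F.indicator (fun _ => (1 : ℝ)) | pastTail X] =
      F.indicator fun _ => (1 : ℝ) :=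
    condExp_of_stronglyMeasurable pastTail_le
      (StronglyMeasurable.indicator (@stronglyMeasurable_const _ _ (pastTail X) _ _) hF)
      ((integrable_const 1).indicator (pastTail_le _ hF))
  rw [h4] at h3
  filter_upwards [h3] with y hy
  refine propext ?_
  change y ∈ F ↔ K y F = 1
  have h5 : (K y F).toReal = F.indicator (fun _ => (1 : ℝ)) y := hy
  by_cases hyF : y ∈ F
  · simp only [hyF, Set.indicator_of_mem, true_iff] at h5 ⊢
    exact (ENNReal.toReal_eq_one_iff _).1 h5
  · simp only [hyF, not_false_eq_true, Set.indicator_of_notMem, false_iff] at h5 ⊢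
    intro h6
    rw [h6] at h5
    simp at h5

/-- The tail `σ`-field of the past is generated mod `0` by a shift-equivariant map. -/
lemma exists_equivariant_tail_map (P : Polymorphism μ) :
    ∃ q : (ℤ → X) → ℤ → ℚ → ℝ≥0∞, Measurable[pastTail X] q ∧
      (∀ n y, q (shiftBy n y) = shiftBy n (q y)) ∧
      ∀ F, MeasurableSet[pastTail X] F → ∃ B, MeasurableSet B ∧ F =ᵐ[P.markovMeasure] q ⁻¹' B := by
  obtain ⟨h, hh, hgen⟩ := P.exists_tail_map
  -- Recording `h` along the whole orbit builds in the equivariance.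
  refine ⟨fun y n => h (shiftBy n y), ?_, fun n y => ?_, fun F hF => ?_⟩
  · exact @measurable_pi_lambda _ _ _ (pastTail X) _ _ fun n =>
      hh.comp (measurable_shiftBy_pastTail n)
  · funext k
    simp only [shiftBy_shiftBy]
    rfl
  · obtain ⟨B, hB, hFB⟩ := hgen F hF
    refine ⟨(fun z => z 0) ⁻¹' B, measurable_pi_apply 0 hB, ?_⟩
    simpa only [Set.preimage_preimage, shiftBy_zero] using hFB

lemma measurePreserving_shiftBy_map {W : Type*} [MeasurableSpace W] (P : Polymorphism μ)
    {q : (ℤ → X) → ℤ → W} (hq : Measurable q) (hqs : ∀ n y, q (shiftBy n y) = shiftBy n (q y))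
    (n : ℤ) : MeasurePreserving (shiftBy n) (P.markovMeasure.map q) (P.markovMeasure.map q) := by
  refine ⟨measurable_shiftBy n, ?_⟩
  rw [Measure.map_map (measurable_shiftBy n) hq,
    show shiftBy n ∘ q = q ∘ shiftBy n from funext fun y => (hqs n y).symm,
    ← Measure.map_map hq (measurable_shiftBy n), (P.measurePreserving_shiftBy n).map_eq]

lemma iterate_leftShift {W : Type*} [MeasurableSpace W] (n : ℕ) (z : ℤ → W) : leftShift^[n] z = shiftBy n z := by
  induction n generalizing z with
  | zero => exact (shiftBy_zero z).symm
  | succ n ih =>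
    rw [Function.iterate_succ_apply, ih, leftShift_eq_shiftBy, shiftBy_shiftBy, Nat.cast_succ]

/-- The quotient by the tail of the past is non-atomic for a prime polymorphism that is not
mixing. -/
lemma IsPrime.nullSingletonClass_map {W : Type*} [MeasurableSpace W] [StandardBorelSpace W]
    [Nonempty W] {P : Polymorphism μ} (hP : P.IsPrime) (hmix : ¬ P.IsMixing)
    {q : (ℤ → X) → ℤ → W} (hq : Measurable[pastTail X] q)
    (hqs : ∀ n y, q (shiftBy n y) = shiftBy n (q y))
    (hgen : ∀ F, MeasurableSet[pastTail X] F →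
      ∃ B, MeasurableSet B ∧ F =ᵐ[P.markovMeasure] q ⁻¹' B) :
    NullSingletonClass (P.markovMeasure.map q) := by
  have hq' : Measurable q := hq.mono pastTail_le le_rfl
  have := Measure.isProbabilityMeasure_map (μ := P.markovMeasure) hq'.aemeasurable
  refine ⟨fun z => ?_⟩
  by_contra hz
  -- By Poincaré recurrence, an atom returns to itself and hence is periodic.
  obtain ⟨z', hz', k, hk, hkz⟩ := (P.measurePreserving_shiftBy_map hq' hqs 1).exists_mem_iterate_mem
    (measurableSet_singleton z).nullMeasurableSet hz
  obtain rfl : z' = z := hz'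
  have hkz' : shiftBy k z' = z' := by
    rw [← iterate_leftShift]; exact hkz
  set F : Set (ℤ → X) := q ⁻¹' {z'} with hF
  have hFm : MeasurableSet[pastTail X] F := hq (measurableSet_singleton z')
  have hFk : ∀ y, shiftBy k y ∈ F ↔ y ∈ F := fun y => by
    simp only [hF, Set.mem_preimage, Set.mem_singleton_iff, hqs]
    refine ⟨fun h => ?_, fun h => by rw [h, hkz']⟩
    have h1 := congrArg (shiftBy (-k)) (h.trans hkz'.symm)
    simpa only [shiftBy_shiftBy, neg_add_cancel, shiftBy_zero] using h1
  have hFj : ∀ (j : ℕ) y, shiftBy (k * j : ℕ) y ∈ F ↔ y ∈ F := fun j => by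
    induction j with
    | zero => intro y; rw [mul_zero, Nat.cast_zero, shiftBy_zero]
    | succ j ih =>
      intro y
      rw [Nat.mul_succ, Nat.cast_add, ← shiftBy_shiftBy, ih, hFk]
  set f : (ℤ → X) → ℝ := F.indicator fun _ => 1 with hf
  have hfm : Measurable[pastTail X] f := Measurable.indicator (m := pastTail X)
    (@measurable_const _ _ _ (pastTail X) 1) hFm
  have hf01 : ∀ y, f y ∈ Set.Icc (0 : ℝ) 1 := fun y => by
    by_cases hy : y ∈ F <;> simp [hf, hy]
  have hfj : ∀ (j : ℕ) y, f (shiftBy (k * j : ℕ) y) = f y := fun j y => by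
    by_cases hy : y ∈ F
    · rw [hf, Set.indicator_of_mem hy, Set.indicator_of_mem ((hFj j y).2 hy)]
    · rw [hf, Set.indicator_of_notMem hy, Set.indicator_of_notMem (mt (hFj j y).1 hy)]
  have hp := P.measurable_pastMean hfm
  have hf' := hfm.mono pastTail_le le_rfl
  have hlim := (P.tendsto_lintegral_edist_pastMean hfm hf01).comp
    (tendsto_id.const_mul_atTop' (Nat.pos_of_ne_zero hk))
  -- Along multiples of the period the sequence in `hlim` is constant, so its limit 0 is its value:
  -- `F` is a function of the present.
  have hconst : ∫⁻ y, edist (P.pastMean f (y 0)) (f y) ∂P.markovMeasure = 0 := by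
    refine tendsto_nhds_unique (tendsto_const_nhds.congr fun j => ?_) hlim
    have h1 : f ∘ shiftBy (k * j : ℕ) = f := funext (hfj j)
    simp only [Function.comp_apply, id]
    rw [h1]
    simp_rw [hfj]
  rw [lintegral_eq_zero_iff (by fun_prop)] at hconst
  have hA : MeasurableSet {x | P.pastMean f x = 1} := hp (measurableSet_singleton 1)
  have hAF : ∀ᵐ y ∂P.markovMeasure, y 0 ∈ {x | P.pastMean f x = 1} ↔ y ∈ F := by
    filter_upwards [hconst] with y hy
    have h1 : P.pastMean f (y 0) = f y := edist_eq_zero.1 hy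
    change P.pastMean f (y 0) = 1 ↔ y ∈ F
    rw [h1]
    by_cases hyF : y ∈ F <;> simp [hf, hyF]
  have hF0 : P.markovMeasure F ≠ 0 := by
    rwa [Measure.map_apply hq' (measurableSet_singleton z')] at hz
  have hF1 : ∀ᵐ y ∂P.markovMeasure, y ∈ F := by
    obtain h | h := hP.measure_eq_zero_or_of_tail hA hFm hAF
    · refine absurd ?_ hF0
      rw [← measure_congr (hAF.mono fun y hy => propext hy : _ =ᵐ[P.markovMeasure] F)]
      exact (P.measurePreserving_eval 0).measure_preimage hA.nullMeasurableSet |>.trans h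
    · have h1 := (P.measurePreserving_eval 0).quasiMeasurePreserving.ae
        (show ∀ᵐ x ∂μ, x ∈ {x | P.pastMean f x = 1} from h)
      filter_upwards [h1, hAF] with y hy hy' using hy'.1 hy
  -- The single fibre `F` has full measure, so every tail event is null or conull.
  refine hmix (P.isMixing_of_tail_trivial fun E hE => ?_)
  obtain ⟨B, -, hEB⟩ := hgen E hE
  have h2 : ∀ᵐ y ∂P.markovMeasure, y ∈ E ↔ z' ∈ B := by
    filter_upwards [hEB, hF1] with y hy hyF
    have h3 : q y = z' := hyF
    rw [← h3]
    exact iff_of_eq hy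
  by_cases hzB : z' ∈ B
  · right
    filter_upwards [h2] with y hy
    simpa using hy.2 hzB
  · left
    exact measure_eq_zero_iff_ae_notMem.2 (h2.mono fun y hy hy' => hzB (hy.1 hy'))

end TailFactor

end Polymorphism

/-! ### Telescoping products and closeness in probability. -/

/-- Between consecutive factors, `s ^ k * t ^ (k + 1)` collapses to `t`. -/
lemma prod_range_conj {M : Type*} [Monoid M] {a s t : M} (hst : s * t = 1) (hts : t * s = 1)
    (n : ℕ) : ((List.range (n + 1)).map fun k => t ^ k * a * s ^ k).prod =
      (a * t) ^ (n + 1) * s ^ (n + 1) := by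
  have hst' : ∀ k : ℕ, s ^ k * t ^ k = 1 := fun k => by
    induction k with
    | zero => simp
    | succ k ih => rw [pow_succ, pow_succ', mul_assoc, ← mul_assoc s t, hst, one_mul, ih]
  induction n with
  | zero => simp [mul_assoc, hts]
  | succ n ih =>
    rw [List.range_succ, List.map_append, List.prod_append, ih, List.map_singleton,
      List.prod_singleton, mul_assoc, ← mul_assoc (s ^ (n + 1)), ← mul_assoc (s ^ (n + 1)), hst',
      one_mul, pow_succ (a * t) (n + 1), pow_succ' s (n + 1), ← mul_assoc, ← mul_assoc,
      mul_assoc _ _ s, mul_assoc a t s, hts, mul_one, mul_assoc]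

/-- Uniform continuity covers nearby points, boundedness distant ones. The affine form lets
closeness in mean pass through `g`. -/
lemma exists_dist_le_add_mul {g : ℝ → ℝ} (hg : Continuous g) (hgc : HasCompactSupport g) {ε : ℝ}
    (hε : 0 < ε) : ∃ C : ℝ, 0 ≤ C ∧ ∀ s t, dist (g s) (g t) ≤ ε + C * dist s t := by
  obtain ⟨C, hC⟩ := hgc.exists_bound_of_continuous hg
  obtain ⟨δ, hδ, h⟩ :=
    Metric.uniformContinuous_iff.1 (hgc.uniformContinuous_of_continuous hg)
    ε hε
  have hC0 : 0 ≤ C := (norm_nonneg _).trans (hC 0)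
  refine ⟨2 * C / δ, by positivity, fun s t => ?_⟩
  by_cases hst : dist s t < δ
  · have h1 : 0 ≤ 2 * C / δ * dist s t := by positivity
    linarith [h hst]
  · have h1 : dist (g s) (g t) ≤ 2 * C := by
      rw [dist_eq_norm]
      exact (norm_sub_le _ _).trans (by linarith [hC s, hC t])
    have h2 : 2 * C / δ * δ ≤ 2 * C / δ * dist s t := by
      gcongr
      exact not_lt.1 hst
    rw [div_mul_cancel₀ _ hδ.ne'] at h2
    linarith

/-- Random variables with a common law which become close in mean belong to a given set at the same
time with probability close to one. -/
lemma tendsto_measure_not_iff {Ω Z : Type*} [MeasurableSpace Ω] [MeasurableSpace Z]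
    {M : Measure Ω} [IsProbabilityMeasure M] {m : Measure Z} {ι : Z → ℝ}
    (hι : MeasurableEmbedding ι) {a b : ℕ → Ω → Z} (ha : ∀ n, MeasurePreserving (a n) M m)
    (hb : ∀ n, MeasurePreserving (b n) M m)
    (hab : Tendsto (fun n => ∫⁻ ω, edist (ι (a n ω)) (ι (b n ω)) ∂M) atTop (𝓝 0))
    {A : Set Z} (hA : MeasurableSet A) :
    Tendsto (fun n => M {ω | ¬ (a n ω ∈ A ↔ b n ω ∈ A)}) atTop (𝓝 0) := by
  have hm : IsProbabilityMeasure m := by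
    rw [← (ha 0).map_eq]
    exact Measure.isProbabilityMeasure_map (ha 0).measurable.aemeasurable
  have := Measure.isProbabilityMeasure_map (μ := m) hι.measurable.aemeasurable
  set f : ℝ → ℝ := (ι '' A).indicator fun _ => 1 with hf
  have hfm : Measurable f := measurable_const.indicator (hι.measurableSet_image.2 hA)
  have hfi : Integrable f (m.map ι) := (integrable_const 1).indicator (hι.measurableSet_image.2 hA)
  have hfA : ∀ z, f (ι z) = A.indicator (fun _ => 1) z := fun z => by
    by_cases hz : z ∈ A
    · rw [hf, Set.indicator_of_mem (Set.mem_image_of_mem ι hz), Set.indicator_of_mem hz]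
    · rw [hf, Set.indicator_of_notMem (by rwa [hι.injective.mem_set_image]),
        Set.indicator_of_notMem hz]
  have key : ∀ ε : ℝ, 0 < ε → ∀ᶠ n in atTop,
      M {ω | ¬ (a n ω ∈ A ↔ b n ω ∈ A)} ≤ 4 * ENNReal.ofReal ε := fun ε hε => by
    have hε' : 0 < ENNReal.ofReal ε := ENNReal.ofReal_pos.2 hε
    -- The indicator is approximated in `L¹` of the common law, so one `g` serves all the variables
    -- `a n` and `b n`.
    obtain ⟨g, hgc, hfg, hg, -⟩ := hfi.exists_hasCompactSupport_lintegral_sub_le hε'.ne'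
    obtain ⟨C, hC0, hC⟩ := exists_dist_le_add_mul hg hgc hε
    have hgm := hg.measurable
    have hιm := hι.measurable
    rw [lintegral_map (f := fun x => ‖f x - g x‖ₑ) (by fun_prop) hιm] at hfg
    have h1 : ∀ c : Ω → Z, MeasurePreserving c M m →
        ∫⁻ ω, edist (f (ι (c ω))) (g (ι (c ω))) ∂M ≤ ENNReal.ofReal ε := fun c hc => by
      have h2 := hc.lintegral_comp (f := fun z => ‖f (ι z) - g (ι z)‖ₑ) (by fun_prop)
      simp_rw [edist_eq_enorm_sub]
      rw [h2]
      exact hfg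
    have hlim := ENNReal.Tendsto.const_mul (a := ENNReal.ofReal C) hab
      (Or.inr ENNReal.ofReal_ne_top)
    rw [mul_zero] at hlim
    filter_upwards [(ENNReal.tendsto_nhds_zero.1 hlim) _ hε'] with n hn
    have ham := (ha n).measurable
    have hbm := (hb n).measurable
    have hD : MeasurableSet {ω | ¬ (a n ω ∈ A ↔ b n ω ∈ A)} := ((ham hA).iff (hbm hA)).compl
    calc M {ω | ¬ (a n ω ∈ A ↔ b n ω ∈ A)}
        ≤ ∫⁻ ω, edist (f (ι (a n ω))) (f (ι (b n ω))) ∂M := by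
          rw [← lintegral_indicator_one hD]
          refine lintegral_mono fun ω => ?_
          rw [hfA, hfA]
          by_cases h2 : a n ω ∈ A <;> by_cases h3 : b n ω ∈ A <;>
            simp [h2, h3, Set.indicator, edist_dist]
      _ ≤ ∫⁻ ω, (edist (f (ι (a n ω))) (g (ι (a n ω))) + (ENNReal.ofReal ε +
            ENNReal.ofReal C * edist (ι (a n ω)) (ι (b n ω))) +
            edist (f (ι (b n ω))) (g (ι (b n ω)))) ∂M := by
          refine lintegral_mono fun ω => ?_
          refine (edist_triangle4 _ (g (ι (a n ω))) (g (ι (b n ω))) _).trans ?_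
          rw [edist_comm (g (ι (b n ω))) (f _)]
          gcongr
          rw [edist_dist, edist_dist, ← ENNReal.ofReal_mul hC0, ← ENNReal.ofReal_add hε.le
            (by positivity)]
          exact ENNReal.ofReal_le_ofReal (hC _ _)
      _ ≤ ENNReal.ofReal ε + (ENNReal.ofReal ε + ENNReal.ofReal ε) + ENNReal.ofReal ε := by
          rw [lintegral_add_right _ (by fun_prop), lintegral_add_right _ (by fun_prop),
            lintegral_add_right _ (by fun_prop), lintegral_const, measure_univ, mul_one,
            lintegral_const_mul _ (by fun_prop)]
          gcongr
          · exact h1 _ (ha n)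
          · exact h1 _ (hb n)
      _ = _ := by ring
  rw [ENNReal.tendsto_nhds_zero]
  intro ε hε
  by_cases hεt : ε = ∞
  · exact Eventually.of_forall fun n => hεt ▸ le_top
  · have h1 : 0 < ε.toReal / 4 := div_pos (ENNReal.toReal_pos hε.ne' hεt) (by norm_num)
    filter_upwards [key _ h1] with n hn
    refine hn.trans (le_of_eq ?_)
    rw [← ENNReal.ofReal_ofNat, ← ENNReal.ofReal_mul (by norm_num), mul_div_cancel₀ _ (by norm_num),
      ENNReal.ofReal_toReal hεt]

/-! ### Products with invertible maps. -/

namespace Polymorphism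

section Algebra

variable {X : Type*} [MeasurableSpace X] [StandardBorelSpace X] [Nonempty X]
  {μ : Measure X} [IsProbabilityMeasure μ]

lemma mul_bistochastic_prod (P Q : Polymorphism μ) {A B : Set X} (hA : MeasurableSet A)
    (hB : MeasurableSet B) : (P * Q).bistochastic (A ×ˢ B) =
      ∫⁻ p, A.indicator 1 p.1 * P.value p.2 B ∂Q.bistochastic := by
  have hA' : Measurable (A.indicator (1 : X → ℝ≥0∞)) := measurable_one.indicator hA
  have hB' : Measurable (B.indicator (1 : X → ℝ≥0∞)) := measurable_one.indicator hB
  have hP := P.value.measurable_coe hB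
  have h1 : ∀ x z : X, (A ×ˢ B).indicator (1 : X × X → ℝ≥0∞) (x, z) =
      A.indicator 1 x * B.indicator 1 z := fun x z => by
    by_cases h : x ∈ A <;> by_cases h' : z ∈ B <;> simp [h, h', Set.indicator]
  rw [← lintegral_indicator_one (hA.prod hB), lintegral_mul_bistochastic _ _
    (measurable_one.indicator (hA.prod hB)), lintegral_bistochastic _ (by fun_prop)]
  simp_rw [h1, lintegral_const_mul _ hB', lintegral_indicator_one hB]

/-- Substitute `x = g x'` in the law of `x` and a `Q`-step from `f x`: the step then starts at `x'`.
-/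
lemma mul_ofMap_bistochastic (Q : Polymorphism μ) {f g : X → X} (hf : MeasurePreserving f μ μ)
    (hg : MeasurePreserving g μ μ) (hfg : ∀ x, f (g x) = x) :
    (Q * ofMap f hf).bistochastic = Q.bistochastic.map (Prod.map g id) := by
  have hgm := hg.measurable
  refine Measure.ext_prod_iff.2 fun {A B} hA hB => ?_
  have hA' : Measurable (A.indicator (1 : X → ℝ≥0∞)) := measurable_one.indicator hA
  have hB' : Measurable (B.indicator (1 : X → ℝ≥0∞)) := measurable_one.indicator hB
  have hQ := Q.value.measurable_coe hB
  have hfm := hf.measurable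
  rw [mul_bistochastic_prod _ _ hA hB]
  change ∫⁻ p, A.indicator 1 p.1 * Q.value p.2 B ∂(μ.map fun x => (x, f x)) = _
  have h1 := hg.lintegral_comp (f := fun x => A.indicator 1 x * Q.value (f x) B) (by fun_prop)
  have h2 : ∀ x z : X, (Prod.map g id ⁻¹' (A ×ˢ B)).indicator (1 : X × X → ℝ≥0∞) (x, z) =
      A.indicator 1 (g x) * B.indicator 1 z := fun x z => by
    by_cases h : g x ∈ A <;> by_cases h' : z ∈ B <;> simp [h, h', Set.indicator]
  have h3 : MeasurableSet (Prod.map g (id : X → X) ⁻¹' (A ×ˢ B)) :=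
    (hgm.prodMap measurable_id) (hA.prod hB)
  rw [lintegral_map (by fun_prop) (by fun_prop), ← h1, Measure.map_apply (by fun_prop) (hA.prod hB),
    ← lintegral_indicator_one h3, lintegral_bistochastic _ (measurable_one.indicator h3)]
  simp_rw [h2, hfg, lintegral_const_mul _ hB', lintegral_indicator_one hB]

lemma ofMap_mul_ofMap {f g : X → X} (hf : MeasurePreserving f μ μ)
    (hg : MeasurePreserving g μ μ) (hfg : ∀ x, f (g x) = x) : ofMap g hg * ofMap f hf = 1 := by
  ext1
  have hgm := hg.measurable
  rw [mul_ofMap_bistochastic _ hf hg hfg]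
  change (μ.map fun x => (x, g x)).map (Prod.map g id) = μ.map fun x => (x, id x)
  rw [Measure.map_map (by fun_prop) (by fun_prop)]
  conv_rhs => rw [← hg.map_eq, Measure.map_map (by fun_prop) hgm]
  rfl

lemma mul_ofMap_pow_bistochastic (Q : Polymorphism μ) {f g : X → X}
    (hf : MeasurePreserving f μ μ) (hg : MeasurePreserving g μ μ) (hfg : ∀ x, f (g x) = x)
    (n : ℕ) : (Q * ofMap f hf ^ n).bistochastic = Q.bistochastic.map (Prod.map g^[n] id) := by
  have hgm := hg.measurable
  induction n with
  | zero =>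
    rw [pow_zero, mul_one, Function.iterate_zero, Prod.map_id, Measure.map_id]
  | succ n ih =>
    have hgn : Measurable g^[n] := hgm.iterate n
    rw [pow_succ, ← mul_assoc, mul_ofMap_bistochastic _ hf hg hfg, ih,
      Measure.map_map (by fun_prop) (by fun_prop), Prod.map_comp_map, Function.iterate_succ',
      Function.id_comp]

end Algebra

end Polymorphism

/-! ### The isomorphism and the limit polymorphism. -/

namespace Polymorphism

section Isomorphism

variable {X : Type*} [MeasurableSpace X] [StandardBorelSpace X] [Nonempty X]
  {μ : Measure X} [IsProbabilityMeasure μ]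

/-- The left shift as a measurable equivalence. -/
def shiftEquiv (W : Type*) [MeasurableSpace W] : (ℤ → W) ≃ᵐ (ℤ → W) where
  toFun := shiftBy 1
  invFun := shiftBy (-1)
  left_inv y := by rw [shiftBy_shiftBy, neg_add_cancel, shiftBy_zero]
  right_inv y := by rw [shiftBy_shiftBy, add_neg_cancel, shiftBy_zero]
  measurable_toFun := measurable_shiftBy 1
  measurable_invFun := measurable_shiftBy (-1)

/-- The quotient by the tail of the past is asymptotically coupled to the state space. -/
lemma isAsymptoticCoupling_map (P : Polymorphism μ) {Z : Type*} [MeasurableSpace Z]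
    {q : (ℤ → X) → ℤ → Z} (hq : Measurable[pastTail X] q)
    (hqs : ∀ n y, q (shiftBy n y) = shiftBy n (q y)) {ι : (ℤ → Z) → ℝ} (hι : Measurable ι)
    (hι01 : ∀ z, ι z ∈ Set.Icc (0 : ℝ) 1) :
    IsAsymptoticCoupling μ (P.markovMeasure.map q)
      (fun n => P.pastMean ((fun y => ι (q y)) ∘ shiftBy n)) (fun n z => ι (shiftBy n z))
      (P.markovMeasure.map fun y => (y 0, q y)) := by
  have hq' : Measurable q := hq.mono pastTail_le le_rfl
  have hm : Measurable fun y : ℤ → X => (y 0, q y) := by fun_prop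
  have hF : Measurable[pastTail X] fun y => ι (q y) := hι.comp hq
  refine ⟨?_, ?_, ?_⟩
  · rw [Measure.fst, Measure.map_map measurable_fst hm]
    exact (P.measurePreserving_eval 0).map_eq
  · rw [Measure.snd, Measure.map_map measurable_snd hm]
    rfl
  · refine (P.tendsto_lintegral_edist_pastMean hF fun y => hι01 _).congr fun n => ?_
    have hu := P.measurable_pastMean (hF.comp (measurable_shiftBy_pastTail n))
    have hs := measurable_shiftBy (X := Z) n
    rw [lintegral_map (f := fun p : X × (ℤ → Z) => edist (P.pastMean ((fun y => ι (q y)) ∘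
      shiftBy n) p.1) (ι (shiftBy n p.2))) (by fun_prop) hm]
    simp_rw [hqs]

/-- A prime polymorphism that is not mixing has a state space isomorphic to the quotient by the tail
of the past, in such a way that the powers of the corresponding automorphism, applied to the state
at time `0`, asymptotically agree with the shifted tail. -/
lemma IsPrime.exists_isTailIsomorphism [NullSingletonClass μ] {P : Polymorphism μ} (hP : P.IsPrime)
    (hmix : ¬ P.IsMixing) :
    ∃ (q : (ℤ → X) → X) (T : X ≃ᵐ X), MeasurePreserving T μ μ ∧ P.IsTailIsomorphism q ∧
      (∀ y, T (q y) = q (leftShift y)) ∧ ∀ A, MeasurableSet A →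
        Tendsto (fun n : ℕ => P.markovMeasure {y | ¬ (T^[n] (y 0) ∈ A ↔ q (shiftBy n y) ∈ A)})
          atTop (𝓝 0) := by
  obtain ⟨q₀, hq₀, hqs, hgen⟩ := P.exists_equivariant_tail_map
  have hq₀' : Measurable q₀ := hq₀.mono pastTail_le le_rfl
  have hm := Measure.isProbabilityMeasure_map (μ := P.markovMeasure) hq₀'.aemeasurable
  have hnull := hP.nullSingletonClass_map hmix hq₀ hqs hgen
  obtain ⟨ι, hι, hι01⟩ := exists_measurableEmbedding_Icc (ℤ → ℚ → ℝ≥0∞)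
  have hι01' : ∀ z, ι z ∈ Set.Icc (0 : ℝ) 1 := fun z => Set.Ioo_subset_Icc_self (hι01 z)
  have hF : Measurable[pastTail X] fun y => ι (q₀ y) := hι.measurable.comp hq₀
  have hpm : ∀ n : ℕ, Measurable (P.pastMean ((fun y => ι (q₀ y)) ∘ shiftBy n)) := fun n =>
    P.measurable_pastMean (hF.comp (measurable_shiftBy_pastTail n))
  have hιm := hι.measurable
  have hpair : Measurable fun y : ℤ → X => (y 0, q₀ y) := by fun_prop
  obtain ⟨R, hR, hlim⟩ := (P.isAsymptoticCoupling_map hq₀ hqs hι.measurable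
    hι01').exists_measurableEquiv hpm (fun n => hι.measurable.comp (measurable_shiftBy n))
    (fun n => P.pastMean_mem_Icc fun y => hι01' _) (fun n z => hι01' _)
    (fun A B hA hB h => hP.measure_eq_zero_or_of_tail hA (hq₀ hB)
      (ae_of_ae_map hpair.aemeasurable h))
  have hT0 : ∀ n : ℤ, MeasurePreserving (shiftBy n) (P.markovMeasure.map q₀)
    (P.markovMeasure.map q₀) := P.measurePreserving_shiftBy_map hq₀' hqs
  have hRsymm := hR.symm R
  -- `T` is the shift of the tail quotient, transported to `X` by `R`.
  let T : X ≃ᵐ X := R.trans ((shiftEquiv (ℚ → ℝ≥0∞)).trans R.symm)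
  have hT : ∀ x, T x = R.symm (shiftBy 1 (R x)) := fun x => rfl
  have hTn : ∀ (n : ℕ) x, T^[n] x = R.symm (shiftBy n (R x)) := fun n => by
    induction n with
    | zero => intro x; simp [shiftBy_zero]
    | succ n ih =>
      intro x
      rw [Function.iterate_succ_apply, ih, hT, R.apply_symm_apply, shiftBy_shiftBy, Nat.cast_succ]
  have hqM : MeasurePreserving q₀ P.markovMeasure (P.markovMeasure.map q₀) := ⟨hq₀', rfl⟩
  refine ⟨fun y => R.symm (q₀ y), T, hRsymm.comp ((hT0 1).comp hR), ⟨R.symm.measurable.comp hq₀,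
    (hRsymm.comp hqM).map_eq, fun F hF => ?_⟩, fun y => ?_, fun A hA => ?_⟩
  · obtain ⟨B, hB, hFB⟩ := hgen F hF
    refine ⟨R ⁻¹' B, R.measurable hB, ?_⟩
    simpa only [Set.preimage_preimage, R.apply_symm_apply] using hFB
  · change T (R.symm (q₀ y)) = R.symm (q₀ (shiftBy 1 y))
    rw [hT, R.apply_symm_apply, hqs]
  · have hRm := R.measurable
    have h1 := tendsto_measure_not_iff hι (a := fun (n : ℕ) (y : ℤ → X) => shiftBy n (R (y 0)))
      (b := fun (n : ℕ) y => q₀ (shiftBy n y))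
      (fun n => (hT0 n).comp (hR.comp (P.measurePreserving_eval 0)))
      (fun n => hqM.comp (P.measurePreserving_shiftBy n)) ?_ (R.symm.measurable hA)
    · refine h1.congr fun n => ?_
      simp only [hTn, Set.mem_preimage]
    -- Both quantities are compared with the conditional mean at `y 0`: one through `R`, the other
    -- through the original coupling.
    · have h2 := hlim.add (P.tendsto_lintegral_edist_pastMean hF fun y => hι01' _)
      rw [add_zero] at h2
      refine tendsto_of_tendsto_of_tendsto_of_le_of_le tendsto_const_nhds h2
        (fun n => zero_le) fun n => ?_
      have hu := hpm n
      have hs := measurable_shiftBy (X := X) n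
      have hs' := measurable_shiftBy (X := ℚ → ℝ≥0∞) n
      simp only
      rw [← (P.measurePreserving_eval 0).lintegral_comp (f := fun x => edist (P.pastMean
        ((fun y => ι (q₀ y)) ∘ shiftBy n) x) (ι (shiftBy n (R x)))) (by fun_prop),
        ← lintegral_add_left (by fun_prop)]
      refine lintegral_mono fun y => ?_
      refine (edist_triangle _ (P.pastMean ((fun y => ι (q₀ y)) ∘ shiftBy n) (y 0)) _).trans ?_
      rw [edist_comm (ι _)]

/-- The polymorphism that corresponds to the conditional distribution of the state at time `0` given
a tail function with values in the state space. -/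
def tailPoly (P : Polymorphism μ) (q : (ℤ → X) → X) (hq : P.IsTailIsomorphism q) :
    Polymorphism μ where
  bistochastic := P.markovMeasure.map fun y => (q y, y 0)
  fst_eq := by
    have hq' : Measurable q := hq.measurable.mono pastTail_le le_rfl
    rw [Measure.fst, Measure.map_map measurable_fst (by fun_prop)]
    exact hq.map_eq
  snd_eq := by
    have hq' : Measurable q := hq.measurable.mono pastTail_le le_rfl
    rw [Measure.snd, Measure.map_map measurable_snd (by fun_prop)]
    exact (P.measurePreserving_eval 0).map_eq

variable {P : Polymorphism μ} {q : (ℤ → X) → X}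

/-- Tail sets are mod 0 preimages under `q`, so the disintegration over `q` has the defining
property of the conditional distribution. A countable π-system makes the exceptional null set
independent of the set tested. -/
lemma tailPoly_value (hq : P.IsTailIsomorphism q) :
    ∀ᵐ y ∂P.markovMeasure, (P.tailPoly q hq).value (q y) = P.tailValue y := by
  have hq' : Measurable q := hq.measurable.mono pastTail_le le_rfl
  obtain ⟨C, hC, hpi, hgen⟩ := exists_countable_isPiSystem X
  have h0 : Measurable fun z : ℤ → X => z 0 := measurable_pi_apply 0
  have key : ∀ B, MeasurableSet B → ∀ᵐ y ∂P.markovMeasure,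
      (P.tailPoly q hq).value (q y) B = P.tailValue y B := fun B hB => by
    have hv := (P.tailPoly q hq).value.measurable_coe hB
    have h1 := condExpKernel_ae_eq_condExp (μ := P.markovMeasure) pastTail_le (h0 hB)
    have h2 : (fun y => ((P.tailPoly q hq).value (q y) B).toReal) =ᵐ[P.markovMeasure]
        P.markovMeasure[((fun z : ℤ → X => z 0) ⁻¹' B).indicator fun _ => (1 : ℝ) |
          pastTail X] := by
      refine ae_eq_condExp_of_forall_setIntegral_eq pastTail_le
        ((integrable_const 1).indicator (h0 hB)) (fun s hs _ => ?_) (fun s hs _ => ?_) ?_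
      · refine (Integrable.of_bound (hv.comp hq').ennreal_toReal.aestronglyMeasurable 1
          (ae_of_all _ fun y => ?_)).integrableOn
        rw [Real.norm_eq_abs, abs_of_nonneg ENNReal.toReal_nonneg]
        exact measureReal_le_one
      · obtain ⟨A, hA, hsA⟩ := hq.generates s hs
        have hvq : Measurable fun y => (P.tailPoly q hq).value (q y) B := hv.comp hq'
        rw [setIntegral_congr_set hsA, setIntegral_congr_set hsA,
          integral_indicator_const _ (h0 hB), integral_toReal hvq.aemeasurable
            (ae_of_all _ fun y => measure_lt_top _ _), smul_eq_mul, mul_one, Measure.real]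
        congr 1
        rw [Measure.restrict_apply (h0 hB), MeasurePreserving.setLIntegral_comp_preimage
          ⟨hq', hq.map_eq⟩ hA hv, ← Measure.compProd_apply_prod hA hB, compProd_value]
        change (P.markovMeasure.map fun y => (q y, y 0)) (A ×ˢ B) = _
        rw [Measure.map_apply (hq'.prodMk h0) (hA.prod hB), Set.inter_comm]
        rfl
      · refine StronglyMeasurable.aestronglyMeasurable ?_
        exact ((hv.comp hq.measurable).ennreal_toReal).stronglyMeasurable
    filter_upwards [h1, h2] with y hy hy'
    rw [tailValue, Measure.map_apply h0 hB]
    refine (ENNReal.toReal_eq_toReal_iff' (measure_ne_top _ _) (measure_ne_top _ _)).1 ?_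
    exact hy'.trans hy.symm
  filter_upwards [ae_all_iff.2 fun r => key (C r) (hC r)] with y hy
  have : IsProbabilityMeasure (P.tailValue y) :=
    Measure.isProbabilityMeasure_map h0.aemeasurable
  refine ext_of_generate_finite _ hgen hpi ?_ (by simp)
  rintro _ ⟨r, rfl⟩
  exact hy r

/-- Both products are the law of `(q y, y 1)`: the left by stationarity, the right by the Markov
property at time 0. -/
lemma tailPoly_mul_ofMap (hq : P.IsTailIsomorphism q) {T : X ≃ᵐ X} (hT : MeasurePreserving T μ μ)
    (hTq : ∀ y, T (q y) = q (leftShift y)) :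
    P.tailPoly q hq * ofMap T hT = P * P.tailPoly q hq := by
  have hq' : Measurable q := hq.measurable.mono pastTail_le le_rfl
  have hTm := T.symm.measurable
  ext1
  rw [mul_ofMap_bistochastic _ hT (hT.symm T) T.apply_symm_apply]
  change (P.markovMeasure.map fun y => (q y, y 0)).map (Prod.map T.symm id) = _
  rw [Measure.map_map (by fun_prop) (by fun_prop)]
  conv_lhs => rw [← P.measurePreserving_leftShift.map_eq]
  rw [Measure.map_map (by fun_prop) P.measurePreserving_leftShift.measurable]
  have h1 : (Prod.map T.symm id ∘ fun y : ℤ → X => (q y, y 0)) ∘ leftShift =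
      fun y => (q y, y 1) := by
    funext y
    refine Prod.ext ?_ rfl
    change T.symm (q (leftShift y)) = q y
    rw [← hTq, T.symm_apply_apply]
  rw [h1]
  have hm : Measurable fun y : ℤ → X => (q y, y 1) := by fun_prop
  have := Measure.isProbabilityMeasure_map (μ := P.markovMeasure) hm.aemeasurable
  refine Measure.ext_prod_iff.2 fun {A B} hA hB => ?_
  have hA' : Measurable (A.indicator (1 : X → ℝ≥0∞)) := measurable_one.indicator hA
  have hB' : Measurable (B.indicator (1 : X → ℝ≥0∞)) := measurable_one.indicator hB
  have hP := P.value.measurable_coe hB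
  have h2 := P.lintegral_eval_mul_back 1 (g := fun w => A.indicator 1 (q (unback w))) hB'
    (hA'.comp (measurable_apply_unback hq.measurable))
  simp_rw [apply_unback_back hq.measurable, pow_one, lintegral_indicator_one hB] at h2
  rw [mul_bistochastic_prod _ _ hA hB]
  change _ = ∫⁻ p, A.indicator 1 p.1 * P.value p.2 B ∂(P.markovMeasure.map fun y => (q y, y 0))
  rw [lintegral_map (by fun_prop) (by fun_prop), Measure.map_apply hm (hA.prod hB),
    ← lintegral_indicator_one (hm (hA.prod hB))]
  refine Eq.trans (lintegral_congr fun y => ?_) (h2.trans (lintegral_congr fun y => mul_comm _ _))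
  by_cases h : q y ∈ A <;> by_cases h' : y 1 ∈ B <;> simp [h, h', Set.indicator]

/-- The laws compared are those of `(T^[n] (y 0), y n)` and `(q (shiftBy n y), y n)`. The second
components coincide, so the error is at most the probability that exactly one first component lies
in `A`. -/
lemma tendsWeakly_tailPoly (hq : P.IsTailIsomorphism q) {T : X ≃ᵐ X}
    (hT : MeasurePreserving T μ μ)
    (hlim : ∀ A, MeasurableSet A → Tendsto (fun n : ℕ => P.markovMeasure
      {y | ¬ (T^[n] (y 0) ∈ A ↔ q (shiftBy n y) ∈ A)}) atTop (𝓝 0)) :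
    TendsWeakly (fun n => P ^ n * ofMap T.symm (hT.symm T) ^ n) (P.tailPoly q hq) := by
  intro A B hA hB
  have hq' : Measurable q := hq.measurable.mono pastTail_le le_rfl
  have hTm := T.measurable
  have h1 := (ENNReal.tendsto_toReal ENNReal.zero_ne_top).comp (hlim A hA)
  rw [tendsto_iff_dist_tendsto_zero]
  refine squeeze_zero (fun n => dist_nonneg) (fun n => ?_) h1
  have hTn : Measurable T^[n] := hTm.iterate n
  have hs := measurable_shiftBy (X := X) n
  have h2 : (P ^ n * ofMap T.symm (hT.symm T) ^ n).bistochastic.real (A ×ˢ B) =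
      P.markovMeasure.real {y | T^[n] (y 0) ∈ A ∧ y n ∈ B} := by
    rw [Measure.real, mul_ofMap_pow_bistochastic _ (hT.symm T) hT T.symm_apply_apply,
      ← markovMeasure_map_pair, Measure.map_map (by fun_prop) (by fun_prop),
      Measure.map_apply (by fun_prop) (hA.prod hB)]
    rfl
  have h3 : (P.tailPoly q hq).bistochastic.real (A ×ˢ B) =
      P.markovMeasure.real {y | q (shiftBy n y) ∈ A ∧ y n ∈ B} := by
    change (P.markovMeasure.map fun y => (q y, y 0)).real (A ×ˢ B) = _
    conv_lhs => rw [← (P.measurePreserving_shiftBy n).map_eq]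
    rw [Measure.real, Measure.map_map (by fun_prop) hs,
      Measure.map_apply (by fun_prop) (hA.prod hB)]
    congr 2
    ext y
    simp [shiftBy]
  rw [h2, h3, Real.dist_eq]
  refine (abs_measureReal_sub_le_measureReal_symmDiff (μ := P.markovMeasure) ?_ ?_).trans ?_
  · exact ((hTn.comp (measurable_pi_apply 0) hA).inter
      (measurable_pi_apply (n : ℤ) hB)).nullMeasurableSet
  · exact ((hq'.comp hs hA).inter (measurable_pi_apply (n : ℤ) hB)).nullMeasurableSet
  · refine measureReal_mono ?_
    rintro y (⟨⟨hy1, hy2⟩, hy3⟩ | ⟨⟨hy1, hy2⟩, hy3⟩)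
    · exact fun h => hy3 ⟨h.1 hy1, hy2⟩
    · exact fun h => hy3 ⟨h.2 hy1, hy2⟩

end Isomorphism

end Polymorphism

end

theorem mainTheorem2 {X : Type*} [MeasurableSpace X] [StandardBorelSpace X] [Nonempty X]
    (μ : Measure X) [IsProbabilityMeasure μ] [NullSingletonClass μ]
    (P : Polymorphism μ) (hprime : P.IsPrime) (hnonmixing : ¬ P.IsMixing) :
    ∃ (q : (ℤ → X) → X) (T : X ≃ᵐ X) (hT : MeasurePreserving T μ μ) (Λ : Polymorphism μ),
      P.IsTailIsomorphism q ∧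
      (∀ᵐ y ∂P.markovMeasure, T (q y) = q (Polymorphism.leftShift y)) ∧
      (∀ᵐ y ∂P.markovMeasure, Λ.value (q y) = P.tailValue y) ∧
      Λ * Polymorphism.ofMap T hT = P * Λ ∧
      Polymorphism.TendsWeakly
        (fun n => P ^ n * Polymorphism.ofMap T.symm (hT.symm T) ^ n) Λ ∧
      (∃ Φ : Polymorphism μ, P = Φ * Polymorphism.ofMap T hT) ∧
      ∀ Φ : Polymorphism μ, P = Φ * Polymorphism.ofMap T hT →
        Polymorphism.TendsWeakly (fun n => Φ.conjProd T hT n) Λ := by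
  obtain ⟨q, T, hT, hq, hTq, hlim⟩ := hprime.exists_isTailIsomorphism hnonmixing
  have hst : Polymorphism.ofMap T.symm (hT.symm T) * Polymorphism.ofMap T hT = 1 :=
    Polymorphism.ofMap_mul_ofMap hT (hT.symm T) T.apply_symm_apply
  have hts : Polymorphism.ofMap T hT * Polymorphism.ofMap T.symm (hT.symm T) = 1 :=
    Polymorphism.ofMap_mul_ofMap (hT.symm T) hT T.symm_apply_apply
  have hweak := Polymorphism.tendsWeakly_tailPoly hq hT hlim
  refine ⟨q, T, hT, P.tailPoly q hq, hq, ae_of_all _ hTq, Polymorphism.tailPoly_value hq,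
    Polymorphism.tailPoly_mul_ofMap hq hT hTq, hweak,
    ⟨P * Polymorphism.ofMap T.symm (hT.symm T), by rw [mul_assoc, hst, mul_one]⟩,
    fun Φ hΦ A B hA hB => ?_⟩
  -- The partial product up to index `n` has `n + 1` factors and equals the term `n + 1` of the
  -- other sequence.
  refine ((hweak A B hA hB).comp (tendsto_add_atTop_nat 1)).congr fun n => ?_
  simp only [Function.comp_apply, Polymorphism.conjProd]
  rw [prod_range_conj hst hts, ← hΦ]
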